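/- **Setting.** A chain of $g$ loops with bridges is the metric graph $\Gamma$ with vertices $w_0,\dots,w_g$ and $v_1,\dots,v_{g+1}$, where for $1\le k\le g$ the vertices $v_k$ and $w_k$ are joined by a top edge of length $\ell_k>0$ and a bottom edge of length $m_k>0$ (the $k$th loop), and for $0\le k\le g$ a bridge of length $n_k>0$ joins $w_k$ to $v_{k+1}$. Given integers $r,s$ with $g\ge (r+1)s$ and a real number $C$, the edge lengths are called *$C$-admissible* if - $4g\,m_k<\ell_k$ and $C\,\ell_k\le\min\{n_{k-1},n_k\}$ for $1\le k\le g$; - there is no nontrivial relation $c_1m_1+\dots+c_gm_g=0$ with integers $|c_k|\le g+1$; - $C\Big(\sum_{i=\alpha s+1}^{(\alpha+1)s}\ell_i+\sum_{i=\alpha s+1}^{(\alpha+1)s-1}n_i\Big)\le\min\{n_{\alpha s},n_{(\alpha+1)s}\}$ for $0\le\alpha\le r$. $\operatorname{PL}(\Gamma)$ is the set of continuous piecewise linear functions with integral slopes, $\operatorname{div}\psi$ has at each point the sum of the incoming slopes of $\psi$ as coefficient, $D\sim D'$ means $D'=D+\operatorname{div}\psi$ for some $\psi\in\operatorname{PL}(\Gamma)$,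 and rank is Baker–Norine rank. The class of a divisor $D$ of rank $r$ is *vertex avoiding* if for every $0\le i\le r$ there is a unique effective divisor $D_i\sim D$ with exactly $i$ chips at $w_0$ and exactly $r-i$ chips at $v_{g+1}$, and $D_i$ has no chips at $v_1,w_1,\dots,v_g,w_g$. For a multiset $I\subset\{0,\dots,r\}$ of size $m$, let $\psi_I\in\operatorname{PL}(\Gamma)$ be a function (unique up to an additive constant) with $mD+\operatorname{div}\psi_I=\sum_{i\in I}D_i$. Functions $\{\psi_I\}_{I\in\mathcal A}$ are *tropically independent* if there are no real numbers $b_I$ such that the minimum of the $\psi_I(v)+b_I$, $I\in\mathcal A$, occurs at least twice at every point $v\in\Gamma$. For integers $r\ge 3$, $s\ge1$, $\rho\ge0$, $m\ge1$ put $g=(r+1)s+\rho$ and $d=g+r-s$. One says that *the tropical maximal rank conjecture holds for $(r,s,\rho,m)$* if there is a constant $C$, depending only on $(r,s,\rho,m)$, such that on every chain of $g$ loops with $C$-admissible edge lengths there is a divisor $D$ of degree $d$ and rank $r$ whose class is vertex avoiding, and a set $\mathcal A$ of multisets $I\subset\{0,\dots,r\}$ of size $m$, with $$|\mathcal A|=\min\left\{\binom{r+m}{m},\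 md-g+1\right\},$$ such that $\{\psi_I\}_{I\in\mathcal A}$ is tropically independent. The parameters are in the *injective range* if $\binom{r+m}{m}\le md-g+1$ and in the *surjective range* if $\binom{r+m}{m}\ge md-g+1$. **Theorem 1.3.** Let $r\ge3$, $s\ge1$ and $\rho\ge0$ be integers. 1. If $s\ge r^2/4$, then $(r,s,\rho,3)$ is in the injective range and the tropical maximal rank conjecture holds for $(r,s,\rho,3)$. 2. If $\rho=0$ and $r\ge s+1$, then $(r,s,0,3)$ is in the surjective range and the tropical maximal rank conjecture holds for $(r,s,0,3)$. -/

import Mathlib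

open Filter Topology

/-- A metric graph given by a model: vertices `V`, edges `E`, each edge `e` being a segment of
length `len e` that starts at `src e` and ends at `tgt e` (the orientation is only a coordinate). -/
structure MetricGraph (V E : Type) where
  src : E → V
  tgt : E → V
  len : E → ℝ
  len_pos : ∀ e, 0 < len e

namespace MetricGraph

/-- The points of the metric graph: the vertices and the interior points of the edges. -/
inductive Point {V E : Type} (Γ : MetricGraph V E) : Type
  | vertex (x : V) : Point Γ
  | inner (e : E) (t : ℝ) (pos : 0 < t) (lt : t < Γ.len e) : Point Γ

open Classical in
/-- The point at distance `t` from the start of the edge `e`, for `0 ≤ t ≤ len e`. -/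
noncomputable def onEdge {V E : Type} (Γ : MetricGraph V E) (e : E) (t : ℝ) : Γ.Point :=
  if h₀ : 0 < t then
    if h₁ : t < Γ.len e then Point.inner e t h₀ h₁ else Point.vertex (Γ.tgt e)
  else Point.vertex (Γ.src e)

/-- Near the point of `e` at coordinate `t`, in the direction of `tgt e`, the function `f` is
affine with (outgoing) slope `k`. -/
def HasSlopeForward {V E : Type} (Γ : MetricGraph V E) (f : Γ.Point → ℝ) (e : E) (t : ℝ)
    (k : ℤ) : Prop :=
  ∀ᶠ h in 𝓝[>] (0 : ℝ), f (Γ.onEdge e (t + h)) = f (Γ.onEdge e t) + k * h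

/-- Near the point of `e` at coordinate `t`, in the direction of `src e`, the function `f` is
affine with (outgoing) slope `k`. -/
def HasSlopeBackward {V E : Type} (Γ : MetricGraph V E) (f : Γ.Point → ℝ) (e : E) (t : ℝ)
    (k : ℤ) : Prop :=
  ∀ᶠ h in 𝓝[>] (0 : ℝ), f (Γ.onEdge e (t - h)) = f (Γ.onEdge e t) + k * h

/-- `f ∈ PL(Γ)`: continuous and piecewise linear with integral slopes.  Every point, and every
tangent direction at it, has a segment on which `f` is affine with integral slope; since the edges
are compact, finitely many such segments cover each of them, and `f` is continuous. -/
def IsPL {V E : Type} (Γ : MetricGraph V E) (f : Γ.Point → ℝ) : Prop :=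
  ∀ e : E,
    (∀ t : ℝ, 0 ≤ t → t < Γ.len e → ∃ k : ℤ, Γ.HasSlopeForward f e t k) ∧
    (∀ t : ℝ, 0 < t → t ≤ Γ.len e → ∃ k : ℤ, Γ.HasSlopeBackward f e t k)

open Classical in
/-- The outgoing slope of `f` at coordinate `t` of `e` towards `tgt e`. -/
noncomputable def slopeForward {V E : Type} (Γ : MetricGraph V E) (f : Γ.Point → ℝ) (e : E)
    (t : ℝ) : ℤ :=
  if h : ∃ k : ℤ, Γ.HasSlopeForward f e t k then h.choose else 0

open Classical in
/-- The outgoing slope of `f` at coordinate `t` of `e` towards `src e`. -/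
noncomputable def slopeBackward {V E : Type} (Γ : MetricGraph V E) (f : Γ.Point → ℝ) (e : E)
    (t : ℝ) : ℤ :=
  if h : ∃ k : ℤ, Γ.HasSlopeBackward f e t k then h.choose else 0

open Classical in
/-- The coefficient of `div f` at a point: the sum of the incoming slopes of `f`, that is, minus
the sum of the outgoing slopes over all tangent directions. -/
noncomputable def ord {V E : Type} [Fintype E] (Γ : MetricGraph V E) (f : Γ.Point → ℝ) :
    Γ.Point → ℤ
  | Point.vertex x =>
      -∑ e : E, ((if Γ.src e = x then Γ.slopeForward f e 0 else 0) +
        (if Γ.tgt e = x then Γ.slopeBackward f e (Γ.len e) else 0))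
  | Point.inner e t _ _ => -(Γ.slopeForward f e t + Γ.slopeBackward f e t)

/-- Divisors: finite formal integer combinations of points. -/
abbrev Divisor {V E : Type} (Γ : MetricGraph V E) : Type := Γ.Point →₀ ℤ

/-- The degree of a divisor. -/
def deg {V E : Type} {Γ : MetricGraph V E} (D : Γ.Divisor) : ℤ := D.sum fun _ a => a

/-- `f ∈ PL(Γ)` and `D + div f = D'`. -/
def MovesTo {V E : Type} [Fintype E] {Γ : MetricGraph V E} (f : Γ.Point → ℝ)
    (D D' : Γ.Divisor) : Prop :=
  Γ.IsPL f ∧ ∀ p, D' p = D p + Γ.ord f p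

/-- Linear equivalence of divisors. -/
def LinEquiv {V E : Type} [Fintype E] {Γ : MetricGraph V E} (D D' : Γ.Divisor) : Prop :=
  ∃ f : Γ.Point → ℝ, MovesTo f D D'

/-- The Baker–Norine rank of `D` is at least `k`: for every effective divisor `F` of degree `k`,
the divisor `D - F` is linearly equivalent to an effective one. -/
def RankAtLeast {V E : Type} [Fintype E] {Γ : MetricGraph V E} (D : Γ.Divisor) (k : ℕ) : Prop :=
  ∀ F : Γ.Divisor, 0 ≤ F → deg F = k → ∃ D' : Γ.Divisor, 0 ≤ D' ∧ LinEquiv (D - F) D'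

/-- The Baker–Norine rank of `D` is exactly `r`. -/
def HasRank {V E : Type} [Fintype E] {Γ : MetricGraph V E} (D : Γ.Divisor) (r : ℕ) : Prop :=
  RankAtLeast D r ∧ ¬ RankAtLeast D (r + 1)

end MetricGraph

/-- The functions `f i`, `i ∈ A`, are tropically dependent: for some real constants `b i`, the
minimum of the `f i x + b i` occurs at least twice at every point `x`. -/
def TropicallyDependent {X ι : Type} (A : Finset ι) (f : ι → X → ℝ) : Prop :=
  ∃ b : ι → ℝ, ∀ x : X, ∃ i ∈ A, ∃ j ∈ A, i ≠ j ∧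
    f i x + b i = f j x + b j ∧ ∀ k ∈ A, f i x + b i ≤ f k x + b k

/-- Tropical independence. -/
def TropicallyIndependent {X ι : Type} (A : Finset ι) (f : ι → X → ℝ) : Prop :=
  ¬ TropicallyDependent A f

/-- The edge lengths of a chain of `g` loops with bridges: for `1 ≤ k ≤ g` the top and bottom edges
of the `k`th loop have lengths `topLen k` (often written `ℓ_k`) and `botLen k` (often `m_k`), and
for `0 ≤ k ≤ g` the `k`th bridge has length `bridgeLen k` (often `n_k`).  The values at other
indices play no role. -/
structure ChainOfLoops (g : ℕ) where
  topLen : ℕ → ℝ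
  botLen : ℕ → ℝ
  bridgeLen : ℕ → ℝ
  topLen_pos : ∀ k, 1 ≤ k → k ≤ g → 0 < topLen k
  botLen_pos : ∀ k, 1 ≤ k → k ≤ g → 0 < botLen k
  bridgeLen_pos : ∀ k, k ≤ g → 0 < bridgeLen k

namespace ChainOfLoops

/-- The `2g + 2` vertices: `Sum.inl k` is `w_k` (`0 ≤ k ≤ g`) and `Sum.inr k` is `v_{k+1}`
(`0 ≤ k ≤ g`). -/
abbrev Vertex (g : ℕ) : Type := Fin (g + 1) ⊕ Fin (g + 1)

/-- The edges: the top edges of the loops, the bottom edges of the loops (the `k : Fin g` standing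
for the loop number `k + 1`), and the bridges (the `k : Fin (g + 1)` standing for bridge
number `k`). -/
abbrev Edge (g : ℕ) : Type := Fin g ⊕ Fin g ⊕ Fin (g + 1)

/-- The metric graph: the two edges of the `k`th loop join `v_k` to `w_k` (`1 ≤ k ≤ g`), and the
`k`th bridge joins `w_k` to `v_{k+1}` (`0 ≤ k ≤ g`). -/
def graph {g : ℕ} (Γ : ChainOfLoops g) : MetricGraph (Vertex g) (Edge g) where
  src
    | Sum.inl k => Sum.inr k.castSucc
    | Sum.inr (Sum.inl k) => Sum.inr k.castSucc
    | Sum.inr (Sum.inr k) => Sum.inl k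
  tgt
    | Sum.inl k => Sum.inl k.succ
    | Sum.inr (Sum.inl k) => Sum.inl k.succ
    | Sum.inr (Sum.inr k) => Sum.inr k
  len
    | Sum.inl k => Γ.topLen (k + 1)
    | Sum.inr (Sum.inl k) => Γ.botLen (k + 1)
    | Sum.inr (Sum.inr k) => Γ.bridgeLen k
  len_pos
    | Sum.inl k => Γ.topLen_pos _ (Nat.le_add_left _ _) k.isLt
    | Sum.inr (Sum.inl k) => Γ.botLen_pos _ (Nat.le_add_left _ _) k.isLt
    | Sum.inr (Sum.inr k) => Γ.bridgeLen_pos _ (Nat.lt_succ_iff.mp k.isLt)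

/-- The point `w_k`, for `0 ≤ k ≤ g`. -/
def wPoint {g : ℕ} (Γ : ChainOfLoops g) (k : Fin (g + 1)) : Γ.graph.Point :=
  MetricGraph.Point.vertex (Sum.inl k)

/-- The point `v_{k+1}`, for `0 ≤ k ≤ g`. -/
def vSuccPoint {g : ℕ} (Γ : ChainOfLoops g) (k : Fin (g + 1)) : Γ.graph.Point :=
  MetricGraph.Point.vertex (Sum.inr k)

/-- Admissible edge lengths, for the decomposition of the first `(r + 1) s` loops into `r + 1`
blocks of `s` loops.  The relation `a ≪ b` is made precise as `C * a ≤ b`. -/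
structure Admissible {g : ℕ} (Γ : ChainOfLoops g) (r s : ℕ) (C : ℝ) : Prop where
  bot_lt_top : ∀ k, 1 ≤ k → k ≤ g → 4 * g * Γ.botLen k < Γ.topLen k
  top_ll_bridge : ∀ k, 1 ≤ k → k ≤ g →
    C * Γ.topLen k ≤ min (Γ.bridgeLen (k - 1)) (Γ.bridgeLen k)
  no_relation : ∀ c : ℕ → ℤ, (∀ k, |c k| ≤ g + 1) →
    ∑ k ∈ Finset.Icc 1 g, (c k : ℝ) * Γ.botLen k = 0 → ∀ k ∈ Finset.Icc 1 g, c k = 0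
  block_ll_bridge : ∀ α, α ≤ r →
    C * (∑ i ∈ Finset.Icc (α * s + 1) ((α + 1) * s), Γ.topLen i +
        ∑ i ∈ Finset.Icc (α * s + 1) ((α + 1) * s - 1), Γ.bridgeLen i) ≤
      min (Γ.bridgeLen (α * s)) (Γ.bridgeLen ((α + 1) * s))

/-- `D'` is an effective divisor linearly equivalent to `D` with exactly `i` chips at the left end
`w_0` and exactly `r - i` chips at the right end `v_{g+1}`. -/
def IsEndDivisor {g : ℕ} (Γ : ChainOfLoops g) (r : ℕ) (D : Γ.graph.Divisor) (i : Fin (r + 1))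
    (D' : Γ.graph.Divisor) : Prop :=
  0 ≤ D' ∧ MetricGraph.LinEquiv D D' ∧
    D' (Γ.wPoint 0) = (i : ℕ) ∧ D' (Γ.vSuccPoint (Fin.last g)) = (r : ℤ) - (i : ℕ)

/-- The class of `D` (of rank `r`) is vertex avoiding: for each `0 ≤ i ≤ r` there is a unique
effective divisor `D_i ∼ D` with `i` chips at `w_0` and `r - i` chips at `v_{g+1}`, and `D_i` has
no chip at any of the vertices `v_1, w_1, …, v_g, w_g` of the loops. -/
def VertexAvoiding {g : ℕ} (Γ : ChainOfLoops g) (r : ℕ) (D : Γ.graph.Divisor) : Prop :=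
  ∀ i : Fin (r + 1), ∃ D' : Γ.graph.Divisor, Γ.IsEndDivisor r D i D' ∧
    (∀ D'' : Γ.graph.Divisor, Γ.IsEndDivisor r D i D'' → D'' = D') ∧
    ∀ k : Fin g, D' (Γ.vSuccPoint k.castSucc) = 0 ∧ D' (Γ.wPoint k.succ) = 0

end ChainOfLoops

/-- The genus `g` determined by `s = g - d + r` and `ρ = g - (r + 1)(g - d + r)`. -/
def genusOf (r s ρ : ℕ) : ℕ := (r + 1) * s + ρ

/-- The degree `d = g + r - s`. -/
def degreeOf (r s ρ : ℕ) : ℤ := (genusOf r s ρ : ℤ) + r - s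

/-- The injective range: `binom (r + m) m ≤ m d - g + 1`. -/
def InjectiveRange (r s ρ m : ℕ) : Prop :=
  ((r + m).choose m : ℤ) ≤ m * degreeOf r s ρ - genusOf r s ρ + 1

/-- The surjective range: `binom (r + m) m ≥ m d - g + 1`. -/
def SurjectiveRange (r s ρ m : ℕ) : Prop :=
  (m * degreeOf r s ρ - genusOf r s ρ + 1 : ℤ) ≤ (r + m).choose m

/-- The assertion of the tropical maximal rank conjecture for the parameters `(r, s, ρ, m)`.  On
every chain of `g` loops with admissible edge lengths (with a constant `C` in `≪` that depends on
the parameters only) there is a divisor `D` of degree `d` and rank `r` with vertex avoiding class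
such that, with `D_i` the corresponding divisors and `ψ_I` functions with
`m D + div ψ_I = ∑_{i ∈ I} D_i` for the multisets `I ⊂ {0, …, r}` of size `m`, some
`min {binom (r + m) m, m d - g + 1}` of the `ψ_I` are tropically independent. -/
def TropicalMaximalRank (r s ρ m : ℕ) : Prop :=
  ∃ C : ℝ, ∀ Γ : ChainOfLoops (genusOf r s ρ), Γ.Admissible r s C →
    ∃ D : Γ.graph.Divisor,
      MetricGraph.deg D = degreeOf r s ρ ∧ MetricGraph.HasRank D r ∧ Γ.VertexAvoiding r D ∧
      ∃ (Di : Fin (r + 1) → Γ.graph.Divisor) (ψ : Sym (Fin (r + 1)) m → Γ.graph.Point → ℝ),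
        (∀ i, Γ.IsEndDivisor r D i (Di i)) ∧
        (∀ I, MetricGraph.MovesTo (ψ I) (m • D) ((I : Multiset (Fin (r + 1))).map Di).sum) ∧
        ∃ A : Finset (Sym (Fin (r + 1)) m),
          (A.card : ℤ) =
            min ((r + m).choose m : ℤ) (m * degreeOf r s ρ - genusOf r s ρ + 1) ∧
          TropicallyIndependent A ψ

/-!
The divisor class is chosen so that, for the function `i` moving the base divisor to the `i`-th end
divisor, the slope on the bridges is `r - i` at first and increases by one at each of the `s` loops
of the block `i`, and nowhere else.  The function `ψ_I` of a triple `I` is then, up to a constant,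
the sum of the functions of its entries.

Suppose that the minimum of shifted functions `ψ_I` is attained twice everywhere.  Since the bridges
between the blocks are very long, there is a block `α` on which only triples with median `α` can be
minimal, and on each of its bridges there is a point where all minimal functions have one slope.

In the surjective range, a set of `3d - g + 1` triples can be chosen that has too few triples of the
same slope and median for this to happen.

In the injective range, all triples are used.  Those with entries `i < α < k` and a given sum
`c = i + k` have the same slopes throughout the block, so that their minimum is attained twice at a
loop only if its bottom length is a breakpoint of a minimum of affine functions of slopes `-i`; the
bottom lengths are distinct, and there are fewer breakpoints than triples.  The sums `c` occurring
along the block are weakly increasing, which leads to `s < α (r - α) ≤ r² / 4`.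
-/

/-! ### Piecewise linear functions on the edges of a metric graph -/

/-- The function `φ` is affine of slope `k` immediately to the right of `t`. -/
def HasSlopeRight (φ : ℝ → ℝ) (t : ℝ) (k : ℤ) : Prop :=
  ∀ᶠ h in 𝓝[>] (0 : ℝ), φ (t + h) = φ t + k * h

/-- The function `φ` is affine immediately to the left of `t`, of slope `k` when moving *away* from
`t`; this is the sign convention of `MetricGraph.HasSlopeBackward`. -/
def HasSlopeLeft (φ : ℝ → ℝ) (t : ℝ) (k : ℤ) : Prop :=
  ∀ᶠ h in 𝓝[>] (0 : ℝ), φ (t - h) = φ t + k * h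

section Slopes

variable {φ χ : ℝ → ℝ} {a b t : ℝ} {k l : ℤ}

theorem eq_zero_of_eventually_add_mul_eq_zero (h : ∀ᶠ x in 𝓝[>] (0 : ℝ), a + b * x = 0) :
    a = 0 ∧ b = 0 := by
  have hlim : Tendsto (fun x : ℝ => a + b * x) (𝓝[>] 0) (𝓝 (a + b * 0)) :=
    Continuous.tendsto' (by fun_prop) _ _ rfl |>.mono_left nhdsWithin_le_nhds
  have ha : a = 0 := by
    simpa using tendsto_nhds_unique hlim (tendsto_const_nhds.congr' (h.mono fun _ hx => hx.symm))
  obtain ⟨x, hx, hpos⟩ := (h.and self_mem_nhdsWithin).exists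
  have hpos : 0 < x := hpos
  exact ⟨ha, by simpa [ha, hpos.ne'] using hx⟩

theorem HasSlopeRight.unique (hk : HasSlopeRight φ t k) (hl : HasSlopeRight φ t l) : k = l := by
  have h : (0 : ℝ) = 0 ∧ (k - l : ℝ) = 0 := eq_zero_of_eventually_add_mul_eq_zero (by
    filter_upwards [hk, hl] with x h1 h2
    linarith)
  exact_mod_cast sub_eq_zero.1 h.2

theorem HasSlopeLeft.unique (hk : HasSlopeLeft φ t k) (hl : HasSlopeLeft φ t l) : k = l := by
  have h : (0 : ℝ) = 0 ∧ (k - l : ℝ) = 0 := eq_zero_of_eventually_add_mul_eq_zero (by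
    filter_upwards [hk, hl] with x h1 h2
    linarith)
  exact_mod_cast sub_eq_zero.1 h.2

theorem HasSlopeRight.add (hk : HasSlopeRight φ t k) (hl : HasSlopeRight χ t l) :
    HasSlopeRight (fun x => φ x + χ x) t (k + l) := by
  filter_upwards [hk, hl] with h h1 h2
  rw [h1, h2]; push_cast; ring

theorem HasSlopeLeft.add (hk : HasSlopeLeft φ t k) (hl : HasSlopeLeft χ t l) :
    HasSlopeLeft (fun x => φ x + χ x) t (k + l) := by
  filter_upwards [hk, hl] with h h1 h2
  rw [h1, h2]; push_cast; ring

theorem HasSlopeRight.const_smul (hk : HasSlopeRight φ t k) (c : ℤ) :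
    HasSlopeRight (fun x => c • φ x) t (c • k) := by
  filter_upwards [hk] with h h1
  rw [h1]; simp only [zsmul_eq_mul, smul_eq_mul]; push_cast; ring

theorem HasSlopeLeft.const_smul (hk : HasSlopeLeft φ t k) (c : ℤ) :
    HasSlopeLeft (fun x => c • φ x) t (c • k) := by
  filter_upwards [hk] with h h1
  rw [h1]; simp only [zsmul_eq_mul, smul_eq_mul]; push_cast; ring

theorem hasSlopeRight_const (a t : ℝ) : HasSlopeRight (fun _ => a) t 0 :=
  Eventually.of_forall fun _ => by simp

theorem hasSlopeLeft_const (a t : ℝ) : HasSlopeLeft (fun _ => a) t 0 :=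
  Eventually.of_forall fun _ => by simp

theorem hasSlopeRight_affine (a : ℝ) (k : ℤ) (t : ℝ) : HasSlopeRight (fun x => a + k * x) t k :=
  Eventually.of_forall fun h => by ring

theorem hasSlopeLeft_affine (a : ℝ) (k : ℤ) (t : ℝ) : HasSlopeLeft (fun x => a + k * x) t (-k) :=
  Eventually.of_forall fun h => by push_cast; ring

theorem hasSlopeRight_ramp (a t : ℝ) :
    HasSlopeRight (fun x => max 0 (x - a)) t (if a ≤ t then 1 else 0) := by
  split_ifs with ha
  · filter_upwards [self_mem_nhdsWithin] with h hh
    have hh : 0 < h := hh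
    rw [max_eq_right (by linarith), max_eq_right (by linarith)]; push_cast; ring
  · filter_upwards [Ioo_mem_nhdsGT (sub_pos.2 (not_le.1 ha))] with h hh
    rw [max_eq_left (by linarith [hh.2]), max_eq_left (by linarith)]; simp

theorem hasSlopeLeft_ramp (a t : ℝ) :
    HasSlopeLeft (fun x => max 0 (x - a)) t (-if a < t then 1 else 0) := by
  split_ifs with ha
  · filter_upwards [Ioo_mem_nhdsGT (sub_pos.2 ha)] with h hh
    rw [max_eq_right (by linarith [hh.2]), max_eq_right (by linarith)]; push_cast; ring
  · filter_upwards [self_mem_nhdsWithin] with h hh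
    have hh : 0 < h := hh
    rw [max_eq_left (by linarith), max_eq_left (by linarith)]; simp

theorem hasSlopeRight_congr (ht : t < b) (h : Set.EqOn φ χ (Set.Ico t b)) :
    HasSlopeRight φ t k ↔ HasSlopeRight χ t k := by
  refine eventually_congr ?_
  filter_upwards [Ioo_mem_nhdsGT (sub_pos.2 ht)] with x hx
  rw [h ⟨by linarith [hx.1], by linarith [hx.2]⟩, h ⟨le_rfl, ht⟩]

theorem hasSlopeLeft_congr (ht : a < t) (h : Set.EqOn φ χ (Set.Ioc a t)) :
    HasSlopeLeft φ t k ↔ HasSlopeLeft χ t k := by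
  refine eventually_congr ?_
  filter_upwards [Ioo_mem_nhdsGT (sub_pos.2 ht)] with x hx
  rw [h ⟨by linarith [hx.2], by linarith [hx.1]⟩, h ⟨ht, le_rfl⟩]

theorem HasSlopeLeft.eq_zero_of_eqOn_zero (hk : HasSlopeLeft φ t k) (ht : a < t)
    (h : ∀ x ∈ Set.Ioo a t, φ x = 0) : φ t = 0 ∧ k = 0 := by
  have h0 : φ t = 0 ∧ (k : ℝ) = 0 := eq_zero_of_eventually_add_mul_eq_zero (by
    filter_upwards [hk, Ioo_mem_nhdsGT (sub_pos.2 ht)] with x hx hxt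
    rw [← hx, h _ ⟨by linarith [hxt.2], by linarith [hxt.1]⟩])
  exact_mod_cast h0

/-- If the two slopes at each interior point are opposite, then a function that starts out
vanishing cannot stop doing so: the infimum of the points where it does not vanish would be a point
where both slopes, hence the values just beyond it, are zero. -/
theorem eq_zero_of_opposite_slopes (h0 : φ 0 = 0) (hr0 : HasSlopeRight φ 0 0)
    (hk : ∀ t, 0 < t → t < b → ∃ k : ℤ, HasSlopeRight φ t k ∧ HasSlopeLeft φ t (-k))
    (hl : ∃ k, HasSlopeLeft φ b k) : ∀ t, 0 ≤ t → t ≤ b → φ t = 0 := by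
  by_contra! ⟨u, hu0, hub, hu⟩
  set Z : Set ℝ := {t | 0 ≤ t ∧ t ≤ b ∧ φ t ≠ 0}
  have hZ : Z.Nonempty := ⟨u, hu0, hub, hu⟩
  have hZ0 : BddBelow Z := ⟨0, fun t ht => ht.1⟩
  set x := sInf Z
  have hx0 : 0 ≤ x := le_csInf hZ fun t ht => ht.1
  have hxu : x ≤ u := csInf_le hZ0 ⟨hu0, hub, hu⟩
  have hlow : ∀ t ∈ Set.Ioo 0 x, φ t = 0 := fun t ht => by
    by_contra h
    exact (csInf_le hZ0 ⟨ht.1.le, by linarith [ht.2], h⟩).not_gt ht.2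
  have hφx : φ x = 0 := by
    rcases hx0.eq_or_lt with h | h
    · rw [← h, h0]
    · obtain ⟨k, hk⟩ : ∃ k, HasSlopeLeft φ x k := by
        rcases (hxu.trans hub).eq_or_lt with h2 | h2
        · rwa [h2]
        · obtain ⟨k, -, hk⟩ := hk x h h2
          exact ⟨_, hk⟩
      exact (hk.eq_zero_of_eqOn_zero h hlow).1
  have hxb : x < b := by
    refine (hxu.trans hub).lt_of_ne fun h => hu ?_
    rw [← hφx, le_antisymm (h ▸ hub) hxu]
  have hright : HasSlopeRight φ x 0 := by
    rcases hx0.eq_or_lt with h | h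
    · rwa [← h]
    · obtain ⟨k, hkr, hkl⟩ := hk x h hxb
      rwa [neg_eq_zero.1 (hkl.eq_zero_of_eqOn_zero h hlow).2] at hkr
  obtain ⟨c, hc, hsub⟩ := mem_nhdsGT_iff_exists_Ioo_subset.1 hright
  obtain ⟨z, hz, hzc⟩ := exists_lt_of_csInf_lt hZ (show sInf Z < x + c from by
    linarith [Set.mem_Ioi.1 hc])
  rcases (csInf_le hZ0 hz).eq_or_lt with h | h
  · exact hz.2.2 (h ▸ hφx)
  · have hval : φ (x + (z - x)) = φ x + (0 : ℤ) * (z - x) := hsub ⟨sub_pos.2 h, by linarith⟩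
    exact hz.2.2 (by simpa [hφx] using hval)

end Slopes

namespace MetricGraph

variable {V E : Type} {Γ : MetricGraph V E}

theorem onEdge_zero (e : E) : Γ.onEdge e 0 = Point.vertex (Γ.src e) := by
  simp [onEdge]

theorem onEdge_len (e : E) : Γ.onEdge e (Γ.len e) = Point.vertex (Γ.tgt e) := by
  simp [onEdge, Γ.len_pos e]

theorem onEdge_inner (e : E) (t : ℝ) (h0 : 0 < t) (h1 : t < Γ.len e) :
    Γ.onEdge e t = Point.inner e t h0 h1 := by
  simp [onEdge, h0, h1]

theorem slopeForward_eq {f : Γ.Point → ℝ} {e : E} {t : ℝ} {k : ℤ}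
    (h : Γ.HasSlopeForward f e t k) : Γ.slopeForward f e t = k := by
  have hex : ∃ k : ℤ, Γ.HasSlopeForward f e t k := ⟨k, h⟩
  rw [slopeForward, dif_pos hex]
  exact HasSlopeRight.unique (φ := fun t => f (Γ.onEdge e t)) hex.choose_spec h

theorem slopeBackward_eq {f : Γ.Point → ℝ} {e : E} {t : ℝ} {k : ℤ}
    (h : Γ.HasSlopeBackward f e t k) : Γ.slopeBackward f e t = k := by
  have hex : ∃ k : ℤ, Γ.HasSlopeBackward f e t k := ⟨k, h⟩
  rw [slopeBackward, dif_pos hex]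
  exact HasSlopeLeft.unique (φ := fun t => f (Γ.onEdge e t)) hex.choose_spec h

theorem IsPL.hasSlopeRight {f : Γ.Point → ℝ} (hf : Γ.IsPL f) {e : E} {t : ℝ} (h0 : 0 ≤ t)
    (h1 : t < Γ.len e) : HasSlopeRight (fun t => f (Γ.onEdge e t)) t (Γ.slopeForward f e t) := by
  obtain ⟨k, hk⟩ := (hf e).1 t h0 h1
  rwa [slopeForward_eq hk]

theorem IsPL.hasSlopeLeft {f : Γ.Point → ℝ} (hf : Γ.IsPL f) {e : E} {t : ℝ} (h0 : 0 < t)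
    (h1 : t ≤ Γ.len e) : HasSlopeLeft (fun t => f (Γ.onEdge e t)) t (Γ.slopeBackward f e t) := by
  obtain ⟨k, hk⟩ := (hf e).2 t h0 h1
  rwa [slopeBackward_eq hk]

theorem IsPL.add {f f' : Γ.Point → ℝ} (hf : Γ.IsPL f) (hf' : Γ.IsPL f') :
    Γ.IsPL fun x => f x + f' x :=
  fun _ => ⟨fun _ h0 h1 => ⟨_, (hf.hasSlopeRight h0 h1).add (hf'.hasSlopeRight h0 h1)⟩,
    fun _ h0 h1 => ⟨_, (hf.hasSlopeLeft h0 h1).add (hf'.hasSlopeLeft h0 h1)⟩⟩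

theorem isPL_const (c : ℝ) : Γ.IsPL fun _ => c :=
  fun _ => ⟨fun t _ _ => ⟨0, hasSlopeRight_const c t⟩, fun t _ _ => ⟨0, hasSlopeLeft_const c t⟩⟩

section ord

variable [Fintype E]

theorem ord_add {f f' : Γ.Point → ℝ} (hf : Γ.IsPL f) (hf' : Γ.IsPL f') (q : Γ.Point) :
    Γ.ord (fun x => f x + f' x) q = Γ.ord f q + Γ.ord f' q := by
  have hF : ∀ e t, 0 ≤ t → t < Γ.len e → Γ.slopeForward (fun x => f x + f' x) e t =
      Γ.slopeForward f e t + Γ.slopeForward f' e t := fun e t h0 h1 =>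
    slopeForward_eq ((hf.hasSlopeRight h0 h1).add (hf'.hasSlopeRight h0 h1))
  have hB : ∀ e t, 0 < t → t ≤ Γ.len e → Γ.slopeBackward (fun x => f x + f' x) e t =
      Γ.slopeBackward f e t + Γ.slopeBackward f' e t := fun e t h0 h1 =>
    slopeBackward_eq ((hf.hasSlopeLeft h0 h1).add (hf'.hasSlopeLeft h0 h1))
  cases q with
  | vertex x =>
    simp only [ord]
    rw [← neg_add, ← Finset.sum_add_distrib]
    congr 1
    refine Finset.sum_congr rfl fun e _ => ?_
    rw [hF e 0 le_rfl (Γ.len_pos e), hB e _ (Γ.len_pos e) le_rfl]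
    split_ifs <;> ring
  | inner e t h0 h1 =>
    simp only [ord]
    rw [hF e t h0.le h1, hB e t h0 h1.le]
    ring

theorem ord_const (c : ℝ) (q : Γ.Point) : Γ.ord (fun _ => c) q = 0 := by
  have hF : ∀ e t, Γ.slopeForward (fun _ => c) e t = 0 := fun e t =>
    slopeForward_eq (hasSlopeRight_const c t)
  have hB : ∀ e t, Γ.slopeBackward (fun _ => c) e t = 0 := fun e t =>
    slopeBackward_eq (hasSlopeLeft_const c t)
  cases q <;> simp [ord, hF, hB]

theorem MovesTo.add {f f' : Γ.Point → ℝ} {D D' F F' : Γ.Divisor} (h : MovesTo f D F)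
    (h' : MovesTo f' D' F') : MovesTo (fun x => f x + f' x) (D + D') (F + F') := by
  refine ⟨h.1.add h'.1, fun q => ?_⟩
  rw [ord_add h.1 h'.1, Finsupp.add_apply, Finsupp.add_apply, h.2, h'.2]
  ring

theorem MovesTo.multiset_sum {ι : Type*} {f : ι → Γ.Point → ℝ} {D : Γ.Divisor} {F : ι → Γ.Divisor}
    (h : ∀ i, MovesTo (f i) D (F i)) (I : Multiset ι) :
    MovesTo (fun x => (I.map fun i => f i x).sum) (Multiset.card I • D) (I.map F).sum := by
  induction I using Multiset.induction_on with
  | empty => exact ⟨by simpa using isPL_const 0, fun q => by simp [ord_const]⟩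
  | cons i I ih =>
    simp only [Multiset.map_cons, Multiset.sum_cons, Multiset.card_cons]
    rw [add_smul, one_smul, add_comm (Multiset.card I • D)]
    exact (h i).add ih

end ord

section edgeSum

open Classical in
/-- The function on the points of `Γ` that is `φ` on the interior of `e`, seen through its
coordinate, and zero elsewhere. -/
noncomputable def onInterior {A : Type*} [Zero A] (e : E) (φ : ℝ → A) : Γ.Point → A
  | Point.vertex _ => 0
  | Point.inner e' a _ _ => if e' = e then φ a else 0

/-- The sum of `φ` over the coordinates of the chips of a divisor in the interior of `e`, counted
with multiplicity. -/
noncomputable def edgeSum {A : Type*} [AddCommGroup A] (e : E) (φ : ℝ → A) : Γ.Divisor →+ A :=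
  Finsupp.liftAddHom fun p => (smulAddHom ℤ A).flip (onInterior e φ p)

/-- The degree of the restriction of a divisor to the interior of `e`. -/
noncomputable def degOn (e : E) : Γ.Divisor →+ ℤ := edgeSum e fun _ => 1

/-- The degree of the restriction of a divisor to the points of the interior of `e` with
coordinate at most `t`. -/
noncomputable def degLE (e : E) (t : ℝ) : Γ.Divisor →+ ℤ :=
  edgeSum e fun a => if a ≤ t then 1 else 0

/-- The degree of the restriction of a divisor to the points of the interior of `e` with
coordinate less than `t`. -/
noncomputable def degLT (e : E) (t : ℝ) : Γ.Divisor →+ ℤ :=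
  edgeSum e fun a => if a < t then 1 else 0

/-- The value at `t` of the function of a coordinate on `e` that starts flat at `0` and bends
upwards at each chip in the interior of `e`, by the multiplicity of that chip. -/
noncomputable def hinge (e : E) (t : ℝ) : Γ.Divisor →+ ℝ := edgeSum e fun a => max 0 (t - a)

variable {A : Type*} [AddCommGroup A] {D : Γ.Divisor} {e : E}

theorem edgeSum_apply (e : E) (φ : ℝ → A) (D : Γ.Divisor) :
    edgeSum e φ D = D.sum fun p c => c • onInterior e φ p := rfl

@[simp]
theorem edgeSum_single (e : E) (φ : ℝ → A) (p : Γ.Point) (c : ℤ) :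
    edgeSum e φ (Finsupp.single p c) = c • onInterior e φ p := by
  simp [edgeSum_apply]

theorem edgeSum_congr {φ χ : ℝ → A} (h : Set.EqOn φ χ (Set.Ioo 0 (Γ.len e))) (D : Γ.Divisor) :
    edgeSum e φ D = edgeSum e χ D := by
  refine Finset.sum_congr rfl fun p _ => ?_
  cases p with
  | vertex x => rfl
  | inner e' a h0 h1 =>
    by_cases he : e' = e
    · subst he; simp [onInterior, h ⟨h0, h1⟩]
    · simp [onInterior, he]

theorem edgeSum_eq_zero {φ : ℝ → A} (h : ∀ a ∈ Set.Ioo 0 (Γ.len e), φ a = 0) (D : Γ.Divisor) :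
    edgeSum e φ D = 0 := by
  rw [edgeSum_congr (χ := fun _ => 0) h]
  refine Finset.sum_eq_zero fun p _ => ?_
  cases p <;> simp [onInterior]

theorem edgeSum_neg (e : E) (φ : ℝ → A) (D : Γ.Divisor) :
    edgeSum e (fun a => -φ a) D = -edgeSum e φ D := by
  rw [edgeSum_apply, edgeSum_apply, Finsupp.sum, Finsupp.sum, ← Finset.sum_neg_distrib]
  refine Finset.sum_congr rfl fun p _ => ?_
  cases p with
  | vertex x => simp [onInterior]
  | inner e' a h0 h1 => by_cases he : e' = e <;> simp [onInterior, he]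

theorem hasSlopeRight_edgeSum {φ : ℝ → ℝ → ℝ} {t : ℝ} {k : ℝ → ℤ}
    (h : ∀ a, HasSlopeRight (fun t => φ t a) t (k a)) (e : E) (D : Γ.Divisor) :
    HasSlopeRight (fun t => edgeSum e (φ t) D) t (edgeSum e k D) := by
  induction D using Finsupp.induction_linear with
  | zero => simpa using hasSlopeRight_const 0 t
  | add D D' hD hD' => simpa using hD.add hD'
  | single p c =>
    simp only [edgeSum_single]
    refine HasSlopeRight.const_smul ?_ c
    cases p with
    | vertex x => exact hasSlopeRight_const 0 t
    | inner e' a _ _ =>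
      by_cases he : e' = e
      · simpa [onInterior, he] using h a
      · simpa [onInterior, he] using hasSlopeRight_const 0 t

theorem hasSlopeLeft_edgeSum {φ : ℝ → ℝ → ℝ} {t : ℝ} {k : ℝ → ℤ}
    (h : ∀ a, HasSlopeLeft (fun t => φ t a) t (k a)) (e : E) (D : Γ.Divisor) :
    HasSlopeLeft (fun t => edgeSum e (φ t) D) t (edgeSum e k D) := by
  induction D using Finsupp.induction_linear with
  | zero => simpa using hasSlopeLeft_const 0 t
  | add D D' hD hD' => simpa using hD.add hD'
  | single p c =>
    simp only [edgeSum_single]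
    refine HasSlopeLeft.const_smul ?_ c
    cases p with
    | vertex x => exact hasSlopeLeft_const 0 t
    | inner e' a _ _ =>
      by_cases he : e' = e
      · simpa [onInterior, he] using h a
      · simpa [onInterior, he] using hasSlopeLeft_const 0 t

theorem hasSlopeRight_hinge (e : E) (D : Γ.Divisor) (t : ℝ) :
    HasSlopeRight (fun t => hinge e t D) t (degLE e t D) :=
  hasSlopeRight_edgeSum (fun a => hasSlopeRight_ramp a t) e D

theorem hasSlopeLeft_hinge (e : E) (D : Γ.Divisor) (t : ℝ) :
    HasSlopeLeft (fun t => hinge e t D) t (-degLT e t D) := by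
  have h := hasSlopeLeft_edgeSum (fun a => hasSlopeLeft_ramp a t) e D
  rwa [edgeSum_neg] at h

theorem degLE_zero (e : E) (D : Γ.Divisor) : degLE e 0 D = 0 :=
  edgeSum_eq_zero (fun _ ha => if_neg ha.1.not_ge) D

theorem degLT_len (e : E) (D : Γ.Divisor) : degLT e (Γ.len e) D = degOn e D :=
  edgeSum_congr (fun _ ha => if_pos ha.2) D

theorem degLE_eq_degLT_add (e : E) (t : ℝ) (h0 : 0 < t) (h1 : t < Γ.len e) (D : Γ.Divisor) :
    degLE e t D = degLT e t D + D (Point.inner e t h0 h1) := by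
  induction D using Finsupp.induction_linear with
  | zero => simp
  | add D D' hD hD' => simp only [map_add, Finsupp.add_apply, hD, hD']; ring
  | single p c =>
    simp only [degLE, degLT, edgeSum_single]
    cases p with
    | vertex x => simp [onInterior]
    | inner e' a g0 g1 =>
      by_cases he : e' = e
      · subst he
        rcases lt_trichotomy a t with h | rfl | h
        · simp [onInterior, h, h.le, h.ne]
        · simp [onInterior]
        · simp [onInterior, h.not_ge, h.not_gt, h.ne']
      · simp [onInterior, he]

theorem hinge_zero (e : E) (D : Γ.Divisor) : hinge e 0 D = 0 :=
  edgeSum_eq_zero (fun _ ha => max_eq_left (by linarith [ha.1])) D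

theorem degOn_nonneg (hD : 0 ≤ D) (e : E) : 0 ≤ degOn e D :=
  Finset.sum_nonneg fun p _ => mul_nonneg (hD p) (by
    cases p <;> simp only [onInterior]
    · exact le_rfl
    · split_ifs <;> simp)

theorem apply_eq_zero_of_degOn_eq_zero (hD : 0 ≤ D) (h : degOn e D = 0) (t : ℝ) (h0 : 0 < t)
    (h1 : t < Γ.len e) : D (Point.inner e t h0 h1) = 0 := by
  have hsub : 0 ≤ D - Finsupp.single (Point.inner e t h0 h1) (D (Point.inner e t h0 h1)) := by
    classical
    intro q
    rw [Finsupp.sub_apply, Finsupp.single_apply]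
    split_ifs with hq
    · simp [hq]
    · simpa using hD q
  have hdeg := degOn_nonneg hsub e
  rw [map_sub, h, degOn, edgeSum_single] at hdeg
  simp only [onInterior, if_true, smul_eq_mul, mul_one] at hdeg
  exact le_antisymm (by linarith) (hD _)

theorem edgeSum_eq_zero_of_degOn_eq_zero (hD : 0 ≤ D) (h : degOn e D = 0) (φ : ℝ → A) :
    edgeSum e φ D = 0 := by
  refine Finset.sum_eq_zero fun p _ => ?_
  cases p with
  | vertex x => simp [onInterior]
  | inner e' a h0 h1 =>
    by_cases he : e' = e
    · subst he
      simp [apply_eq_zero_of_degOn_eq_zero hD h]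
    · simp [onInterior, he]

theorem hinge_eq_zero_of_degOn_eq_zero (hD : 0 ≤ D) (h : degOn e D = 0) (t : ℝ) : hinge e t D = 0 :=
  edgeSum_eq_zero_of_degOn_eq_zero hD h _

theorem exists_of_degOn_eq_one (hD : 0 ≤ D) (h : degOn e D = 1) :
    ∃ a, 0 < a ∧ a < Γ.len e ∧ (∀ t, hinge e t D = max 0 (t - a)) ∧
      ∀ t h0 h1, D (Point.inner e t h0 h1) = if a = t then 1 else 0 := by
  classical
  obtain ⟨a, h0, h1, hpos⟩ : ∃ a h0 h1, 0 < D (Point.inner e a h0 h1) := by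
    by_contra! hcon
    have hle : degOn e D ≤ 0 := Finset.sum_nonpos fun p _ => by
      cases p with
      | vertex x => simp [onInterior]
      | inner e' a h0 h1 =>
        by_cases he : e' = e
        · subst he; simpa [onInterior] using hcon a h0 h1
        · simp [onInterior, he]
    omega
  set chip : Γ.Divisor := Finsupp.single (Point.inner e a h0 h1) 1 with hchip
  have hrest : 0 ≤ D - chip := by
    intro q
    rw [hchip, Finsupp.sub_apply, Finsupp.single_apply]
    split_ifs with hq
    · subst hq; simp only [Finsupp.coe_zero, Pi.zero_apply]; omega
    · simpa using hD q
  have hdeg : degOn e (D - chip) = 0 := by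
    rw [map_sub, h, hchip, degOn, edgeSum_single]; simp [onInterior]
  refine ⟨a, h0, h1, fun t => ?_, fun t g0 g1 => ?_⟩
  · rw [← sub_add_cancel D chip, map_add, hinge_eq_zero_of_degOn_eq_zero hrest hdeg]
    simp [hchip, hinge, onInterior]
  · rw [← sub_add_cancel D chip, Finsupp.add_apply, apply_eq_zero_of_degOn_eq_zero hrest hdeg]
    simp [hchip, Finsupp.single_apply]

theorem deg_add (D D' : Γ.Divisor) : deg (D + D') = deg D + deg D' :=
  Finsupp.sum_add_index' (by simp) (by simp)

theorem deg_sum {ι : Type*} (A : Finset ι) (D : ι → Γ.Divisor) :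
    deg (∑ i ∈ A, D i) = ∑ i ∈ A, deg (D i) := by
  classical
  induction A using Finset.induction_on with
  | empty => simp [deg]
  | insert a s ha ih => rw [Finset.sum_insert ha, Finset.sum_insert ha, deg_add, ih]

theorem deg_single (p : Γ.Point) (c : ℤ) : deg (Finsupp.single p c) = c := by simp [deg]

theorem deg_eq_sum [Fintype V] [Fintype E] (D : Γ.Divisor) :
    deg D = ∑ x, D (Point.vertex x) + ∑ e, degOn e D := by
  classical
  induction D using Finsupp.induction_linear with
  | zero => simp [deg]
  | add D D' h h' =>
    simp only [deg_add, h, h', Finsupp.add_apply, map_add, Finset.sum_add_distrib]; ring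
  | single p c =>
    rw [deg_single]
    simp only [degOn, edgeSum_single, Finsupp.single_apply]
    cases p <;> simp [onInterior]

end edgeSum

section divisor

/-- The function with the values `val` at the vertices and `φ e` on the interior of `e`. -/
def ofEdges (val : V → ℝ) (φ : E → ℝ → ℝ) : Γ.Point → ℝ
  | Point.vertex x => val x
  | Point.inner e t _ _ => φ e t

theorem ofEdges_onEdge {val : V → ℝ} {φ : E → ℝ → ℝ} {e : E} (h0 : φ e 0 = val (Γ.src e))
    (h1 : φ e (Γ.len e) = val (Γ.tgt e)) (t : ℝ) (ht0 : 0 ≤ t) (ht1 : t ≤ Γ.len e) :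
    ofEdges val φ (Γ.onEdge e t) = φ e t := by
  rcases ht0.eq_or_lt with rfl | ht0
  · rw [onEdge_zero, ofEdges, h0]
  rcases ht1.eq_or_lt with rfl | ht1
  · rw [onEdge_len, ofEdges, h1]
  · rw [onEdge_inner _ _ ht0 ht1, ofEdges]

theorem hasSlopeRight_affine_sub_hinge (e : E) (D : Γ.Divisor) (a : ℝ) (k : ℤ) (t : ℝ) :
    HasSlopeRight (fun t => a + k * t - hinge e t D) t (k - degLE e t D) := by
  simpa [sub_eq_add_neg] using
    (hasSlopeRight_affine a k t).add ((hasSlopeRight_hinge e D t).const_smul (-1))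

theorem hasSlopeLeft_affine_sub_hinge (e : E) (D : Γ.Divisor) (a : ℝ) (k : ℤ) (t : ℝ) :
    HasSlopeLeft (fun t => a + k * t - hinge e t D) t (degLT e t D - k) := by
  simpa [sub_eq_add_neg, add_comm] using
    (hasSlopeLeft_affine a k t).add ((hasSlopeLeft_hinge e D t).const_smul (-1))

variable [Fintype E] {f : Γ.Point → ℝ} {D : Γ.Divisor}

open Classical in
/-- What arrives at the vertex `x` through the ends of the edges, of `a e` at the end of each `e`,
minus what leaves it through their starts, of `b e` at the start of each `e`. -/
noncomputable def netFlow (Γ : MetricGraph V E) (a b : E → ℤ) (x : V) : ℤ :=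
  ∑ e, ((if Γ.tgt e = x then a e else 0) - (if Γ.src e = x then b e else 0))

/-- The outgoing slopes `κ` at the starts of the edges and the values at the vertices may be
prescribed as soon as they fit together along each edge and balance at each vertex. -/
theorem exists_ord_eq (D : Γ.Divisor) (κ : E → ℤ) (val : V → ℝ)
    (hE : ∀ e, val (Γ.tgt e) = val (Γ.src e) + κ e * Γ.len e - hinge e (Γ.len e) D)
    (hV : ∀ x, D (Point.vertex x) = Γ.netFlow (fun e => κ e - degOn e D) κ x) :
    ∃ f : Γ.Point → ℝ, Γ.IsPL f ∧ (∀ p, Γ.ord f p = D p) ∧ (∀ x, f (Point.vertex x) = val x) ∧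
      ∀ e t, 0 ≤ t → t ≤ Γ.len e →
        f (Γ.onEdge e t) = val (Γ.src e) + κ e * t - hinge e t D := by
  set φ : E → ℝ → ℝ := fun e t => val (Γ.src e) + κ e * t - hinge e t D with hφ
  have hf : ∀ e t, 0 ≤ t → t ≤ Γ.len e → ofEdges val φ (Γ.onEdge e t) = φ e t := fun e =>
    ofEdges_onEdge (by simp [hφ, hinge_zero]) (by simp [hφ, hE])
  have hF : ∀ e t, 0 ≤ t → t < Γ.len e →
      Γ.HasSlopeForward (ofEdges val φ) e t (κ e - degLE e t D) := fun e t h0 h1 =>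
    (hasSlopeRight_congr h1 fun x hx => hf e x (h0.trans hx.1) hx.2.le).2
      (hasSlopeRight_affine_sub_hinge e D _ _ t)
  have hB : ∀ e t, 0 < t → t ≤ Γ.len e →
      Γ.HasSlopeBackward (ofEdges val φ) e t (degLT e t D - κ e) := fun e t h0 h1 =>
    (hasSlopeLeft_congr h0 fun x hx => hf e x hx.1.le (hx.2.trans h1)).2
      (hasSlopeLeft_affine_sub_hinge e D _ _ t)
  refine ⟨ofEdges val φ, fun e => ⟨fun t h0 h1 => ⟨_, hF e t h0 h1⟩,
    fun t h0 h1 => ⟨_, hB e t h0 h1⟩⟩, fun p => ?_, fun x => rfl, hf⟩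
  cases p with
  | vertex x =>
    rw [ord, hV, netFlow, ← Finset.sum_neg_distrib]
    refine Finset.sum_congr rfl fun e _ => ?_
    rw [slopeForward_eq (hF e 0 le_rfl (Γ.len_pos e)),
      slopeBackward_eq (hB e _ (Γ.len_pos e) le_rfl), degLE_zero, degLT_len]
    split_ifs <;> ring
  | inner e t h0 h1 =>
    rw [ord, slopeForward_eq (hF e t h0.le h1), slopeBackward_eq (hB e t h0 h1.le),
      degLE_eq_degLT_add e t h0 h1]
    ring

theorem IsPL.apply_onEdge (hf : Γ.IsPL f) (hD : ∀ p, Γ.ord f p = D p) (e : E) (t : ℝ)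
    (h0 : 0 ≤ t) (h1 : t ≤ Γ.len e) : f (Γ.onEdge e t) =
      f (Point.vertex (Γ.src e)) + Γ.slopeForward f e 0 * t - hinge e t D := by
  set a := f (Point.vertex (Γ.src e)) with ha
  set κ := Γ.slopeForward f e 0 with hκ
  set φ : ℝ → ℝ := fun t => f (Γ.onEdge e t) + (-1 : ℤ) • (a + κ * t - hinge e t D) with hφ
  have hR : ∀ t, 0 ≤ t → t < Γ.len e →
      HasSlopeRight φ t (Γ.slopeForward f e t + (-1 : ℤ) • (κ - degLE e t D)) := fun t h0 h1 =>
    (hf.hasSlopeRight h0 h1).add ((hasSlopeRight_affine_sub_hinge e D a κ t).const_smul (-1))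
  have hL : ∀ t, 0 < t → t ≤ Γ.len e →
      HasSlopeLeft φ t (Γ.slopeBackward f e t + (-1 : ℤ) • (degLT e t D - κ)) := fun t h0 h1 =>
    (hf.hasSlopeLeft h0 h1).add ((hasSlopeLeft_affine_sub_hinge e D a κ t).const_smul (-1))
  have hφ0 : φ t = 0 := by
    refine eq_zero_of_opposite_slopes ?_ ?_ (fun t h0 h1 => ⟨_, hR t h0.le h1, ?_⟩)
      ⟨_, hL _ (Γ.len_pos e) le_rfl⟩ t h0 h1
    · simp [hφ, onEdge_zero, hinge_zero, ha]
    · simpa [← hκ, degLE_zero] using hR 0 le_rfl (Γ.len_pos e)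
    · convert hL t h0 h1.le using 1
      have hord := hD (Point.inner e t h0 h1)
      rw [ord] at hord
      rw [degLE_eq_degLT_add e t h0 h1, smul_eq_mul, smul_eq_mul]
      linarith
  simp only [hφ, neg_smul, one_smul] at hφ0
  linarith

theorem IsPL.apply_tgt (hf : Γ.IsPL f) (hD : ∀ p, Γ.ord f p = D p) (e : E) :
    f (Point.vertex (Γ.tgt e)) = f (Point.vertex (Γ.src e)) +
      Γ.slopeForward f e 0 * Γ.len e - hinge e (Γ.len e) D := by
  rw [← onEdge_len, hf.apply_onEdge hD e _ (Γ.len_pos e).le le_rfl]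

theorem IsPL.divisor_apply_vertex (hf : Γ.IsPL f) (hD : ∀ p, Γ.ord f p = D p) (x : V) :
    D (Point.vertex x) = Γ.netFlow (fun e => Γ.slopeForward f e 0 - degOn e D)
      (fun e => Γ.slopeForward f e 0) x := by
  rw [← hD, ord, netFlow, ← Finset.sum_neg_distrib]
  refine Finset.sum_congr rfl fun e _ => ?_
  have hback : Γ.slopeBackward f e (Γ.len e) = degOn e D - Γ.slopeForward f e 0 := by
    rw [← degLT_len]
    refine (hf.hasSlopeLeft (Γ.len_pos e) le_rfl).unique ?_
    exact (hasSlopeLeft_congr (Γ.len_pos e) fun t ht =>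
      hf.apply_onEdge hD e t ht.1.le ht.2).2
        (hasSlopeLeft_affine_sub_hinge e D _ _ _)
  rw [hback]
  split_ifs <;> ring

end divisor

end MetricGraph

/-! ### Functions and divisors on a chain of loops -/

namespace ChainOfLoops

open MetricGraph

variable {g : ℕ} {Γ : ChainOfLoops g}

/-- The top edge of a loop. -/
abbrev top (k : Fin g) : Edge g := Sum.inl k

/-- The bottom edge of a loop. -/
abbrev bot (k : Fin g) : Edge g := Sum.inr (Sum.inl k)

/-- The bridge with the given index. -/
abbrev bridge (k : Fin (g + 1)) : Edge g := Sum.inr (Sum.inr k)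

theorem len_top (k : Fin g) : Γ.graph.len (top k) = Γ.topLen (k + 1) := rfl

theorem len_bot (k : Fin g) : Γ.graph.len (bot k) = Γ.botLen (k + 1) := rfl

theorem len_bridge (k : Fin (g + 1)) : Γ.graph.len (bridge k) = Γ.bridgeLen k := rfl

/-- The integers `κt`, `κb` and `σ` are the slopes, at the starts of the top edges, the bottom edges
and the bridges, of a function with divisor `D` on the chain of loops. -/
structure Balanced (D : Γ.graph.Divisor) (κt κb : Fin g → ℤ) (σ : Fin (g + 1) → ℤ) : Prop where
  start : D (Γ.wPoint 0) = -σ 0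
  left : ∀ k : Fin g, D (Γ.vSuccPoint k.castSucc) =
    σ k.castSucc - degOn (bridge k.castSucc) D - κt k - κb k
  right : ∀ k : Fin g, D (Γ.wPoint k.succ) =
    κt k - degOn (top k) D + (κb k - degOn (bot k) D) - σ k.succ
  finish : D (Γ.vSuccPoint (Fin.last g)) = σ (Fin.last g) - degOn (bridge (Fin.last g)) D
  loop : ∀ k : Fin g, κt k * Γ.topLen (k + 1) - hinge (top k) (Γ.topLen (k + 1)) D =
    κb k * Γ.botLen (k + 1) - hinge (bot k) (Γ.botLen (k + 1)) D

section netFlow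

variable (a b : Edge g → ℤ)

theorem netFlow_start : Γ.graph.netFlow a b (Sum.inl 0) = -b (bridge 0) := by
  simp [netFlow, Fintype.sum_sum_type, graph, Fin.succ_ne_zero]

theorem netFlow_right (k : Fin g) :
    Γ.graph.netFlow a b (Sum.inl k.succ) = a (top k) + a (bot k) - b (bridge k.succ) := by
  simp [netFlow, Fintype.sum_sum_type, graph, sub_eq_add_neg, add_assoc]

theorem netFlow_left (k : Fin g) :
    Γ.graph.netFlow a b (Sum.inr k.castSucc) = a (bridge k.castSucc) - b (top k) - b (bot k) := by
  simp [netFlow, Fintype.sum_sum_type, graph]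
  ring

theorem netFlow_finish :
    Γ.graph.netFlow a b (Sum.inr (Fin.last g)) = a (bridge (Fin.last g)) := by
  simp [netFlow, Fintype.sum_sum_type, graph, Fin.castSucc_ne_last]

end netFlow

theorem balanced_slopeForward {f : Γ.graph.Point → ℝ} {D : Γ.graph.Divisor}
    (hf : Γ.graph.IsPL f) (hD : ∀ p, Γ.graph.ord f p = D p) :
    Balanced D (fun k => Γ.graph.slopeForward f (top k) 0)
      (fun k => Γ.graph.slopeForward f (bot k) 0)
      (fun k => Γ.graph.slopeForward f (bridge k) 0) where
  start := by rw [wPoint, hf.divisor_apply_vertex hD, netFlow_start]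
  left k := by rw [vSuccPoint, hf.divisor_apply_vertex hD, netFlow_left]
  right k := by rw [wPoint, hf.divisor_apply_vertex hD, netFlow_right]
  finish := by rw [vSuccPoint, hf.divisor_apply_vertex hD, netFlow_finish]
  loop k := by
    have htop := hf.apply_tgt hD (top k)
    have hbot := hf.apply_tgt hD (bot k)
    rw [len_top, show Γ.graph.tgt (top k) = Γ.graph.tgt (bot k) from rfl,
      show Γ.graph.src (top k) = Γ.graph.src (bot k) from rfl] at htop
    rw [len_bot] at hbot
    linarith

/-- Only differences of values along the bridges and the bottom edges have to be matched, since
these edges form a path through all the vertices. -/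
theorem exists_vertex_values (x : Fin (g + 1) → ℝ) (y : Fin g → ℝ) :
    ∃ val : Vertex g → ℝ, (∀ k, val (Sum.inr k) = val (Sum.inl k) + x k) ∧
      ∀ k : Fin g, val (Sum.inl k.succ) = val (Sum.inr k.castSucc) + y k := by
  let w : Fin (g + 1) → ℝ :=
    Fin.induction (motive := fun _ => ℝ) 0 fun k z => z + x k.castSucc + y k
  refine ⟨Sum.elim w fun k => w k + x k, fun k => rfl, fun k => ?_⟩
  simp only [Sum.elim_inl, Sum.elim_inr, w, Fin.induction_succ]

theorem Balanced.exists_ord_eq {D : Γ.graph.Divisor} {κt κb : Fin g → ℤ} {σ : Fin (g + 1) → ℤ}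
    (h : Balanced D κt κb σ) :
    ∃ f : Γ.graph.Point → ℝ, Γ.graph.IsPL f ∧ (∀ p, Γ.graph.ord f p = D p) ∧
      (∀ k t, 0 ≤ t → t ≤ Γ.bridgeLen (k : Fin (g + 1)) → f (Γ.graph.onEdge (bridge k) t) =
        f (Γ.wPoint k) + σ k * t - hinge (bridge k) t D) ∧
      (∀ k t, 0 ≤ t → t ≤ Γ.topLen ((k : Fin g) + 1) → f (Γ.graph.onEdge (top k) t) =
        f (Γ.vSuccPoint k.castSucc) + κt k * t - hinge (top k) t D) ∧
      ∀ k : Fin g, f (Γ.wPoint k.succ) = f (Γ.vSuccPoint k.castSucc) +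
        κb k * Γ.botLen (k + 1) - hinge (bot k) (Γ.botLen (k + 1)) D := by
  obtain ⟨val, hbridge, hbot⟩ := exists_vertex_values
    (fun k => σ k * Γ.bridgeLen k - hinge (bridge k) (Γ.bridgeLen k) D)
    (fun k => κb k * Γ.botLen (k + 1) - hinge (bot k) (Γ.botLen (k + 1)) D)
  let κ : Edge g → ℤ := Sum.elim κt (Sum.elim κb σ)
  have hE : ∀ e, val (Γ.graph.tgt e) =
      val (Γ.graph.src e) + κ e * Γ.graph.len e - hinge e (Γ.graph.len e) D := by
    rintro (k | k | k)
    · exact (hbot k).trans (by rw [← h.loop, add_sub_assoc]; rfl)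
    · exact (hbot k).trans (add_sub_assoc ..).symm
    · exact (hbridge k).trans (add_sub_assoc ..).symm
  have hV : ∀ x, D (Point.vertex x) = Γ.graph.netFlow (fun e => κ e - degOn e D) κ x := by
    rintro (k | k)
    · refine Fin.cases ?_ (fun k => ?_) k
      · rw [netFlow_start]; exact h.start
      · rw [netFlow_right]; exact h.right k
    · refine Fin.lastCases ?_ (fun k => ?_) k
      · rw [netFlow_finish]; exact h.finish
      · rw [netFlow_left]; exact h.left k
  obtain ⟨f, hPL, hord, hval, hf⟩ := MetricGraph.exists_ord_eq D κ val hE hV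
  refine ⟨f, hPL, hord, fun k t ht0 ht1 => ?_, fun k t ht0 ht1 => ?_, fun k => ?_⟩
  · rw [hf (bridge k) t ht0 ht1, wPoint, hval]; rfl
  · rw [hf (top k) t ht0 ht1, vSuccPoint, hval]; rfl
  · rw [wPoint, vSuccPoint, hval, hval, hbot, add_sub_assoc]

theorem linEquiv_iff {D D' : Γ.graph.Divisor} :
    MetricGraph.LinEquiv D D' ↔ ∃ κt κb σ, Balanced (D' - D) κt κb σ := by
  constructor
  · rintro ⟨f, hf, h⟩
    exact ⟨_, _, _, balanced_slopeForward hf fun p => by rw [Finsupp.sub_apply, h]; ring⟩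
  · rintro ⟨κt, κb, σ, h⟩
    obtain ⟨f, hPL, hord, -⟩ := h.exists_ord_eq
    exact ⟨f, hPL, fun p => by rw [hord, Finsupp.sub_apply]; ring⟩

variable (Γ) in
/-- The divisor with `c x` chips at the vertices `x`, and with `d k` and `d' k` chips at the points
with coordinates `a k` and `b k` of the top and bottom edges of the loops. -/
noncomputable def loopDivisor (c : Vertex g → ℤ) (a b : Fin g → ℝ) (d d' : Fin g → ℤ) :
    Γ.graph.Divisor :=
  (∑ x, Finsupp.single (Point.vertex x) (c x)) +
    (∑ k, Finsupp.single (Γ.graph.onEdge (top k) (a k)) (d k) +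
      ∑ k, Finsupp.single (Γ.graph.onEdge (bot k) (b k)) (d' k))

/-- The coordinates are those of interior points. -/
def Inside (Γ : ChainOfLoops g) (a b : Fin g → ℝ) : Prop :=
  ∀ k : Fin g, (0 < a k ∧ a k < Γ.graph.len (top k)) ∧ 0 < b k ∧ b k < Γ.graph.len (bot k)

section loopDivisor

variable {c : Vertex g → ℤ} {a b : Fin g → ℝ} {d d' : Fin g → ℤ}

theorem loopDivisor_eq (h : Inside Γ a b) : loopDivisor Γ c a b d d' =
    (∑ x, Finsupp.single (Point.vertex x) (c x)) +
    (∑ k, Finsupp.single (Point.inner (top k) (a k) (h k).1.1 (h k).1.2) (d k) +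
      ∑ k, Finsupp.single (Point.inner (bot k) (b k) (h k).2.1 (h k).2.2) (d' k)) := by
  unfold loopDivisor
  congr 2
  · exact Finset.sum_congr rfl fun k _ => by rw [onEdge_inner _ _ (h k).1.1 (h k).1.2]
  · exact Finset.sum_congr rfl fun k _ => by rw [onEdge_inner _ _ (h k).2.1 (h k).2.2]

theorem loopDivisor_vertex (h : Inside Γ a b) (x : Vertex g) :
    loopDivisor Γ c a b d d' (Point.vertex x) = c x := by
  classical
  rw [loopDivisor_eq h]
  rcases x with x | x <;> simp [Finsupp.single_apply]

theorem loopDivisor_top (h : Inside Γ a b) (k : Fin g) (t : ℝ) (h0 : 0 < t)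
    (h1 : t < Γ.graph.len (top k)) :
    loopDivisor Γ c a b d d' (Point.inner (top k) t h0 h1) = if a k = t then d k else 0 := by
  classical
  rw [loopDivisor_eq h]
  simp only [Finsupp.add_apply, Finsupp.finsetSum_apply, Finsupp.single_apply, reduceCtorEq,
    if_false, Finset.sum_const_zero, zero_add, Point.inner.injEq, Sum.inl.injEq, false_and,
    add_zero]
  rw [Finset.sum_eq_single k]
  · simp
  · intro j _ hj; simp [hj]
  · simp

theorem loopDivisor_bot (h : Inside Γ a b) (k : Fin g) (t : ℝ) (h0 : 0 < t)
    (h1 : t < Γ.graph.len (bot k)) :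
    loopDivisor Γ c a b d d' (Point.inner (bot k) t h0 h1) = if b k = t then d' k else 0 := by
  classical
  rw [loopDivisor_eq h]
  simp only [Finsupp.add_apply, Finsupp.finsetSum_apply, Finsupp.single_apply, reduceCtorEq,
    if_false, Finset.sum_const_zero, zero_add, Point.inner.injEq, Sum.inl.injEq, false_and,
    Sum.inr.injEq]
  rw [Finset.sum_eq_single k]
  · simp
  · intro j _ hj; simp [hj]
  · simp

theorem loopDivisor_bridge (h : Inside Γ a b) (k : Fin (g + 1)) (t : ℝ) (h0 : 0 < t)
    (h1 : t < Γ.graph.len (bridge k)) :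
    loopDivisor Γ c a b d d' (Point.inner (bridge k) t h0 h1) = 0 := by
  classical
  rw [loopDivisor_eq h]
  simp

theorem loopDivisor_nonneg (h : Inside Γ a b) (hc : ∀ x, 0 ≤ c x) (hd : ∀ k, 0 ≤ d k)
    (hd' : ∀ k, 0 ≤ d' k) : 0 ≤ loopDivisor Γ c a b d d' := by
  intro p
  rcases p with x | ⟨k | k | k, t, h0, h1⟩
  · rw [loopDivisor_vertex h]; exact hc x
  · rw [loopDivisor_top h]; split_ifs
    exacts [hd k, le_rfl]
  · rw [loopDivisor_bot h]; split_ifs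
    exacts [hd' k, le_rfl]
  · rw [loopDivisor_bridge h]; rfl

theorem degOn_loopDivisor_top (h : Inside Γ a b) (k : Fin g) :
    degOn (top k) (loopDivisor Γ c a b d d') = d k := by
  rw [loopDivisor_eq h]
  simp [degOn, onInterior]

theorem degOn_loopDivisor_bot (h : Inside Γ a b) (k : Fin g) :
    degOn (bot k) (loopDivisor Γ c a b d d') = d' k := by
  rw [loopDivisor_eq h]
  simp [degOn, onInterior]

theorem degOn_loopDivisor_bridge (h : Inside Γ a b) (k : Fin (g + 1)) :
    degOn (bridge k) (loopDivisor Γ c a b d d') = 0 := by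
  rw [loopDivisor_eq h]
  simp [degOn, onInterior]

theorem hinge_loopDivisor_top (h : Inside Γ a b) (k : Fin g) (t : ℝ) :
    hinge (top k) t (loopDivisor Γ c a b d d') = d k * max 0 (t - a k) := by
  rw [loopDivisor_eq h]
  simp [hinge, onInterior]

theorem hinge_loopDivisor_bot (h : Inside Γ a b) (k : Fin g) (t : ℝ) :
    hinge (bot k) t (loopDivisor Γ c a b d d') = d' k * max 0 (t - b k) := by
  rw [loopDivisor_eq h]
  simp [hinge, onInterior]

theorem hinge_loopDivisor_bridge (h : Inside Γ a b) (k : Fin (g + 1)) (t : ℝ) :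
    hinge (bridge k) t (loopDivisor Γ c a b d d') = 0 := by
  rw [loopDivisor_eq h]
  simp [hinge, onInterior]

end loopDivisor

end ChainOfLoops

/-! ### The divisor class of a path of slopes -/

theorem eq_zero_of_mul_add_eq {κ x : ℤ} {ℓ m G : ℝ} (hm : 0 < m) (hℓ : G * m < ℓ)
    (hx : |(x : ℝ)| ≤ G) (h : κ * (ℓ + m) = x * m) : κ = 0 ∧ x = 0 := by
  have hG : 0 ≤ G := (abs_nonneg _).trans hx
  have hpos : 0 < ℓ + m := by nlinarith
  have habs : |(κ : ℝ)| * (ℓ + m) = |(x : ℝ)| * m := by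
    simpa only [abs_mul, abs_of_pos hpos, abs_of_pos hm] using congrArg abs h
  have hlt : |(κ : ℝ)| < 1 := by
    by_contra! hcon
    nlinarith
  have hκ : κ = 0 := Int.abs_lt_one_iff.1 (by exact_mod_cast hlt)
  rw [hκ, Int.cast_zero, zero_mul] at h
  exact ⟨hκ, by exact_mod_cast (mul_eq_zero.1 h.symm).resolve_right hm.ne'⟩

/-- A family `p k i` of slopes on the bridges of a chain of loops, where the slopes equal to `P k`
increase by one at the loop after the bridge `k`. -/
structure SlopePath (g r s : ℕ) (p : ℕ → ℕ → ℤ) (P : ℕ → ℤ) : Prop where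
  start : ∀ i ≤ r, p 0 i = r - i
  finish : ∀ i ≤ r, p g i = r - i + s
  step : ∀ k < g, ∀ i ≤ r, p (k + 1) i = p k i + if p k i = P k then 1 else 0
  anti : ∀ k ≤ g, ∀ i j, i < j → j ≤ r → p k j < p k i
  skip : ∀ k < g, ∀ i ≤ r, p k i ≠ P k + 1
  nonneg : ∀ k ≤ g, ∀ i ≤ r, 0 ≤ p k i
  le : ∀ k ≤ g, ∀ i ≤ r, p k i ≤ r + s
  special_nonneg : ∀ k < g, 0 ≤ P k
  special_le : ∀ k < g, P k ≤ r + s + 1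
  succ_le_genus : r + 1 ≤ g
  add_le_genus : r + s ≤ g

namespace SlopePath

variable {g r s : ℕ} {p : ℕ → ℕ → ℤ} {P : ℕ → ℤ}

theorem abs_sub_special_le (hP : SlopePath g r s p P) {k : ℕ} (hk : k < g) {i : ℕ} (hi : i ≤ r) :
    |p k i - P k| ≤ r + s + 1 := by
  have := hP.nonneg k hk.le i hi
  have := hP.le k hk.le i hi
  have := hP.special_nonneg k hk
  have := hP.special_le k hk
  rw [abs_le]; constructor <;> omega

theorem add_two_le (hP : SlopePath g r s p P) {k : ℕ} (hk : k < g) {i : ℕ} (hi : i ≤ r)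
    (h : P k < p k i) : P k + 2 ≤ p k i := by
  have := hP.skip k hk i hi
  omega

end SlopePath

namespace ChainOfLoops

open MetricGraph

variable {g r s : ℕ} {Γ : ChainOfLoops g} {p : ℕ → ℕ → ℤ} {P : ℕ → ℤ}

/-- Every bottom edge is shorter than the top edge of its loop by a factor of more than `4 * g`. -/
def ShortBottoms (Γ : ChainOfLoops g) : Prop :=
  ∀ k : Fin g, 4 * g * Γ.botLen (k + 1) < Γ.topLen (k + 1)

theorem bot_pos (Γ : ChainOfLoops g) (k : Fin g) : 0 < Γ.botLen (k + 1) :=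
  Γ.botLen_pos _ (by omega) (by omega)

theorem top_pos (Γ : ChainOfLoops g) (k : Fin g) : 0 < Γ.topLen (k + 1) :=
  Γ.topLen_pos _ (by omega) (by omega)

/-- The multiplicities at the vertices of `baseDivisor`. -/
def baseCoeff (g r s : ℕ) (P : ℕ → ℤ) : Vertex g → ℤ :=
  Sum.elim (Fin.cases r fun k : Fin g => 1 + P k)
    (Fin.lastCases (-(s : ℤ)) fun k : Fin g => -P k)

/-- A divisor supported at the vertices, representing the class in which a function can gain slope
at a loop only if its slope before the loop is the special slope `P k`. -/
noncomputable def baseDivisor (Γ : ChainOfLoops g) (r s : ℕ) (P : ℕ → ℤ) : Γ.graph.Divisor :=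
  ∑ x, Finsupp.single (Point.vertex x) (baseCoeff g r s P x)

theorem baseDivisor_vertex (x : Vertex g) :
    baseDivisor Γ r s P (Point.vertex x) = baseCoeff g r s P x := by
  classical
  rcases x with x | x <;> simp [baseDivisor, Finsupp.single_apply]

theorem baseDivisor_w_zero : baseDivisor Γ r s P (Γ.wPoint 0) = r := baseDivisor_vertex _

theorem baseDivisor_w_succ (k : Fin g) : baseDivisor Γ r s P (Γ.wPoint k.succ) = 1 + P k :=
  baseDivisor_vertex _

theorem baseDivisor_v_castSucc (k : Fin g) :
    baseDivisor Γ r s P (Γ.vSuccPoint k.castSucc) = -P k :=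
  (baseDivisor_vertex _).trans (by simp [baseCoeff])

theorem baseDivisor_v_last : baseDivisor Γ r s P (Γ.vSuccPoint (Fin.last g)) = -s :=
  (baseDivisor_vertex _).trans (by simp [baseCoeff])

theorem edgeSum_baseDivisor {A : Type*} [AddCommGroup A] (e : Edge g) (φ : ℝ → A) :
    edgeSum e φ (baseDivisor Γ r s P) = 0 := by
  simp [baseDivisor, onInterior]

theorem degOn_baseDivisor (e : Edge g) : degOn e (baseDivisor Γ r s P) = 0 :=
  edgeSum_baseDivisor e _

theorem hinge_baseDivisor (e : Edge g) (t : ℝ) : hinge e t (baseDivisor Γ r s P) = 0 :=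
  edgeSum_baseDivisor e _

theorem deg_baseDivisor : deg (baseDivisor Γ r s P) = (g : ℤ) + r - s := by
  simp only [baseDivisor, deg_sum, deg_single]
  rw [Fintype.sum_sum_type, Fin.sum_univ_succ,
    Fin.sum_univ_castSucc (f := fun k => baseCoeff g r s P (Sum.inr k))]
  simp [baseCoeff, Finset.sum_add_distrib]
  ring

/-- The position, on the top edge of the loop `k + 1`, of the chip of the end divisor `i`.  There is
no such chip if `p k i = P k`; the midpoint is then a placeholder. -/
noncomputable def endCoord (Γ : ChainOfLoops g) (p : ℕ → ℕ → ℤ) (P : ℕ → ℤ) (i : ℕ) (k : Fin g) :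
    ℝ :=
  if p k i < P k then Γ.topLen (k + 1) - (P k - p k i) * Γ.botLen (k + 1)
  else if p k i = P k then Γ.topLen (k + 1) / 2
  else (p k i - P k - 1) * Γ.botLen (k + 1)

/-- The multiplicities at the vertices of `endDivisor`. -/
def endCoeff (g r i : ℕ) : Vertex g → ℤ :=
  Sum.elim (Fin.cases i fun _ : Fin g => 0) (Fin.lastCases ((r : ℤ) - i) fun _ : Fin g => 0)

/-- The effective divisor in the class of `baseDivisor` with `i` chips at `w_0` and `r - i` chips at
`v_{g+1}`. -/
noncomputable def endDivisor (Γ : ChainOfLoops g) (r : ℕ) (p : ℕ → ℕ → ℤ) (P : ℕ → ℤ) (i : ℕ) :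
    Γ.graph.Divisor :=
  loopDivisor Γ (endCoeff g r i) (endCoord Γ p P i) (fun k => Γ.botLen (k + 1) / 2)
    (fun k => if p k i = P k then 0 else 1) 0

theorem loop_bound (hP : SlopePath g r s p P) (hΓ : ShortBottoms Γ) (k : Fin g) (x : ℤ)
    (hx : |x| ≤ r + s + 1) : |(x : ℝ)| * Γ.botLen (k + 1) < Γ.topLen (k + 1) / 2 := by
  have hm := Γ.bot_pos k
  have h2 : |(x : ℝ)| ≤ 2 * g := by
    rw [← Int.cast_abs]
    have := hP.succ_le_genus; have := hP.add_le_genus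
    have : |x| ≤ 2 * g := by omega
    exact_mod_cast this
  have := hΓ k
  nlinarith

theorem endCoord_of_gt (hP : SlopePath g r s p P) (hΓ : ShortBottoms Γ) {i : ℕ} (hi : i ≤ r)
    (k : Fin g) (h : P k + 2 ≤ p k i) :
    endCoord Γ p P i k = (p k i - P k - 1) * Γ.botLen (k + 1) ∧ 0 < endCoord Γ p P i k ∧
      endCoord Γ p P i k < Γ.topLen (k + 1) / 2 := by
  have hm := Γ.bot_pos k
  have e : endCoord Γ p P i k = (p k i - P k - 1) * Γ.botLen (k + 1) := by
    rw [endCoord, if_neg (by omega), if_neg (by omega)]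
  have hb := loop_bound hP hΓ k _ (hP.abs_sub_special_le k.2 hi)
  have h' : (P k : ℝ) + 2 ≤ p k i := by exact_mod_cast h
  rw [Int.cast_sub, abs_of_nonneg (by linarith)] at hb
  refine ⟨e, ?_, ?_⟩ <;> rw [e] <;> nlinarith

theorem endCoord_of_lt (hP : SlopePath g r s p P) (hΓ : ShortBottoms Γ) {i : ℕ} (hi : i ≤ r)
    (k : Fin g) (h : p k i < P k) :
    endCoord Γ p P i k = Γ.topLen (k + 1) - (P k - p k i) * Γ.botLen (k + 1) ∧
      Γ.topLen (k + 1) / 2 < endCoord Γ p P i k ∧ endCoord Γ p P i k < Γ.topLen (k + 1) := by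
  have hm := Γ.bot_pos k
  have e : endCoord Γ p P i k = Γ.topLen (k + 1) - (P k - p k i) * Γ.botLen (k + 1) := by
    rw [endCoord, if_pos h]
  have hb := loop_bound hP hΓ k _ (hP.abs_sub_special_le k.2 hi)
  have h' : (p k i : ℝ) + 1 ≤ P k := by exact_mod_cast h
  rw [Int.cast_sub, abs_of_nonpos (by linarith)] at hb
  refine ⟨e, ?_, ?_⟩ <;> rw [e] <;> nlinarith

theorem inside_endCoord (hP : SlopePath g r s p P) (hΓ : ShortBottoms Γ) {i : ℕ} (hi : i ≤ r) :
    Inside Γ (endCoord Γ p P i) (fun k => Γ.botLen (k + 1) / 2) := fun k => by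
  have hm := Γ.bot_pos k
  have hℓ := Γ.top_pos k
  rw [len_top, len_bot]
  refine ⟨?_, by linarith, by linarith⟩
  rcases lt_trichotomy (p k i) (P k) with hlt | heq | hgt
  · have := endCoord_of_lt hP hΓ hi k hlt
    constructor <;> linarith
  · rw [endCoord, if_neg heq.not_lt, if_pos heq]
    constructor <;> linarith
  · have := endCoord_of_gt hP hΓ hi k (hP.add_two_le k.2 hi hgt)
    constructor <;> linarith

theorem endDivisor_nonneg (hP : SlopePath g r s p P) (hΓ : ShortBottoms Γ) {i : ℕ} (hi : i ≤ r) :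
    0 ≤ endDivisor Γ r p P i := by
  refine loopDivisor_nonneg (inside_endCoord hP hΓ hi) ?_ ?_ fun _ => le_rfl
  · rintro (k | k)
    · refine Fin.cases ?_ (fun _ => ?_) k <;> simp [endCoeff]
    · refine Fin.lastCases ?_ (fun _ => ?_) k <;> simp [endCoeff, hi]
  · intro _; split_ifs <;> simp

/-- `f` has slope `S k` on the bridge `k`, and changes by `U k` along the loop `k + 1` and by `H k`
from the start of this loop to the middle of its top edge, both in units of the bottom length. -/
structure HasProfile (Γ : ChainOfLoops g) (f : Γ.graph.Point → ℝ) (S U H : ℕ → ℤ) : Prop where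
  bridge : ∀ (k : Fin (g + 1)) t, 0 ≤ t → t ≤ Γ.bridgeLen k →
    f (Γ.graph.onEdge (bridge k) t) = f (Γ.wPoint k) + S k * t
  half : ∀ k : Fin g, f (Γ.graph.onEdge (top k) (Γ.topLen (k + 1) / 2)) =
    f (Γ.wPoint k.castSucc) + S k * Γ.bridgeLen k + Γ.botLen (k + 1) * H k
  loop : ∀ k : Fin g, f (Γ.wPoint k.succ) =
    f (Γ.wPoint k.castSucc) + S k * Γ.bridgeLen k + Γ.botLen (k + 1) * U k

/-- The change along the loop `k + 1`, in units of the bottom length, of a function that moves the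
base divisor to the end divisor of index `i`. -/
def loopChange (p : ℕ → ℕ → ℤ) (P : ℕ → ℤ) (k i : ℕ) : ℤ :=
  if p k i ≤ P k then p k i - P k else p k i - P k - 1

/-- The change from the start of the loop `k + 1` to the middle of its top edge, in units of the
bottom length, of a function that moves the base divisor to the end divisor of index `i`. -/
def halfChange (p : ℕ → ℕ → ℤ) (P : ℕ → ℤ) (k i : ℕ) : ℤ := max 0 (p k i - P k - 1)

section endDivisor

variable (hP : SlopePath g r s p P) (hΓ : ShortBottoms Γ) {i : ℕ} (hi : i ≤ r)

include hP hΓ hi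

theorem endDivisor_w_zero : endDivisor Γ r p P i (Γ.wPoint 0) = i :=
  loopDivisor_vertex (inside_endCoord hP hΓ hi) _

theorem endDivisor_w_succ (k : Fin g) : endDivisor Γ r p P i (Γ.wPoint k.succ) = 0 :=
  loopDivisor_vertex (inside_endCoord hP hΓ hi) _

theorem endDivisor_v_castSucc (k : Fin g) :
    endDivisor Γ r p P i (Γ.vSuccPoint k.castSucc) = 0 := by
  refine (loopDivisor_vertex (inside_endCoord hP hΓ hi) _).trans ?_
  simp [endCoeff]

theorem endDivisor_v_last : endDivisor Γ r p P i (Γ.vSuccPoint (Fin.last g)) = (r : ℤ) - i := by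
  refine (loopDivisor_vertex (inside_endCoord hP hΓ hi) _).trans ?_
  simp [endCoeff]

theorem mul_len_sub_hinge_endDivisor_top (k : Fin g) :
    (if p k i ≤ P k then 0 else 1 : ℤ) * Γ.topLen (k + 1) -
        hinge (top k) (Γ.topLen (k + 1)) (endDivisor Γ r p P i) =
      (if p k i ≤ P k then p k i - P k else p k i - P k - 1 : ℤ) * Γ.botLen (k + 1) := by
  rw [endDivisor, hinge_loopDivisor_top (inside_endCoord hP hΓ hi)]
  rcases lt_trichotomy (p k i) (P k) with hlt | heq | hgt
  · obtain ⟨hcoord, -, hlen⟩ := endCoord_of_lt hP hΓ hi k hlt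
    rw [max_eq_right (by linarith), hcoord]
    simp [hlt.le, hlt.ne]
    ring
  · simp [heq]
  · have hℓ := Γ.top_pos k
    obtain ⟨hcoord, -, hhalf⟩ := endCoord_of_gt hP hΓ hi k (hP.add_two_le k.2 hi hgt)
    rw [max_eq_right (by linarith), hcoord]
    simp [hgt.not_ge, hgt.ne']

theorem mul_half_sub_hinge_endDivisor_top (k : Fin g) :
    (if p k i ≤ P k then 0 else 1 : ℤ) * (Γ.topLen (k + 1) / 2) -
        hinge (top k) (Γ.topLen (k + 1) / 2) (endDivisor Γ r p P i) =
      Γ.botLen (k + 1) * (max 0 (p k i - P k - 1) : ℤ) := by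
  rw [endDivisor, hinge_loopDivisor_top (inside_endCoord hP hΓ hi)]
  rcases lt_trichotomy (p k i) (P k) with hlt | heq | hgt
  · obtain ⟨-, hhalf, -⟩ := endCoord_of_lt hP hΓ hi k hlt
    rw [max_eq_left (by linarith), max_eq_left (by omega)]
    simp [hlt.le]
  · simp [heq]
  · obtain ⟨hcoord, -, hhalf⟩ := endCoord_of_gt hP hΓ hi k (hP.add_two_le k.2 hi hgt)
    rw [max_eq_right (by linarith), max_eq_right (by omega), hcoord]
    simp [hgt.not_ge, hgt.ne', mul_comm]

theorem balanced_endDivisor :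
    Balanced (endDivisor Γ r p P i - baseDivisor Γ r s P) (fun k => if p k i ≤ P k then 0 else 1)
      (fun k => if p k i ≤ P k then p k i - P k else p k i - P k - 1) (fun k => p k i) := by
  have hI := inside_endCoord hP hΓ hi
  refine ⟨?_, fun k => ?_, fun k => ?_, ?_, fun k => ?_⟩
  · rw [Finsupp.sub_apply, endDivisor_w_zero hP hΓ hi, baseDivisor_w_zero, Fin.val_zero,
      hP.start i hi]
    ring
  · rw [Finsupp.sub_apply, endDivisor_v_castSucc hP hΓ hi, baseDivisor_v_castSucc, map_sub,
      degOn_baseDivisor, endDivisor, degOn_loopDivisor_bridge hI, Fin.val_castSucc]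
    split_ifs <;> ring
  · rw [Finsupp.sub_apply, endDivisor_w_succ hP hΓ hi, baseDivisor_w_succ, map_sub, map_sub,
      degOn_baseDivisor, degOn_baseDivisor, endDivisor, degOn_loopDivisor_top hI,
      degOn_loopDivisor_bot hI, Fin.val_succ, hP.step k k.2 i hi]
    have := hP.skip k k.2 i hi
    split_ifs <;> simp <;> omega
  · rw [Finsupp.sub_apply, endDivisor_v_last hP hΓ hi, baseDivisor_v_last, map_sub,
      degOn_baseDivisor, endDivisor, degOn_loopDivisor_bridge hI, Fin.val_last, hP.finish i hi]
    ring
  · rw [map_sub, map_sub, hinge_baseDivisor, hinge_baseDivisor, sub_zero, sub_zero,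
      mul_len_sub_hinge_endDivisor_top hP hΓ hi, endDivisor, hinge_loopDivisor_bot hI]
    simp

theorem exists_hasProfile_endDivisor :
    ∃ f : Γ.graph.Point → ℝ, MovesTo f (baseDivisor Γ r s P) (endDivisor Γ r p P i) ∧
      HasProfile Γ f (p · i) (loopChange p P · i) (halfChange p P · i) := by
  have hI := inside_endCoord hP hΓ hi
  obtain ⟨f, hPL, hord, hbridge, htop, hbot⟩ := (balanced_endDivisor hP hΓ hi).exists_ord_eq
  have hslope : ∀ (k : Fin (g + 1)) t, 0 ≤ t → t ≤ Γ.bridgeLen k →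
      f (Γ.graph.onEdge (bridge k) t) = f (Γ.wPoint k) + p k i * t := fun k t ht0 ht1 => by
    rw [hbridge k t ht0 ht1, map_sub, hinge_baseDivisor, endDivisor, hinge_loopDivisor_bridge hI]
    ring
  have hend : ∀ k : Fin g, f (Γ.vSuccPoint k.castSucc) =
      f (Γ.wPoint k.castSucc) + p k i * Γ.bridgeLen k := fun k => by
    have hlen := onEdge_len (Γ := Γ.graph) (bridge k.castSucc)
    rw [len_bridge] at hlen
    have hval := hslope k.castSucc (Γ.bridgeLen k.castSucc) (Γ.bridgeLen_pos k (by omega)).le le_rfl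
    rw [hlen] at hval
    exact hval
  refine ⟨f, ⟨hPL, fun q => by rw [hord, Finsupp.sub_apply]; ring⟩, hslope, fun k => ?_,
    fun k => ?_⟩
  · have hℓ := Γ.top_pos k
    rw [← hend, htop k _ (by linarith) (by linarith), map_sub, hinge_baseDivisor, sub_zero,
      add_sub_assoc, mul_half_sub_hinge_endDivisor_top hP hΓ hi, halfChange]
  · rw [← hend, hbot k, map_sub, hinge_baseDivisor, endDivisor, hinge_loopDivisor_bot hI]
    simp [loopChange, mul_comm]

end endDivisor

end ChainOfLoops

/-! ### Uniqueness of the end divisors -/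

theorem int_eq_of_mul_lt {κ n : ℤ} {L : ℝ} (hL : 0 < L) (h₁ : (n - 1 : ℤ) * L < κ * L)
    (h₂ : κ * L < (n + 1 : ℤ) * L) : κ = n := by
  have h₁' : n - 1 < κ := by exact_mod_cast lt_of_mul_lt_mul_right h₁ hL.le
  have h₂' : κ < n + 1 := by exact_mod_cast lt_of_mul_lt_mul_right h₂ hL.le
  omega

namespace ChainOfLoops

open MetricGraph

variable {g r s : ℕ} {Γ : ChainOfLoops g} {p : ℕ → ℕ → ℤ} {P : ℕ → ℤ}

section loop

variable (hP : SlopePath g r s p P) (hΓ : ShortBottoms Γ) (k : Fin g) {i : ℕ} (hi : i ≤ r)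

include hP hΓ hi

theorem sub_special_mul_bounds :
    -(Γ.topLen (k + 1) / 2) < (p k i - P k) * Γ.botLen (k + 1) ∧
      ((p k i : ℝ) - P k) * Γ.botLen (k + 1) < Γ.topLen (k + 1) / 2 := by
  rw [← abs_lt, abs_mul, abs_of_pos (Γ.bot_pos k)]
  exact_mod_cast loop_bound hP hΓ k _ (hP.abs_sub_special_le k.2 hi)

theorem endCoord_eq_of_top_chip (hne : p k i ≠ P k) {κ : ℤ} {a : ℝ} (ha0 : 0 < a)
    (ha1 : a < Γ.topLen (k + 1))
    (h : κ * (Γ.topLen (k + 1) + Γ.botLen (k + 1)) =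
      (p k i - P k) * Γ.botLen (k + 1) + (Γ.topLen (k + 1) - a)) :
    endCoord Γ p P i k = a := by
  have hℓ := Γ.top_pos k
  have hm := Γ.bot_pos k
  obtain ⟨hlow, hhigh⟩ := sub_special_mul_bounds hP hΓ k hi
  rcases lt_or_gt_of_ne hne with hlt | hgt
  · have hq : (p k i : ℝ) + 1 ≤ P k := by exact_mod_cast hlt
    have hκ : κ = 0 := int_eq_of_mul_lt (L := Γ.topLen (k + 1) + Γ.botLen (k + 1))
      (by linarith) (by push_cast; nlinarith) (by push_cast; nlinarith)
    rw [(endCoord_of_lt hP hΓ hi k hlt).1]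
    rw [hκ, Int.cast_zero] at h
    linarith
  · have hgt' := hP.add_two_le k.2 hi hgt
    have hq : (P k : ℝ) + 2 ≤ p k i := by exact_mod_cast hgt'
    have hκ : κ = 1 := int_eq_of_mul_lt (L := Γ.topLen (k + 1) + Γ.botLen (k + 1))
      (by linarith) (by push_cast; nlinarith) (by push_cast; nlinarith)
    rw [(endCoord_of_gt hP hΓ hi k hgt').1]
    rw [hκ, Int.cast_one] at h
    linarith

theorem no_bottom_chip {κ : ℤ} {b : ℝ} (hb0 : 0 < b) (hb1 : b < Γ.botLen (k + 1))
    (h : κ * (Γ.topLen (k + 1) + Γ.botLen (k + 1)) =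
      (p k i - P k) * Γ.botLen (k + 1) - (Γ.botLen (k + 1) - b)) : False := by
  have hℓ := Γ.top_pos k
  have hm := Γ.bot_pos k
  obtain ⟨hlow, hhigh⟩ := sub_special_mul_bounds hP hΓ k hi
  have hκ : κ = 0 := int_eq_of_mul_lt (L := Γ.topLen (k + 1) + Γ.botLen (k + 1))
    (by linarith) (by push_cast; linarith) (by push_cast; linarith)
  rw [hκ, Int.cast_zero, zero_mul] at h
  rcases lt_or_ge (P k) (p k i) with hgt | hle
  · have : (P k : ℝ) + 1 ≤ p k i := by exact_mod_cast hgt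
    nlinarith
  · have : (p k i : ℝ) ≤ P k := by exact_mod_cast hle
    nlinarith

end loop

section uniqueness

variable {D : Γ.graph.Divisor} {κt κb : Fin g → ℤ} {σ : Fin (g + 1) → ℤ}
  (hP : SlopePath g r s p P) (hΓ : ShortBottoms Γ) (hD : 0 ≤ D)
  (hb : Balanced (D - baseDivisor Γ r s P) κt κb σ)

include hb

theorem Balanced.start_eq : D (Γ.wPoint 0) = r - σ 0 := by
  have := hb.start
  rw [Finsupp.sub_apply, baseDivisor_w_zero] at this
  omega

theorem Balanced.left_eq (k : Fin g) : D (Γ.vSuccPoint k.castSucc) =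
    σ k.castSucc - degOn (bridge k.castSucc) D - κt k - κb k - P k := by
  have := hb.left k
  rw [Finsupp.sub_apply, baseDivisor_v_castSucc, map_sub, degOn_baseDivisor] at this
  omega

theorem Balanced.right_eq (k : Fin g) : D (Γ.wPoint k.succ) =
    1 + P k + κt k - degOn (top k) D + κb k - degOn (bot k) D - σ k.succ := by
  have := hb.right k
  rw [Finsupp.sub_apply, baseDivisor_w_succ, map_sub, map_sub, degOn_baseDivisor,
    degOn_baseDivisor] at this
  omega

theorem Balanced.finish_eq : D (Γ.vSuccPoint (Fin.last g)) =
    σ (Fin.last g) - degOn (bridge (Fin.last g)) D - s := by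
  have := hb.finish
  rw [Finsupp.sub_apply, baseDivisor_v_last, map_sub, degOn_baseDivisor] at this
  omega

theorem Balanced.loop_eq (k : Fin g) :
    κt k * Γ.topLen (k + 1) - hinge (top k) (Γ.topLen (k + 1)) D =
      κb k * Γ.botLen (k + 1) - hinge (bot k) (Γ.botLen (k + 1)) D := by
  have := hb.loop k
  rwa [map_sub, map_sub, hinge_baseDivisor, hinge_baseDivisor, sub_zero, sub_zero] at this

include hD

theorem Balanced.succ_le (k : Fin g) :
    σ k.succ ≤ σ k.castSucc - degOn (bridge k.castSucc) D + 1 := by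
  have h1 := hb.left_eq k
  have h2 := hb.right_eq k
  have h3 : 0 ≤ D (Γ.vSuccPoint k.castSucc) := hD _
  have h4 : 0 ≤ D (Γ.wPoint k.succ) := hD _
  have h5 := degOn_nonneg hD (top k)
  have h6 := degOn_nonneg hD (bot k)
  omega

theorem Balanced.lower_bound (k : Fin (g + 1)) : (s : ℤ) - g + k ≤ σ k := by
  induction k using Fin.reverseInduction with
  | last =>
    have h1 := hb.finish_eq
    have h3 : 0 ≤ D (Γ.vSuccPoint (Fin.last g)) := hD _
    have h5 := degOn_nonneg hD (bridge (Fin.last g))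
    rw [Fin.val_last]
    omega
  | cast k ih =>
    have h1 := hb.succ_le hD k
    have h5 := degOn_nonneg hD (bridge k.castSucc)
    rw [Fin.val_succ] at ih
    rw [Fin.val_castSucc]
    push_cast at ih
    omega

include hP hΓ

theorem Balanced.eq_special (k : Fin g)
    (hle : σ k.castSucc - degOn (bridge k.castSucc) D ≤ r + s)
    (h : σ k.succ = σ k.castSucc - degOn (bridge k.castSucc) D + 1) :
    σ k.castSucc - degOn (bridge k.castSucc) D = P k ∧ D (Γ.vSuccPoint k.castSucc) = 0 ∧
      D (Γ.wPoint k.succ) = 0 ∧ degOn (top k) D = 0 ∧ degOn (bot k) D = 0 := by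
  have h1 := hb.left_eq k
  have h2 := hb.right_eq k
  have h3 : 0 ≤ D (Γ.vSuccPoint k.castSucc) := hD _
  have h4 : 0 ≤ D (Γ.wPoint k.succ) := hD _
  have h5 := degOn_nonneg hD (top k)
  have h6 := degOn_nonneg hD (bot k)
  have t0 : degOn (top k) D = 0 := by omega
  have b0 : degOn (bot k) D = 0 := by omega
  have hl := hb.loop_eq k
  rw [hinge_eq_zero_of_degOn_eq_zero hD t0, hinge_eq_zero_of_degOn_eq_zero hD b0] at hl
  have low := hb.lower_bound hD k.succ
  have hg := hP.succ_le_genus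
  have hg' := hP.add_le_genus
  have hP0 := hP.special_nonneg k k.2
  have hP1 := hP.special_le k k.2
  rw [Fin.val_succ] at low
  push_cast at low
  have hx : |κt k + κb k| ≤ 4 * g := by
    rw [abs_le]; constructor <;> omega
  have hm := Γ.bot_pos k
  obtain ⟨e1, e2⟩ := eq_zero_of_mul_add_eq (κ := κt k) (x := κt k + κb k) hm (hΓ k)
    (by rw [← Int.cast_abs]; exact_mod_cast hx) (by push_cast; linarith)
  omega

theorem Balanced.lt_of_lt (k : Fin g) {i : ℕ} (hi : i ≤ r)
    (h : σ k.castSucc - degOn (bridge k.castSucc) D < p k i) : σ k.succ < p (k + 1) i := by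
  have h1 := hb.succ_le hD k
  have h2 := hP.le k k.2.le i hi
  have h3 := hP.step k k.2 i hi
  have h4 := hP.skip k k.2 i hi
  by_contra! hcon
  by_cases hs : σ k.succ = σ k.castSucc - degOn (bridge k.castSucc) D + 1
  · have := (hb.eq_special hP hΓ hD k (by omega) hs).1
    split_ifs at h3 <;> omega
  · split_ifs at h3 <;> omega

theorem Balanced.slope_ge {i : ℕ} (hi : i ≤ r)
    (hl : (r : ℤ) - i ≤ D (Γ.vSuccPoint (Fin.last g))) (k : Fin (g + 1)) :
    p k i ≤ σ k - degOn (bridge k) D := by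
  induction k using Fin.reverseInduction with
  | last =>
    have h1 := hb.finish_eq
    rw [Fin.val_last, hP.finish i hi]
    omega
  | cast k ih =>
    by_contra! hcon
    have h1 := hb.lt_of_lt hP hΓ hD k hi hcon
    have := degOn_nonneg hD (bridge k.succ)
    rw [Fin.val_succ] at ih
    omega

theorem Balanced.slope_le {i : ℕ} (hi : i ≤ r) (hl : (i : ℤ) ≤ D (Γ.wPoint 0))
    (k : Fin (g + 1)) : σ k ≤ p k i := by
  induction k using Fin.induction with
  | zero =>
    have h1 := hb.start_eq
    rw [Fin.val_zero, hP.start i hi]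
    omega
  | succ k ih =>
    have h1 := hb.succ_le hD k
    have h5 := degOn_nonneg hD (bridge k.castSucc)
    have h2 := hP.le k k.2.le i hi
    rw [Fin.val_castSucc] at ih
    rw [Fin.val_succ]
    by_cases hs : σ k.castSucc - degOn (bridge k.castSucc) D < p k i
    · exact (hb.lt_of_lt hP hΓ hD k hi hs).le
    · have h3 := hP.step k k.2 i hi
      by_cases hs' : σ k.succ = σ k.castSucc - degOn (bridge k.castSucc) D + 1
      · have := (hb.eq_special hP hΓ hD k (by omega) hs').1
        rw [if_pos (by omega)] at h3
        omega
      · split_ifs at h3 <;> omega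

theorem Balanced.exists_top_chip (k : Fin g) {i : ℕ} (hi : i ≤ r)
    (h : σ k.castSucc - degOn (bridge k.castSucc) D = p k i) (h' : σ k.succ = p k i)
    (hne : p k i ≠ P k) :
    D (Γ.vSuccPoint k.castSucc) = 0 ∧ D (Γ.wPoint k.succ) = 0 ∧ degOn (bot k) D = 0 ∧
      degOn (top k) D = 1 ∧ κb k = p k i - P k - κt k := by
  have hleft := hb.left_eq k
  have hright := hb.right_eq k
  have hv : 0 ≤ D (Γ.vSuccPoint k.castSucc) := hD _
  have hw : 0 ≤ D (Γ.wPoint k.succ) := hD _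
  have htop := degOn_nonneg hD (top k)
  have hbot := degOn_nonneg hD (bot k)
  have hloop := hb.loop_eq k
  by_cases ht : degOn (top k) D = 1
  · omega
  exfalso
  rw [hinge_eq_zero_of_degOn_eq_zero hD (by omega)] at hloop
  by_cases hbt : degOn (bot k) D = 1
  · obtain ⟨b, hb0, hb1, hhinge, -⟩ := exists_of_degOn_eq_one hD hbt
    rw [len_bot] at hb1
    rw [hhinge, max_eq_right (by linarith), (by omega : κb k = p k i - P k - κt k)] at hloop
    push_cast at hloop
    exact no_bottom_chip hP hΓ k hi (κ := κt k) hb0 hb1 (by linarith)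
  · rw [hinge_eq_zero_of_degOn_eq_zero hD (by omega)] at hloop
    have := hP.abs_sub_special_le k.2 hi
    have := hP.succ_le_genus
    have := hP.add_le_genus
    have hx : |κt k + κb k| ≤ 4 * g := by rw [abs_le] at *; constructor <;> omega
    have := (eq_zero_of_mul_add_eq (κ := κt k) (x := κt k + κb k) (Γ.bot_pos k) (hΓ k)
      (by exact_mod_cast hx) (by push_cast; linarith)).2
    have := hP.skip k k.2 i hi
    omega

theorem Balanced.loop_chip (k : Fin g) {i : ℕ} (hi : i ≤ r)
    (h : σ k.castSucc - degOn (bridge k.castSucc) D = p k i) (h' : σ k.succ = p k i)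
    (hne : p k i ≠ P k) :
    D (Γ.vSuccPoint k.castSucc) = 0 ∧ D (Γ.wPoint k.succ) = 0 ∧ degOn (bot k) D = 0 ∧
      ∀ t h0 h1, D (Point.inner (top k) t h0 h1) = if endCoord Γ p P i k = t then 1 else 0 := by
  obtain ⟨hv, hw, hbot, htop, hκ⟩ := hb.exists_top_chip hP hΓ hD k hi h h' hne
  obtain ⟨a, ha0, ha1, hhinge, happly⟩ := exists_of_degOn_eq_one hD htop
  rw [len_top] at ha1
  have hloop := hb.loop_eq k
  rw [hhinge, hinge_eq_zero_of_degOn_eq_zero hD hbot, max_eq_right (by linarith), hκ] at hloop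
  push_cast at hloop
  rw [endCoord_eq_of_top_chip hP hΓ k hi hne (κ := κt k) ha0 ha1 (by linarith)]
  exact ⟨hv, hw, hbot, happly⟩

theorem Balanced.loop_apply {i : ℕ} (hi : i ≤ r) (k : Fin g)
    (h : σ k.castSucc - degOn (bridge k.castSucc) D = p k i) (h' : σ k.succ = p (k + 1) i) :
    D (Γ.vSuccPoint k.castSucc) = 0 ∧ D (Γ.wPoint k.succ) = 0 ∧ degOn (bot k) D = 0 ∧
      ∀ t h0 h1, D (Point.inner (top k) t h0 h1) =
        if endCoord Γ p P i k = t then (if p k i = P k then 0 else 1) else 0 := by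
  rw [hP.step k k.2 i hi] at h'
  by_cases hp : p k i = P k
  · rw [if_pos hp] at h'
    have := hP.le k k.2.le i hi
    obtain ⟨-, hv, hw, htop, hbot⟩ := hb.eq_special hP hΓ hD k (by omega) (by omega)
    refine ⟨hv, hw, hbot, fun t h0 h1 => ?_⟩
    rw [apply_eq_zero_of_degOn_eq_zero hD htop]
    simp [hp]
  · rw [if_neg hp] at h' ⊢
    exact hb.loop_chip hP hΓ hD k hi h (by omega) hp

theorem Balanced.eq_endDivisor {i : ℕ} (hi : i ≤ r) (h0 : D (Γ.wPoint 0) = i)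
    (hl : D (Γ.vSuccPoint (Fin.last g)) = (r : ℤ) - i) : D = endDivisor Γ r p P i := by
  have hge := hb.slope_ge hP hΓ hD hi hl.ge
  have hle := hb.slope_le hP hΓ hD hi h0.ge
  have hbr : ∀ k, degOn (bridge k) D = 0 := fun k => by
    have := hge k; have := hle k; have := degOn_nonneg hD (bridge k); omega
  have hσ : ∀ k, σ k = p k i := fun k => by
    have := hge k; have := hle k; have := hbr k; omega
  have hloop : ∀ k : Fin g, _ := fun k => hb.loop_apply hP hΓ hD hi k
    (by rw [hbr, sub_zero, hσ, Fin.val_castSucc]) (by rw [hσ, Fin.val_succ])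
  have hI := inside_endCoord hP hΓ hi
  ext q
  rcases q with (k | k) | ⟨k | k | k, t, g0, g1⟩
  · refine Fin.cases ?_ (fun k => ?_) k
    · exact h0.trans (endDivisor_w_zero hP hΓ hi).symm
    · exact (hloop k).2.1.trans (endDivisor_w_succ hP hΓ hi k).symm
  · refine Fin.lastCases ?_ (fun k => ?_) k
    · exact hl.trans (endDivisor_v_last hP hΓ hi).symm
    · exact (hloop k).1.trans (endDivisor_v_castSucc hP hΓ hi k).symm
  · rw [(hloop k).2.2.2, endDivisor, loopDivisor_top hI]
  · rw [apply_eq_zero_of_degOn_eq_zero hD (hloop k).2.2.1, endDivisor, loopDivisor_bot hI]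
    simp
  · rw [apply_eq_zero_of_degOn_eq_zero hD (hbr k), endDivisor, loopDivisor_bridge hI]

end uniqueness

section

variable (hP : SlopePath g r s p P) (hΓ : ShortBottoms Γ)

include hP hΓ

theorem isEndDivisor_endDivisor (i : Fin (r + 1)) :
    Γ.IsEndDivisor r (baseDivisor Γ r s P) i (endDivisor Γ r p P i) := by
  have hi : (i : ℕ) ≤ r := by omega
  exact ⟨endDivisor_nonneg hP hΓ hi, linEquiv_iff.2 ⟨_, _, _, balanced_endDivisor hP hΓ hi⟩,
    endDivisor_w_zero hP hΓ hi, endDivisor_v_last hP hΓ hi⟩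

theorem vertexAvoiding_baseDivisor : Γ.VertexAvoiding r (baseDivisor Γ r s P) := by
  intro i
  have hi : (i : ℕ) ≤ r := by omega
  refine ⟨_, isEndDivisor_endDivisor hP hΓ i, ?_, fun k => ⟨endDivisor_v_castSucc hP hΓ hi k,
    endDivisor_w_succ hP hΓ hi k⟩⟩
  rintro D ⟨h1, h2, h3, h4⟩
  obtain ⟨κt, κb, σ, hb⟩ := linEquiv_iff.1 h2
  exact hb.eq_endDivisor hP hΓ h1 hi h3 h4

theorem not_rankAtLeast_baseDivisor : ¬RankAtLeast (baseDivisor Γ r s P) (r + 1) := by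
  intro h
  obtain ⟨D', hD', hlin⟩ := h (Finsupp.single (Γ.wPoint 0) (r + 1))
    (Finsupp.single_nonneg.2 (by positivity)) (by rw [deg_single]; push_cast; rfl)
  obtain ⟨κt, κb, σ, hb⟩ := linEquiv_iff.1 hlin
  set D := D' + Finsupp.single (Γ.wPoint 0) ((r : ℤ) + 1) with hDdef
  have hD : 0 ≤ D := add_nonneg hD' (Finsupp.single_nonneg.2 (by positivity))
  have hb' : Balanced (D - baseDivisor Γ r s P) κt κb σ := by
    convert hb using 1
    rw [hDdef]; abel
  have h0 : (r : ℤ) + 1 ≤ D (Γ.wPoint 0) := by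
    rw [hDdef, Finsupp.add_apply, Finsupp.single_eq_same]
    have : 0 ≤ D' (Γ.wPoint 0) := hD' _
    omega
  have hl : 0 ≤ D (Γ.vSuccPoint (Fin.last g)) := hD _
  have h1 := hb'.slope_ge hP hΓ hD le_rfl (by omega) 0
  have h2 := degOn_nonneg hD (bridge 0)
  have h3 := hb'.start_eq
  rw [Fin.val_zero, hP.start r le_rfl] at h1
  omega

end

end ChainOfLoops

/-! ### The rank of the base divisor -/

/-- Riemann–Roch on a circle made of arcs of lengths `ℓ` and `m`: `κ` is the slope along the first
arc, `cv` and `cw` count chips at the common ends, `d` and `d'` chips inside the arcs. -/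
theorem exists_loop_chips {ℓ m : ℝ} (hℓ : 0 < ℓ) (hm : 0 < m) (R : ℝ) {n : ℤ} (hn : 1 ≤ n) :
    ∃ (κ cv cw d d' : ℤ) (a b : ℝ), 0 ≤ cv ∧ 0 ≤ cw ∧ 0 ≤ d ∧ 0 ≤ d' ∧ cv + cw + d + d' = n ∧
      (0 < a ∧ a < ℓ) ∧ (0 < b ∧ b < m) ∧
      κ * (ℓ + m) = R + d * (ℓ - a) - d' * (m - b) - cv * m := by
  have hL : 0 < ℓ + m := by linarith
  set S := R - (n - 1 : ℤ) * m with hS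
  push_cast at hS
  set κ := ⌈S / (ℓ + m)⌉ with hκ
  have hle : S ≤ κ * (ℓ + m) := (div_le_iff₀ hL).1 (Int.le_ceil _)
  have hlt : κ * (ℓ + m) < S + (ℓ + m) := by
    have := Int.ceil_lt_add_one (S / (ℓ + m))
    rw [← hκ, ← sub_lt_iff_lt_add, lt_div_iff₀ hL] at this
    linarith
  have ha : 0 < ℓ / 2 ∧ ℓ / 2 < ℓ := by constructor <;> linarith
  have hb : 0 < m / 2 ∧ m / 2 < m := by constructor <;> linarith
  rcases hle.eq_or_lt with hw | hgt
  · exact ⟨κ, n - 1, 1, 0, 0, ℓ / 2, m / 2, by omega, by simp, by simp, by simp, by omega, ha, hb,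
      by push_cast; linarith⟩
  rcases lt_trichotomy (κ * (ℓ + m)) (S + ℓ) with htop | hv | hbot
  · exact ⟨κ, n - 1, 0, 1, 0, S + ℓ - κ * (ℓ + m), m / 2, by omega, by simp, by simp, by simp,
      by omega, ⟨by linarith, by linarith⟩, hb, by push_cast; linarith⟩
  · exact ⟨κ - 1, n, 0, 0, 0, ℓ / 2, m / 2, by omega, by simp, by simp, by simp, by omega, ha, hb,
      by push_cast; linarith⟩
  · exact ⟨κ - 1, n - 1, 0, 0, 1, ℓ / 2, κ * (ℓ + m) - ℓ - S, by omega, by simp, by simp, by simp,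
      by omega, ha, ⟨by linarith, by linarith⟩, by push_cast; linarith⟩

namespace SlopePath

variable {g r s : ℕ} {p : ℕ → ℕ → ℤ} {P : ℕ → ℤ}

theorem add_le_of_add_le (hP : SlopePath g r s p P) {k : ℕ} (hk : k ≤ g) (i d : ℕ)
    (h : i + d ≤ r) : p k (i + d) + d ≤ p k i := by
  induction d with
  | zero => simp
  | succ d ih =>
    have := ih (by omega)
    have := hP.anti k hk (i + d) (i + (d + 1)) (by omega) h
    push_cast
    omega

theorem succ_add_le (hP : SlopePath g r s p P) {k : ℕ} (hk : k < g) (i b l : ℕ)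
    (h : i + b + l ≤ r) : p (k + 1) (i + b + l) + b + l ≤ p k i + 1 ∧
      (p (k + 1) (i + b + l) + b + l = p k i + 1 → p k i - b = P k ∧ l = 0) := by
  have := hP.add_le_of_add_le hk.le i b (by omega)
  have := hP.add_le_of_add_le hk.le (i + b) l h
  have := hP.add_le_of_add_le (k := k + 1) hk (i + b) l h
  have hstep := hP.step k hk (i + b) (by omega)
  have hstep' := hP.step k hk (i + b + l) h
  rcases Nat.eq_zero_or_pos l with rfl | hl
  · simp only [Nat.cast_zero, add_zero, and_true] at *
    split_ifs at hstep <;> constructor <;> omega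
  · by_cases hs : p k (i + b) = P k
    · have hne : p k (i + b + l) ≠ P k := by omega
      rw [if_neg hne] at hstep'
      constructor <;> omega
    · rw [if_neg hs] at hstep
      constructor <;> omega

end SlopePath

namespace ChainOfLoops

open MetricGraph

variable {g r s : ℕ} {Γ : ChainOfLoops g} {p : ℕ → ℕ → ℤ} {P : ℕ → ℤ}

/-- The number of chips of `F` on the loop `k + 1`, its two vertices included. -/
noncomputable def chipsOnLoop (F : Γ.graph.Divisor) (k : Fin g) : ℤ :=
  F (Γ.vSuccPoint k.castSucc) + degOn (top k) F + degOn (bot k) F + F (Γ.wPoint k.succ)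

/-- The number of chips of `F` to the left of the bridge `k`, the vertex `w_k` included. -/
noncomputable def chipsBefore (F : Γ.graph.Divisor) (k : Fin (g + 1)) : ℤ :=
  F (Γ.wPoint 0) + ∑ j : Fin g with j.castSucc < k, (degOn (bridge j.castSucc) F + chipsOnLoop F j)

section chips

variable {F : Γ.graph.Divisor}

theorem chipsBefore_zero : chipsBefore F 0 = F (Γ.wPoint 0) := by
  simp [chipsBefore]

theorem chipsBefore_succ (k : Fin g) : chipsBefore F k.succ =
    chipsBefore F k.castSucc + degOn (bridge k.castSucc) F + chipsOnLoop F k := by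
  have hfilter : Finset.univ.filter (fun j : Fin g => j.castSucc < k.succ) =
      insert k (Finset.univ.filter fun j : Fin g => j.castSucc < k.castSucc) := by
    ext j
    simp [Fin.castSucc_lt_succ_iff, le_iff_eq_or_lt]
  rw [chipsBefore, hfilter, Finset.sum_insert (by simp), chipsBefore]
  ring

theorem chipsBefore_last_add : chipsBefore F (Fin.last g) + degOn (bridge (Fin.last g)) F +
    F (Γ.vSuccPoint (Fin.last g)) = deg F := by
  rw [deg_eq_sum, Fintype.sum_sum_type, Fintype.sum_sum_type, Fintype.sum_sum_type,
    Fin.sum_univ_succ, Fin.sum_univ_castSucc (f := fun k => F (Point.vertex (Sum.inr k))),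
    Fin.sum_univ_castSucc (f := fun k => degOn (Sum.inr (Sum.inr k)) F)]
  simp only [chipsBefore, chipsOnLoop, Fin.castSucc_lt_last, Finset.filter_true,
    Finset.sum_add_distrib, wPoint, vSuccPoint]
  ring

variable (hF : 0 ≤ F)

include hF

theorem chipsOnLoop_nonneg (k : Fin g) : 0 ≤ chipsOnLoop F k :=
  add_nonneg (add_nonneg (add_nonneg (hF _) (degOn_nonneg hF _)) (degOn_nonneg hF _)) (hF _)

theorem chipsBefore_nonneg (k : Fin (g + 1)) : 0 ≤ chipsBefore F k :=
  add_nonneg (hF _) <| Finset.sum_nonneg fun j _ =>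
    add_nonneg (degOn_nonneg hF _) (chipsOnLoop_nonneg hF j)

theorem chipsBefore_add_le (k : Fin (g + 1)) :
    chipsBefore F k + degOn (bridge k) F ≤ deg F := by
  induction k using Fin.reverseInduction with
  | last =>
    have := chipsBefore_last_add (F := F)
    have : 0 ≤ F (Γ.vSuccPoint (Fin.last g)) := hF _
    omega
  | cast k ih =>
    have := chipsBefore_succ (F := F) k
    have := degOn_nonneg hF (bridge k.succ)
    have := chipsOnLoop_nonneg hF k
    omega

end chips

section effective

variable {F : Γ.graph.Divisor} {σ : Fin (g + 1) → ℤ}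

theorem balanced_loopDivisor_sub {c : Vertex g → ℤ} {a b : Fin g → ℝ} {d d' κ : Fin g → ℤ}
    (hI : Inside Γ a b) (hstart : c (Sum.inl 0) = r - σ 0 - F (Γ.wPoint 0))
    (hloop : ∀ k : Fin g, c (Sum.inr k.castSucc) + c (Sum.inl k.succ) + d k + d' k =
      σ k.castSucc - degOn (bridge k.castSucc) F - σ k.succ + 1 - chipsOnLoop F k)
    (hfinish : c (Sum.inr (Fin.last g)) =
      σ (Fin.last g) - degOn (bridge (Fin.last g)) F - s - F (Γ.vSuccPoint (Fin.last g)))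
    (hclose : ∀ k : Fin g, κ k * (Γ.topLen (k + 1) + Γ.botLen (k + 1)) =
      ((σ k.castSucc - degOn (bridge k.castSucc) F - c (Sum.inr k.castSucc) - P k -
          F (Γ.vSuccPoint k.castSucc) : ℤ) : ℝ) * Γ.botLen (k + 1) +
        d k * (Γ.topLen (k + 1) - a k) - d' k * (Γ.botLen (k + 1) - b k) +
        hinge (top k) (Γ.topLen (k + 1)) F - hinge (bot k) (Γ.botLen (k + 1)) F) :
    Balanced (loopDivisor Γ c a b d d' - (baseDivisor Γ r s P - F)) κ
      (fun k => σ k.castSucc - degOn (bridge k.castSucc) F - c (Sum.inr k.castSucc) - P k -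
        F (Γ.vSuccPoint k.castSucc) - κ k) σ := by
  have hvert : ∀ x, loopDivisor Γ c a b d d' (Point.vertex x) = c x := loopDivisor_vertex hI
  refine ⟨?_, fun k => ?_, fun k => ?_, ?_, fun k => ?_⟩
  · rw [Finsupp.sub_apply, Finsupp.sub_apply, baseDivisor_w_zero, wPoint, hvert, hstart, wPoint]
    ring
  · rw [Finsupp.sub_apply, Finsupp.sub_apply, baseDivisor_v_castSucc, vSuccPoint, hvert, map_sub,
      map_sub, degOn_baseDivisor, degOn_loopDivisor_bridge hI]
    ring
  · have := hloop k
    rw [chipsOnLoop] at this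
    rw [Finsupp.sub_apply, Finsupp.sub_apply, baseDivisor_w_succ, wPoint, hvert]
    simp only [map_sub, degOn_baseDivisor, degOn_loopDivisor_top hI, degOn_loopDivisor_bot hI]
    rw [wPoint] at this
    omega
  · rw [Finsupp.sub_apply, Finsupp.sub_apply, baseDivisor_v_last, vSuccPoint, hvert, hfinish,
      map_sub, map_sub, degOn_baseDivisor, degOn_loopDivisor_bridge hI, vSuccPoint]
    ring
  · have := hclose k
    have := (hI k).1.2
    have := (hI k).2.2
    rw [len_top] at *
    rw [len_bot] at *
    simp only [map_sub, hinge_baseDivisor, hinge_loopDivisor_top hI, hinge_loopDivisor_bot hI]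
    rw [max_eq_right (by linarith), max_eq_right (by linarith)]
    push_cast at *
    linarith

variable (hF : 0 ≤ F)

include hF

theorem exists_loop_closing (k : Fin g) {e q : ℤ} (he : 0 ≤ e)
    (h : e = 0 → q = P k ∧ chipsOnLoop F k = 0) :
    ∃ (κ cv cw d d' : ℤ) (a b : ℝ), 0 ≤ cv ∧ 0 ≤ cw ∧ 0 ≤ d ∧ 0 ≤ d' ∧
      cv + cw + d + d' = e ∧ (0 < a ∧ a < Γ.topLen (k + 1)) ∧ (0 < b ∧ b < Γ.botLen (k + 1)) ∧
      κ * (Γ.topLen (k + 1) + Γ.botLen (k + 1)) =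
        ((q - cv - P k - F (Γ.vSuccPoint k.castSucc) : ℤ) : ℝ) * Γ.botLen (k + 1) +
          d * (Γ.topLen (k + 1) - a) - d' * (Γ.botLen (k + 1) - b) +
        hinge (top k) (Γ.topLen (k + 1)) F - hinge (bot k) (Γ.botLen (k + 1)) F := by
  have hm := Γ.bot_pos k
  have hℓ := Γ.top_pos k
  rcases he.eq_or_lt with rfl | hpos
  · obtain ⟨rfl, hchips⟩ := h rfl
    rw [chipsOnLoop] at hchips
    have hv : 0 ≤ F (Γ.vSuccPoint k.castSucc) := hF _
    have hw : 0 ≤ F (Γ.wPoint k.succ) := hF _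
    have htop := degOn_nonneg hF (top k)
    have hbot := degOn_nonneg hF (bot k)
    refine ⟨0, 0, 0, 0, 0, Γ.topLen (k + 1) / 2, Γ.botLen (k + 1) / 2, le_rfl, le_rfl, le_rfl,
      le_rfl, rfl, by constructor <;> linarith, by constructor <;> linarith, ?_⟩
    rw [hinge_eq_zero_of_degOn_eq_zero hF (e := top k) (by omega),
      hinge_eq_zero_of_degOn_eq_zero hF (e := bot k) (by omega),
      (by omega : F (Γ.vSuccPoint k.castSucc) = 0)]
    simp
  · obtain ⟨κ, cv, cw, d, d', a, b, hcv, hcw, hd, hd', hsum, ha, hb, hκ⟩ := exists_loop_chips hℓ hm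
      (((q - P k - F (Γ.vSuccPoint k.castSucc) : ℤ) : ℝ) * Γ.botLen (k + 1) +
        hinge (top k) (Γ.topLen (k + 1)) F - hinge (bot k) (Γ.botLen (k + 1)) F) hpos
    refine ⟨κ, cv, cw, d, d', a, b, hcv, hcw, hd, hd', hsum, ha, hb, ?_⟩
    rw [hκ]
    push_cast
    ring

theorem exists_effective_of_slopes (hstart : σ 0 + F (Γ.wPoint 0) ≤ r)
    (hloop : ∀ k : Fin g,
      σ k.succ + degOn (bridge k.castSucc) F + chipsOnLoop F k ≤ σ k.castSucc + 1)
    (hspecial : ∀ k : Fin g,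
      σ k.succ + degOn (bridge k.castSucc) F + chipsOnLoop F k = σ k.castSucc + 1 →
        σ k.castSucc - degOn (bridge k.castSucc) F = P k ∧ chipsOnLoop F k = 0)
    (hfinish : s + F (Γ.vSuccPoint (Fin.last g)) + degOn (bridge (Fin.last g)) F ≤
      σ (Fin.last g)) :
    ∃ D', 0 ≤ D' ∧ LinEquiv (baseDivisor Γ r s P - F) D' := by
  have hclosing : ∀ k : Fin g, _ := fun k => exists_loop_closing (P := P) hF k
    (e := σ k.castSucc - degOn (bridge k.castSucc) F - σ k.succ + 1 - chipsOnLoop F k)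
    (q := σ k.castSucc - degOn (bridge k.castSucc) F)
    (by have := hloop k; omega) fun h => hspecial k (by omega)
  choose κ cv cw d d' a b hcv hcw hd hd' hsum ha hb hκ using hclosing
  have hI : Inside Γ a b := fun k => ⟨ha k, hb k⟩
  set c : Vertex g → ℤ := Sum.elim (Fin.cases (r - σ 0 - F (Γ.wPoint 0)) cw)
    (Fin.lastCases (σ (Fin.last g) - degOn (bridge (Fin.last g)) F - s -
      F (Γ.vSuccPoint (Fin.last g))) cv) with hc
  have hcv_eq : ∀ k : Fin g, c (Sum.inr k.castSucc) = cv k := fun k => by simp [hc]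
  have hc_last : c (Sum.inr (Fin.last g)) = σ (Fin.last g) - degOn (bridge (Fin.last g)) F - s -
      F (Γ.vSuccPoint (Fin.last g)) := by simp [hc]
  refine ⟨loopDivisor Γ c a b d d', loopDivisor_nonneg hI ?_ hd hd', linEquiv_iff.2 ⟨_, _, _,
    balanced_loopDivisor_sub hI rfl (fun k => ?_) hc_last (κ := κ) fun k => ?_⟩⟩
  · rintro (k | k)
    · refine Fin.cases ?_ (fun k => hcw k) k
      change 0 ≤ (r : ℤ) - σ 0 - F (Γ.wPoint 0)
      omega
    · refine Fin.lastCases ?_ (fun k => ?_) k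
      · rw [hc_last]; omega
      · rw [hcv_eq]; exact hcv k
  · rw [hcv_eq]; exact hsum k
  · rw [hcv_eq]; exact hκ k

end effective

/-- To the right of `n` chips one takes the slope `p k n`: every chip passed costs one slope, which
the strict monotonicity of `p k` provides. -/
theorem rankAtLeast_baseDivisor (hP : SlopePath g r s p P) :
    RankAtLeast (baseDivisor Γ r s P) r := by
  intro F hF hdeg
  obtain ⟨n, hn⟩ : ∃ n : Fin (g + 1) → ℕ, ∀ k, (n k : ℤ) = chipsBefore F k :=
    ⟨fun k => (chipsBefore F k).toNat, fun k => Int.toNat_of_nonneg (chipsBefore_nonneg hF k)⟩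
  have hle : ∀ k, n k + degOn (bridge k) F ≤ r := fun k => by
    rw [hn, ← hdeg]; exact chipsBefore_add_le hF k
  have hbridge : ∀ k, 0 ≤ degOn (bridge k) F := fun k => degOn_nonneg hF _
  have hstep : ∀ k : Fin g,
      p (k + 1) (n k.succ) + degOn (bridge k.castSucc) F + chipsOnLoop F k ≤
          p k (n k.castSucc) + 1 ∧
        (p (k + 1) (n k.succ) + degOn (bridge k.castSucc) F + chipsOnLoop F k =
            p k (n k.castSucc) + 1 →
          p k (n k.castSucc) - degOn (bridge k.castSucc) F = P k ∧ chipsOnLoop F k = 0) := by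
    intro k
    obtain ⟨b, hb⟩ := Int.eq_ofNat_of_zero_le (hbridge k.castSucc)
    obtain ⟨l, hl⟩ := Int.eq_ofNat_of_zero_le (chipsOnLoop_nonneg hF k)
    have hsucc := chipsBefore_succ (F := F) k
    rw [← hn, ← hn, hb, hl] at hsucc
    have hn_succ : n k.succ = n k.castSucc + b + l := by exact_mod_cast hsucc
    have := hle k.succ
    have := hbridge k.succ
    rw [hb, hl, hn_succ, Nat.cast_eq_zero]
    exact hP.succ_add_le k.2 (n k.castSucc) b l (by omega)
  refine exists_effective_of_slopes (σ := fun k => p k (n k)) hF ?_ (fun k => (hstep k).1)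
    (fun k => (hstep k).2) ?_
  · have := hle 0
    have := hbridge 0
    rw [Fin.val_zero, hP.start _ (by omega), ← chipsBefore_zero, ← hn]
    omega
  · have := hle (Fin.last g)
    have := hbridge (Fin.last g)
    have hlast := chipsBefore_last_add (F := F)
    rw [← hn, hdeg] at hlast
    rw [Fin.val_last, hP.finish _ (by omega)]
    omega

theorem hasRank_baseDivisor (hP : SlopePath g r s p P) (hΓ : ShortBottoms Γ) :
    HasRank (baseDivisor Γ r s P) r :=
  ⟨rankAtLeast_baseDivisor hP, not_rankAtLeast_baseDivisor hP hΓ⟩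

end ChainOfLoops

/-! ### Localization of minima to a block -/

section MinTwice

variable {ι : Type*} {A : Finset ι} {f : ι → ℝ}

/-- The minimum of `f` on `A` is attained at least twice. -/
def MinTwice (A : Finset ι) (f : ι → ℝ) : Prop :=
  ∃ i ∈ A, ∃ j ∈ A, i ≠ j ∧ f i = f j ∧ ∀ k ∈ A, f i ≤ f k

/-- The minimum of `f` on `A` is attained at `i`. -/
def AttainsMin (A : Finset ι) (f : ι → ℝ) (i : ι) : Prop := i ∈ A ∧ ∀ k ∈ A, f i ≤ f k

theorem MinTwice.exists_attainsMin (h : MinTwice A f) :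
    ∃ i j, i ≠ j ∧ AttainsMin A f i ∧ AttainsMin A f j := by
  obtain ⟨i, hi, j, hj, hne, he, hk⟩ := h
  exact ⟨i, j, hne, ⟨hi, hk⟩, ⟨hj, fun k hk' => he ▸ hk k hk'⟩⟩

theorem minTwice_of_attainsMin {i j : ι} (hne : i ≠ j) (hi : AttainsMin A f i)
    (hj : AttainsMin A f j) : MinTwice A f :=
  ⟨i, hi.1, j, hj.1, hne, le_antisymm (hi.2 j hj.1) (hj.2 i hi.1), hi.2⟩

theorem MinTwice.of_eq_add_const {f' : ι → ℝ} (h : MinTwice A f) (c : ℝ)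
    (hc : ∀ i ∈ A, f i = f' i + c) : MinTwice A f' := by
  obtain ⟨i, hi, j, hj, hne, heq, hle⟩ := h
  refine ⟨i, hi, j, hj, hne, by linarith [hc i hi, hc j hj], fun k hk => ?_⟩
  linarith [hc i hi, hc k hk, hle k hk]

theorem MinTwice.congr {f' : ι → ℝ} (h : MinTwice A f) (hf : ∀ i ∈ A, f i = f' i) :
    MinTwice A f' :=
  h.of_eq_add_const 0 fun i hi => by rw [hf i hi, add_zero]

theorem exists_common_slope (w : ι → ℝ) (S : ι → ℤ) {a b : ℝ} (hab : a < b) (hA : A.Nonempty) :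
    ∃ x, a < x ∧ x < b ∧ ∃ σ : ℤ, ∀ i, AttainsMin A (fun i => w i + S i * x) i → S i = σ := by
  classical
  have hfin : (⋃ i ∈ A, ⋃ j ∈ A,
      {x : ℝ | S i ≠ S j ∧ w i + S i * x = w j + S j * x}).Finite := by
    refine A.finite_toSet.biUnion fun i _ => A.finite_toSet.biUnion fun j _ => ?_
    refine Set.Subsingleton.finite ?_
    rintro x ⟨hne, hx⟩ y ⟨-, hy⟩
    have : ((S i : ℝ) - S j) * (x - y) = 0 := by linarith
    exact sub_eq_zero.1 ((mul_eq_zero.1 this).resolve_left (sub_ne_zero.2 (by exact_mod_cast hne)))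
  obtain ⟨x, hx, hxb⟩ := (Set.Ioo_infinite hab).exists_notMem_finite hfin
  obtain ⟨i, hi, hmin⟩ := A.exists_min_image (fun i => w i + S i * x) hA
  refine ⟨x, hx.1, hx.2, S i, fun j hj => ?_⟩
  by_contra hne
  refine hxb (Set.mem_biUnion hj.1 (Set.mem_biUnion hi ⟨hne, ?_⟩))
  exact le_antisymm (hj.2 i hi) (hmin j hj.1)

end MinTwice

/-- Functions on a chain of loops that are affine on the bridges: `S k I` is the slope of the
function `I` on the bridge `k` of length `n k`, `w k I` its value at the start of that bridge, and
`m (k + 1) * U k I`, `m (k + 1) * H k I` are its changes from the start of the loop `k + 1` to its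
end and to the middle of its top edge.  At all these points the minimum occurs twice. -/
structure DependentChain {ι : Type*} (A : Finset ι) (g : ℕ) (n m : ℕ → ℝ) (S U H : ℕ → ι → ℤ)
    (w : ℕ → ι → ℝ) (Λ : ℝ) : Prop where
  step : ∀ k < g, ∀ I ∈ A, w (k + 1) I = w k I + S k I * n k + m (k + 1) * U k I
  bridge : ∀ k ≤ g, ∀ x, 0 ≤ x → x ≤ n k → MinTwice A fun I => w k I + S k I * x
  loop : ∀ k < g, MinTwice A fun I => w k I + S k I * n k + m (k + 1) * H k I
  boundS : ∀ k ≤ g, ∀ I ∈ A, |(S k I : ℝ)| ≤ Λ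
  boundU : ∀ k < g, ∀ I ∈ A, |(U k I : ℝ)| ≤ Λ
  boundH : ∀ k < g, ∀ I ∈ A, |(H k I : ℝ)| ≤ Λ

/-- The part of admissibility used to localize minima: each bridge is much longer than the loops
next to it. The bridge `k` joins the loop `k` to the loop `k + 1`. -/
structure LongBridges (g : ℕ) (n m ℓ : ℕ → ℝ) (Λ : ℝ) : Prop where
  bridge_pos : ∀ k ≤ g, 0 < n k
  bot_pos : ∀ k < g, 0 < m (k + 1)
  bot_lt_top : ∀ k < g, m (k + 1) < ℓ (k + 1)
  top_le_left : ∀ k < g, 100 * (Λ + 1) ^ 2 * ℓ (k + 1) ≤ n k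
  top_le_right : ∀ k < g, 100 * (Λ + 1) ^ 2 * ℓ (k + 1) ≤ n (k + 1)

/-- The total length of the top edges of the first `t` loops after the bridge `a` and of the bridges
between these loops. -/
def blockLen (n ℓ : ℕ → ℝ) (a t : ℕ) : ℝ :=
  ∑ i ∈ Finset.range t, ℓ (a + 1 + i) + ∑ i ∈ Finset.range (t - 1), n (a + 1 + i)

theorem blockLen_one (n ℓ : ℕ → ℝ) (a : ℕ) : blockLen n ℓ a 1 = ℓ (a + 1) := by
  simp [blockLen]

theorem blockLen_add_two (n ℓ : ℕ → ℝ) (a t : ℕ) :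
    blockLen n ℓ a (t + 2) = blockLen n ℓ a (t + 1) + n (a + (t + 1)) + ℓ (a + (t + 1) + 1) := by
  simp only [blockLen, show t + 2 - 1 = t + 1 by omega, Nat.add_sub_cancel]
  rw [Finset.sum_range_succ (n := t + 1), Finset.sum_range_succ (n := t) (f := fun i => n _),
    show a + 1 + t = a + (t + 1) by ring, show a + 1 + (t + 1) = a + (t + 1) + 1 by ring]
  ring

theorem abs_mul_sub_mul_le {a b x Λ : ℝ} (ha : |a| ≤ Λ) (hb : |b| ≤ Λ) (hx : 0 ≤ x) :
    |x * a - x * b| ≤ 2 * Λ * x := by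
  rw [← mul_sub, abs_mul, abs_of_nonneg hx]
  have := abs_sub a b
  nlinarith [abs_nonneg (a - b)]

namespace LongBridges

variable {g : ℕ} {n m ℓ : ℕ → ℝ} {Λ : ℝ} {a s t : ℕ}

theorem top_pos (hb : LongBridges g n m ℓ Λ) {k : ℕ} (hk : k < g) : 0 < ℓ (k + 1) :=
  (hb.bot_pos k hk).trans (hb.bot_lt_top k hk)

theorem blockLen_le_blockLen (hb : LongBridges g n m ℓ Λ) (has : a + s ≤ g) (hts : t ≤ s) :
    blockLen n ℓ a t ≤ blockLen n ℓ a s := by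
  refine add_le_add
    (Finset.sum_le_sum_of_subset_of_nonneg (Finset.range_mono hts) fun i hi _ => ?_)
    (Finset.sum_le_sum_of_subset_of_nonneg (Finset.range_mono (by omega)) fun i hi _ => ?_)
  · rw [Finset.mem_range] at hi
    rw [add_right_comm]
    exact (hb.top_pos (by omega)).le
  · rw [Finset.mem_range] at hi
    exact (hb.bridge_pos _ (by omega)).le

theorem blockLen_nonneg (hb : LongBridges g n m ℓ Λ) (has : a + s ≤ g) : 0 ≤ blockLen n ℓ a s := by
  simpa [blockLen] using hb.blockLen_le_blockLen has s.zero_le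

theorem bridge_le_blockLen (hb : LongBridges g n m ℓ Λ) (has : a + s ≤ g) (ht : 1 ≤ t)
    (hts : t < s) : n (a + t) ≤ blockLen n ℓ a s := by
  obtain ⟨t, rfl⟩ := Nat.exists_eq_add_of_le' ht
  have := hb.blockLen_le_blockLen has (show t + 2 ≤ s by omega)
  have := hb.blockLen_nonneg (show a + (t + 1) ≤ g by omega)
  have := hb.top_pos (show a + (t + 1) < g by omega)
  linarith [blockLen_add_two n ℓ a t]

theorem top_le_blockLen (hb : LongBridges g n m ℓ Λ) (has : a + s ≤ g) (hts : t < s) :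
    ℓ (a + t + 1) ≤ blockLen n ℓ a s := by
  refine le_trans ?_ (hb.blockLen_le_blockLen has hts)
  cases t with
  | zero => exact (blockLen_one n ℓ a).ge
  | succ t =>
    have := hb.blockLen_nonneg (show a + (t + 1) ≤ g by omega)
    have := hb.bridge_pos (a + (t + 1)) (by omega)
    linarith [blockLen_add_two n ℓ a t]

theorem bot_le_blockLen (hb : LongBridges g n m ℓ Λ) (has : a + s ≤ g) (hts : t < s) :
    m (a + t + 1) ≤ blockLen n ℓ a s :=
  (hb.bot_lt_top _ (by omega)).le.trans (hb.top_le_blockLen has hts)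

theorem blockLen_pos (hb : LongBridges g n m ℓ Λ) (has : a + s ≤ g) (hs : 1 ≤ s) :
    0 < blockLen n ℓ a s :=
  (hb.top_pos (by omega)).trans_le (hb.top_le_blockLen has hs)

theorem three_mul_bot_le (hb : LongBridges g n m ℓ Λ) (hΛ : 0 ≤ Λ) {k : ℕ} (hk : k < g) :
    3 * ((4 * Λ + 1) * m (k + 1)) ≤ n k ∧ 3 * ((4 * Λ + 1) * m (k + 1)) ≤ n (k + 1) := by
  have hm := hb.bot_pos k hk
  have hle : 3 * (4 * Λ + 1) * m (k + 1) ≤ 100 * (Λ + 1) ^ 2 * ℓ (k + 1) := by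
    have := (hb.bot_lt_top k hk).le
    have : 3 * (4 * Λ + 1) ≤ 100 * (Λ + 1) ^ 2 := by nlinarith
    gcongr
  rw [← mul_assoc]
  exact ⟨hle.trans (hb.top_le_left k hk), hle.trans (hb.top_le_right k hk)⟩

theorem exists_interval (hb : LongBridges g n m ℓ Λ) (hΛ : 0 ≤ Λ) (has : a + s ≤ g) (hs : 1 ≤ s)
    (ha : 100 * (Λ + 1) ^ 2 * blockLen n ℓ a s ≤ n a)
    (hz : 100 * (Λ + 1) ^ 2 * blockLen n ℓ a s ≤ n (a + s)) (hts : t ≤ s) :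
    ∃ lo hi, lo < hi ∧ 0 ≤ lo ∧ hi ≤ n (a + t) ∧
      (t < s → (4 * Λ + 1) * m (a + t + 1) ≤ n (a + t) - hi) ∧
      (1 ≤ t → (4 * Λ + 1) * m (a + t) ≤ lo) ∧
      (t = 0 → n a - lo ≤ 2 * ((4 * Λ + 1) * blockLen n ℓ a s)) ∧
      (1 ≤ t → hi ≤ 2 * ((4 * Λ + 1) * blockLen n ℓ a s)) := by
  have hQ := hb.blockLen_pos has hs
  set Q := blockLen n ℓ a s
  have hX : 0 < (4 * Λ + 1) * Q := by positivity
  have hXQ : 2 * ((4 * Λ + 1) * Q) ≤ 100 * (Λ + 1) ^ 2 * Q := by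
    rw [← mul_assoc]
    exact mul_le_mul_of_nonneg_right (by nlinarith) hQ.le
  have hbot : ∀ u < s, (4 * Λ + 1) * m (a + u + 1) ≤ (4 * Λ + 1) * Q := fun u hu => by
    have := hb.bot_le_blockLen has hu
    gcongr
  rcases Nat.eq_zero_or_pos t with rfl | ht
  · have hfirst := hbot 0 hs
    simp only [add_zero] at hfirst ⊢
    exact ⟨n a - 2 * ((4 * Λ + 1) * Q), n a - (4 * Λ + 1) * Q, by linarith, by linarith,
      by linarith, fun _ => by linarith, by omega, fun _ => by linarith, by omega⟩
  obtain ⟨u, rfl⟩ := Nat.exists_eq_add_of_le' ht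
  rcases hts.eq_or_lt with rfl | hts
  · exact ⟨(4 * Λ + 1) * Q, 2 * ((4 * Λ + 1) * Q), by linarith, hX.le, by linarith, by omega,
      fun _ => hbot u (by omega), by omega, fun _ => le_rfl⟩
  · have hn := hb.bridge_pos (a + (u + 1)) (by omega)
    have hnQ := hb.bridge_le_blockLen has ht hts
    have hnext := (hb.three_mul_bot_le hΛ (show a + (u + 1) < g by omega)).1
    have hprev := (hb.three_mul_bot_le hΛ (show a + u < g by omega)).2
    rw [add_assoc a u] at hprev
    have : Q ≤ 2 * ((4 * Λ + 1) * Q) := by nlinarith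
    exact ⟨n (a + (u + 1)) / 3, 2 * n (a + (u + 1)) / 3, by linarith, by linarith, by linarith,
      fun _ => by linarith, fun _ => by linarith, by omega, fun _ => by linarith⟩

end LongBridges

namespace DependentChain

variable {ι : Type*} {A : Finset ι} {g : ℕ} {n m ℓ : ℕ → ℝ} {S U H : ℕ → ι → ℤ} {w : ℕ → ι → ℝ}
  {Λ : ℝ} {κ : ι → ℕ} {a k r s t α : ℕ} {x : ℝ} {I J : ι}

theorem exists_mem (h : DependentChain A g n m S U H w Λ) (h0 : 0 ≤ n 0) : ∃ I, I ∈ A := by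
  obtain ⟨i, -, -, hi, -⟩ := (h.bridge 0 g.zero_le 0 le_rfl h0).exists_attainsMin
  exact ⟨i, hi.1⟩

theorem nonneg (h : DependentChain A g n m S U H w Λ) (hI : I ∈ A) : 0 ≤ Λ :=
  (abs_nonneg _).trans (h.boundS 0 g.zero_le I hI)

theorem abs_slope_sub_le (h : DependentChain A g n m S U H w Λ) (hk : k ≤ g) (hI : I ∈ A)
    (hJ : J ∈ A) (hx : 0 ≤ x) : |x * S k I - x * S k J| ≤ 2 * Λ * x :=
  abs_mul_sub_mul_le (h.boundS k hk I hI) (h.boundS k hk J hJ) hx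

theorem abs_loop_sub_le (h : DependentChain A g n m S U H w Λ) (hk : k < g) (hI : I ∈ A)
    (hJ : J ∈ A) (hx : 0 ≤ x) : |x * U k I - x * U k J| ≤ 2 * Λ * x :=
  abs_mul_sub_mul_le (h.boundU k hk I hI) (h.boundU k hk J hJ) hx

theorem abs_half_sub_le (h : DependentChain A g n m S U H w Λ) (hk : k < g) (hI : I ∈ A)
    (hJ : J ∈ A) (hx : 0 ≤ x) : |x * H k I - x * H k J| ≤ 2 * Λ * x :=
  abs_mul_sub_mul_le (h.boundH k hk I hI) (h.boundH k hk J hJ) hx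

theorem slope_le_of_attainsMin_loop (h : DependentChain A g n m S U H w Λ) (hk : k < g)
    (hm : 0 < m (k + 1)) (hx : (4 * Λ + 1) * m (k + 1) ≤ n k - x)
    (hI : AttainsMin A (fun I => w k I + S k I * n k + m (k + 1) * H k I) I)
    (hJ : AttainsMin A (fun I => w k I + S k I * x) J) : S k I ≤ S k J := by
  by_contra! hlt
  have hlt : (S k J : ℝ) + 1 ≤ S k I := by exact_mod_cast hlt
  have hIJ := hI.2 J hJ.1
  have hJI := hJ.2 I hI.1
  have hH := (abs_le.1 (h.abs_half_sub_le hk hI.1 hJ.1 hm.le)).1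
  have hΛm : 0 ≤ Λ * m (k + 1) := mul_nonneg (h.nonneg hI.1) hm.le
  have : n k - x ≤ (S k I - S k J) * (n k - x) := by nlinarith
  nlinarith

theorem le_slope_of_attainsMin_loop (h : DependentChain A g n m S U H w Λ) (hk : k < g)
    (hm : 0 < m (k + 1)) (hx : (4 * Λ + 1) * m (k + 1) ≤ x)
    (hI : AttainsMin A (fun I => w k I + S k I * n k + m (k + 1) * H k I) I)
    (hJ : AttainsMin A (fun I => w (k + 1) I + S (k + 1) I * x) J) :
    S (k + 1) J ≤ S (k + 1) I := by
  by_contra! hlt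
  have hlt : (S (k + 1) I : ℝ) + 1 ≤ S (k + 1) J := by exact_mod_cast hlt
  have hIJ := hI.2 J hJ.1
  have hJI := hJ.2 I hI.1
  simp only [h.step k hk I hI.1, h.step k hk J hJ.1] at hJI
  have hH := (abs_le.1 (h.abs_half_sub_le hk hI.1 hJ.1 hm.le)).1
  have hU := (abs_le.1 (h.abs_loop_sub_le hk hI.1 hJ.1 hm.le)).2
  have hΛm : 0 ≤ Λ * m (k + 1) := mul_nonneg (h.nonneg hI.1) hm.le
  have : x ≤ (S (k + 1) J - S (k + 1) I) * x := by nlinarith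
  nlinarith

theorem abs_sub_bridgeEnd_le (h : DependentChain A g n m S U H w Λ)
    (hb : LongBridges g n m ℓ Λ) (hI : I ∈ A) (hJ : J ∈ A) (ht : 1 ≤ t) (hat : a + t ≤ g) :
    |(w (a + t) I - w (a + t) J) - ((w a I + S a I * n a) - (w a J + S a J * n a))| ≤
      2 * Λ * blockLen n ℓ a t := by
  have hΛ := h.nonneg hI
  induction t, ht using Nat.le_induction with
  | base =>
    have hm := hb.bot_pos a (by omega)
    have hU := h.abs_loop_sub_le (show a < g by omega) hI hJ hm.le
    have := (hb.bot_lt_top a (by omega)).le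
    rw [h.step a (by omega) I hI, h.step a (by omega) J hJ, blockLen_one]
    refine le_trans (le_of_eq ?_) (hU.trans (by gcongr))
    congr 1; ring
  | succ t ht ih =>
    obtain ⟨t, rfl⟩ := Nat.exists_eq_add_of_le' ht
    have hm := hb.bot_pos (a + (t + 1)) (by omega)
    have hU := h.abs_loop_sub_le (show a + (t + 1) < g by omega) hI hJ hm.le
    have hS := h.abs_slope_sub_le (show a + (t + 1) ≤ g by omega) hI hJ
      (hb.bridge_pos (a + (t + 1)) (by omega)).le
    have ih := ih (by omega)
    rw [blockLen_add_two, ← add_assoc a, h.step _ (by omega) I hI, h.step _ (by omega) J hJ]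
    rw [abs_le] at ih hU hS ⊢
    have : 2 * Λ * m (a + (t + 1) + 1) ≤ 2 * Λ * ℓ (a + (t + 1) + 1) := by
      have := (hb.bot_lt_top (a + (t + 1)) (by omega)).le
      gcongr
    constructor <;> nlinarith

theorem abs_sub_bridgeEnd_le_of_le (h : DependentChain A g n m S U H w Λ)
    (hb : LongBridges g n m ℓ Λ) (hI : I ∈ A) (hJ : J ∈ A) (ht : 1 ≤ t) (hts : t ≤ s)
    (has : a + s ≤ g) :
    |(w (a + t) I - w (a + t) J) - ((w a I + S a I * n a) - (w a J + S a J * n a))| ≤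
      2 * Λ * blockLen n ℓ a s := by
  refine (h.abs_sub_bridgeEnd_le hb hI hJ ht (by omega)).trans ?_
  have := hb.blockLen_le_blockLen has hts
  have := h.nonneg hI
  gcongr

theorem exists_block_minimizers (h : DependentChain A g n m S U H w Λ)
    (hn : ∀ k ≤ g, 0 < n k) (hg : (r + 1) * s ≤ g) (hκ : ∀ I ∈ A, κ I ≤ r) :
    ∃ α ≤ r,
      (∃ L, AttainsMin A (fun I => w (α * s) I + S (α * s) I * (n (α * s) / 2)) L ∧ α ≤ κ L) ∧
      ∃ R, AttainsMin A
        (fun I => w ((α + 1) * s) I + S ((α + 1) * s) I * (n ((α + 1) * s) / 2)) R ∧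
        κ R ≤ α := by
  classical
  have hmid : ∀ β ≤ r + 1, ∃ I, AttainsMin A
      (fun I => w (β * s) I + S (β * s) I * (n (β * s) / 2)) I := by
    intro β hβ
    have hβs : β * s ≤ g := (Nat.mul_le_mul_right s hβ).trans hg
    have := hn _ hβs
    obtain ⟨I, -, -, hI, -⟩ := (h.bridge _ hβs (n (β * s) / 2) (by linarith)
      (by linarith)).exists_attainsMin
    exact ⟨I, hI⟩
  -- The block sought is the first one at whose end some minimizer has class at most its index.
  have hex : ∃ β, β ≤ r ∧ ∃ R, AttainsMin A
      (fun I => w ((β + 1) * s) I + S ((β + 1) * s) I * (n ((β + 1) * s) / 2)) R ∧ κ R ≤ β := by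
    obtain ⟨I, hI⟩ := hmid (r + 1) le_rfl
    exact ⟨r, le_rfl, I, hI, hκ I hI.1⟩
  obtain ⟨hle, hR⟩ := Nat.find_spec hex
  obtain ⟨L, hL⟩ := hmid (Nat.find hex) (by omega)
  refine ⟨Nat.find hex, hle, ⟨L, hL, ?_⟩, hR⟩
  by_contra! hlt
  have hpred : Nat.find hex - 1 + 1 = Nat.find hex := by omega
  refine Nat.find_min hex (m := Nat.find hex - 1) (by omega) ⟨by omega, L, ?_, by omega⟩
  rwa [hpred]

theorem exists_isolated_block (h : DependentChain A g n m S U H w Λ)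
    (hb : LongBridges g n m ℓ Λ) (hs : 1 ≤ s) (hg : (r + 1) * s ≤ g)
    (hblock : ∀ α ≤ r, 100 * (Λ + 1) ^ 2 * blockLen n ℓ (α * s) s ≤
      min (n (α * s)) (n ((α + 1) * s)))
    (hκ : ∀ I ∈ A, κ I ≤ r)
    (hsep : ∀ α, 1 ≤ α → α ≤ r → ∀ I ∈ A, ∀ J ∈ A, κ I < α → α ≤ κ J →
      S (α * s) J + 1 ≤ S (α * s) I) :
    ∃ α ≤ r, ∀ I ∈ A, κ I ≠ α → ∃ J ∈ A,
      w (α * s) J + S (α * s) J * n (α * s) + 40 * ((Λ + 1) ^ 2 * blockLen n ℓ (α * s) s) ≤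
        w (α * s) I + S (α * s) I * n (α * s) := by
  obtain ⟨α, hα, ⟨L, hL, hLκ⟩, R, hR, hRκ⟩ := h.exists_block_minimizers hb.bridge_pos hg hκ
  have hsg : (α + 1) * s ≤ g := (Nat.mul_le_mul_right s (by omega)).trans hg
  have hend : (α + 1) * s = α * s + s := by ring
  obtain ⟨hna, hnz⟩ := le_min_iff.1 (hblock α hα)
  have hΛ := h.nonneg hL.1
  have hQ := hb.blockLen_nonneg (hend ▸ hsg)
  refine ⟨α, hα, fun I hI hne => ?_⟩
  rcases hne.lt_or_gt with hlt | hgt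
  · refine ⟨L, hL.1, ?_⟩
    have hslope : (S (α * s) L : ℝ) + 1 ≤ S (α * s) I := by
      exact_mod_cast hsep α (by omega) hα I hI L hL.1 hlt hLκ
    have hLI := hL.2 I hI
    have hn := hb.bridge_pos (α * s) (by omega)
    have : 0 ≤ (Λ + 1) ^ 2 * blockLen n ℓ (α * s) s := by positivity
    nlinarith
  · refine ⟨R, hR.1, ?_⟩
    have hαr : α + 1 ≤ r := hgt.trans_le (hκ I hI)
    have hslope : (S ((α + 1) * s) I : ℝ) + 1 ≤ S ((α + 1) * s) R := by
      exact_mod_cast hsep (α + 1) (by omega) hαr R hR.1 I hI (by omega) hgt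
    have hRI := hR.2 I hI
    have hn := hb.bridge_pos _ hsg
    have hdrift := (abs_le.1 (h.abs_sub_bridgeEnd_le hb hI hR.1 hs (hend ▸ hsg))).2
    rw [← hend] at hdrift
    have hgap : n ((α + 1) * s) / 2 ≤ w ((α + 1) * s) I - w ((α + 1) * s) R := by nlinarith
    have : 2 * Λ * blockLen n ℓ (α * s) s ≤ 10 * (Λ + 1) ^ 2 * blockLen n ℓ (α * s) s :=
      mul_le_mul_of_nonneg_right (by nlinarith) hQ
    linarith

theorem class_eq_of_attainsMin {Q : ℝ} (hΛ : 0 ≤ Λ) (hQ : 0 < Q) {e val : ι → ℝ}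
    (hgap : ∀ I ∈ A, κ I ≠ α → ∃ J ∈ A, e J + 40 * ((Λ + 1) ^ 2 * Q) ≤ e I)
    (hval : ∀ I ∈ A, ∀ J ∈ A, |(val I - val J) - (e I - e J)| ≤ 20 * ((Λ + 1) ^ 2 * Q))
    (hI : AttainsMin A val I) : κ I = α := by
  by_contra hne
  obtain ⟨J, hJ, hJI⟩ := hgap I hI.1 hne
  have := (abs_le.1 (hval I hI.1 J hJ)).1
  have := hI.2 J hJ
  have : 0 < (Λ + 1) ^ 2 * Q := by positivity
  linarith

theorem abs_bridge_sub_bridgeEnd_le (h : DependentChain A g n m S U H w Λ)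
    (hb : LongBridges g n m ℓ Λ) (has : a + s ≤ g) (hts : t ≤ s) (hx0 : 0 ≤ x) (hx : x ≤ n (a + t))
    (hfirst : t = 0 → n a - x ≤ 2 * ((4 * Λ + 1) * blockLen n ℓ a s))
    (hlater : 1 ≤ t → x ≤ 2 * ((4 * Λ + 1) * blockLen n ℓ a s)) (hI : I ∈ A) (hJ : J ∈ A) :
    |((w (a + t) I + S (a + t) I * x) - (w (a + t) J + S (a + t) J * x)) -
      ((w a I + S a I * n a) - (w a J + S a J * n a))| ≤
      20 * ((Λ + 1) ^ 2 * blockLen n ℓ a s) := by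
  have hΛ := h.nonneg hI
  have hQ := hb.blockLen_nonneg has
  set Q := blockLen n ℓ a s
  have hbound : 2 * Λ * Q + 2 * Λ * (2 * ((4 * Λ + 1) * Q)) ≤ 20 * ((Λ + 1) ^ 2 * Q) := by
    nlinarith [mul_nonneg hΛ hQ, mul_nonneg (mul_nonneg hΛ hΛ) hQ]
  have hΛQ : 0 ≤ 2 * Λ * Q := by positivity
  rcases Nat.eq_zero_or_pos t with rfl | ht
  · have hS := h.abs_slope_sub_le (show a ≤ g by omega) hI hJ (show 0 ≤ n a - x by simpa using hx)
    have hx' : 2 * Λ * (n a - x) ≤ 2 * Λ * (2 * ((4 * Λ + 1) * Q)) := by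
      have := hfirst rfl
      gcongr
    rw [add_zero]
    rw [abs_le] at hS ⊢
    constructor <;> linarith
  · have hS := h.abs_slope_sub_le (show a + t ≤ g by omega) hI hJ hx0
    have hw := h.abs_sub_bridgeEnd_le_of_le hb hI hJ ht hts has
    have hx' : 2 * Λ * x ≤ 2 * Λ * (2 * ((4 * Λ + 1) * Q)) := by
      have := hlater ht
      gcongr
    rw [abs_le] at hS hw ⊢
    constructor <;> linarith

theorem abs_loop_sub_bridgeEnd_le (h : DependentChain A g n m S U H w Λ)
    (hb : LongBridges g n m ℓ Λ) (has : a + s ≤ g) (hts : t < s) (hI : I ∈ A) (hJ : J ∈ A) :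
    |((w (a + t) I + S (a + t) I * n (a + t) + m (a + t + 1) * H (a + t) I) -
        (w (a + t) J + S (a + t) J * n (a + t) + m (a + t + 1) * H (a + t) J)) -
      ((w a I + S a I * n a) - (w a J + S a J * n a))| ≤
      20 * ((Λ + 1) ^ 2 * blockLen n ℓ a s) := by
  have hΛ := h.nonneg hI
  have hQ := hb.blockLen_nonneg has
  have hm := hb.bot_pos (a + t) (by omega)
  have hH := h.abs_half_sub_le (show a + t < g by omega) hI hJ hm.le
  have hmQ : 2 * Λ * m (a + t + 1) ≤ 2 * Λ * blockLen n ℓ a s := by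
    have := hb.bot_le_blockLen has hts
    gcongr
  have hnear : |((w (a + t) I + S (a + t) I * n (a + t)) -
      (w (a + t) J + S (a + t) J * n (a + t))) -
      ((w a I + S a I * n a) - (w a J + S a J * n a))| ≤ 4 * Λ * blockLen n ℓ a s := by
    rcases Nat.eq_zero_or_pos t with rfl | ht
    · rw [add_zero, sub_self, abs_zero]
      positivity
    · have hn := hb.bridge_pos (a + t) (by omega)
      have hS := h.abs_slope_sub_le (show a + t ≤ g by omega) hI hJ hn.le
      have hw := h.abs_sub_bridgeEnd_le_of_le hb hI hJ ht hts.le has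
      have : 2 * Λ * n (a + t) ≤ 2 * Λ * blockLen n ℓ a s := by
        have := hb.bridge_le_blockLen has ht hts
        gcongr
      rw [abs_le] at hS hw ⊢
      constructor <;> linarith
  have : 6 * Λ * blockLen n ℓ a s ≤ 20 * ((Λ + 1) ^ 2 * blockLen n ℓ a s) := by
    rw [← mul_assoc]
    exact mul_le_mul_of_nonneg_right (by nlinarith) hQ
  rw [abs_le] at hH hnear ⊢
  constructor <;> linarith

/-- A point `x` on the bridge `a + t`, far enough from the loops of the block for comparing slopes,
at which only functions of class `α` and of slope `σ` are minimal. -/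
structure IsGenericPoint (A : Finset ι) (n m : ℕ → ℝ) (S : ℕ → ι → ℤ) (w : ℕ → ι → ℝ) (Λ : ℝ)
    (κ : ι → ℕ) (α a s t : ℕ) (x : ℝ) (σ : ℤ) : Prop where
  nonneg : 0 ≤ x
  le : x ≤ n (a + t)
  right_margin : t < s → (4 * Λ + 1) * m (a + t + 1) ≤ n (a + t) - x
  left_margin : 1 ≤ t → (4 * Λ + 1) * m (a + t) ≤ x
  of_attainsMin : ∀ I, AttainsMin A (fun I => w (a + t) I + S (a + t) I * x) I →
    κ I = α ∧ S (a + t) I = σ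

theorem exists_isGenericPoint (h : DependentChain A g n m S U H w Λ) (hb : LongBridges g n m ℓ Λ)
    (has : a + s ≤ g) (hs : 1 ≤ s)
    (ha : 100 * (Λ + 1) ^ 2 * blockLen n ℓ a s ≤ n a)
    (hz : 100 * (Λ + 1) ^ 2 * blockLen n ℓ a s ≤ n (a + s))
    (hgap : ∀ I ∈ A, κ I ≠ α → ∃ J ∈ A,
      w a J + S a J * n a + 40 * ((Λ + 1) ^ 2 * blockLen n ℓ a s) ≤ w a I + S a I * n a)
    (hts : t ≤ s) : ∃ x σ, IsGenericPoint A n m S w Λ κ α a s t x σ := by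
  obtain ⟨I₀, hI₀⟩ := h.exists_mem (hb.bridge_pos 0 g.zero_le).le
  have hΛ := h.nonneg hI₀
  obtain ⟨lo, hi, hlt, hlo, hhi, hright, hleft, hfirst, hlater⟩ :=
    hb.exists_interval hΛ has hs ha hz hts
  obtain ⟨x, hlox, hxhi, σ, hσ⟩ := exists_common_slope (w (a + t)) (S (a + t)) hlt ⟨I₀, hI₀⟩
  have hx0 : 0 ≤ x := hlo.trans hlox.le
  have hxn : x ≤ n (a + t) := hxhi.le.trans hhi
  refine ⟨x, σ, hx0, hxn, fun ht => (hright ht).trans (by linarith),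
    fun ht => (hleft ht).trans hlox.le, fun I hI => ⟨?_, hσ I hI⟩⟩
  exact class_eq_of_attainsMin hΛ (hb.blockLen_pos has hs) hgap (fun I hI J hJ =>
    h.abs_bridge_sub_bridgeEnd_le hb has hts hx0 hxn (fun ht => by linarith [hfirst ht])
      (fun ht => hxhi.le.trans (hlater ht)) hI hJ) hI

theorem exists_slopes_of_gap (h : DependentChain A g n m S U H w Λ) (hb : LongBridges g n m ℓ Λ)
    (has : a + s ≤ g) (hs : 1 ≤ s)
    (ha : 100 * (Λ + 1) ^ 2 * blockLen n ℓ a s ≤ n a)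
    (hz : 100 * (Λ + 1) ^ 2 * blockLen n ℓ a s ≤ n (a + s))
    (hgap : ∀ I ∈ A, κ I ≠ α → ∃ J ∈ A,
      w a J + S a J * n a + 40 * ((Λ + 1) ^ 2 * blockLen n ℓ a s) ≤ w a I + S a I * n a) :
    ∃ (x : ℕ → ℝ) (σ : ℕ → ℤ),
      (∀ t ≤ s, MinTwice A (fun I => w (a + t) I + S (a + t) I * x t) ∧
        ∀ I, AttainsMin A (fun I => w (a + t) I + S (a + t) I * x t) I →
          κ I = α ∧ S (a + t) I = σ t) ∧
      ∀ t < s, ∀ I, AttainsMin A (fun I => w (a + t) I + S (a + t) I * n (a + t) +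
          m (a + t + 1) * H (a + t) I) I →
        κ I = α ∧ S (a + t) I ≤ σ t ∧ σ (t + 1) ≤ S (a + (t + 1)) I := by
  have hpoint : ∀ t, ∃ x σ, t ≤ s → IsGenericPoint A n m S w Λ κ α a s t x σ := fun t => by
    by_cases hts : t ≤ s
    · obtain ⟨x, σ, hx⟩ := h.exists_isGenericPoint hb has hs ha hz hgap hts
      exact ⟨x, σ, fun _ => hx⟩
    · exact ⟨0, 0, fun hts' => absurd hts' hts⟩
  choose x σ hx using hpoint
  have hmin : ∀ t ≤ s, MinTwice A (fun I => w (a + t) I + S (a + t) I * x t) := fun t ht =>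
    h.bridge _ (by omega) _ (hx t ht).nonneg (hx t ht).le
  refine ⟨x, σ, fun t ht => ⟨hmin t ht, (hx t ht).of_attainsMin⟩, fun t ht I hI => ?_⟩
  have hatg : a + t < g := by omega
  have hm := hb.bot_pos (a + t) hatg
  obtain ⟨J, -, -, hJ, -⟩ := (hmin t ht.le).exists_attainsMin
  obtain ⟨K, -, -, hK, -⟩ := (hmin (t + 1) ht).exists_attainsMin
  refine ⟨class_eq_of_attainsMin (h.nonneg hI.1) (hb.blockLen_pos has hs) hgap
    (fun I hI J hJ => h.abs_loop_sub_bridgeEnd_le hb has ht hI hJ) hI, ?_, ?_⟩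
  · rw [← ((hx t ht.le).of_attainsMin J hJ).2]
    exact h.slope_le_of_attainsMin_loop hatg hm ((hx t ht.le).right_margin ht) hI hJ
  · rw [← ((hx (t + 1) ht).of_attainsMin K hK).2]
    exact h.le_slope_of_attainsMin_loop hatg hm ((hx (t + 1) ht).left_margin (by omega)) hI hK

theorem exists_block (h : DependentChain A g n m S U H w Λ) (hb : LongBridges g n m ℓ Λ)
    (hs : 1 ≤ s) (hg : (r + 1) * s ≤ g)
    (hblock : ∀ α ≤ r, 100 * (Λ + 1) ^ 2 * blockLen n ℓ (α * s) s ≤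
      min (n (α * s)) (n ((α + 1) * s)))
    (hκ : ∀ I ∈ A, κ I ≤ r)
    (hsep : ∀ α, 1 ≤ α → α ≤ r → ∀ I ∈ A, ∀ J ∈ A, κ I < α → α ≤ κ J →
      S (α * s) J + 1 ≤ S (α * s) I) :
    ∃ α ≤ r, ∃ (x : ℕ → ℝ) (σ : ℕ → ℤ),
      (∀ t ≤ s, MinTwice A (fun I => w (α * s + t) I + S (α * s + t) I * x t) ∧
        ∀ I, AttainsMin A (fun I => w (α * s + t) I + S (α * s + t) I * x t) I →
          κ I = α ∧ S (α * s + t) I = σ t) ∧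
      ∀ t < s, ∀ I, AttainsMin A (fun I => w (α * s + t) I + S (α * s + t) I * n (α * s + t) +
          m (α * s + t + 1) * H (α * s + t) I) I →
        κ I = α ∧ S (α * s + t) I ≤ σ t ∧ σ (t + 1) ≤ S (α * s + (t + 1)) I := by
  obtain ⟨α, hα, hgap⟩ := h.exists_isolated_block hb hs hg hblock hκ hsep
  have hend : (α + 1) * s = α * s + s := by ring
  have has : α * s + s ≤ g := hend ▸ (Nat.mul_le_mul_right s (by omega)).trans hg
  obtain ⟨ha, hz⟩ := le_min_iff.1 (hblock α hα)
  exact ⟨α, hα, h.exists_slopes_of_gap hb has hs ha (hend ▸ hz) hgap⟩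

end DependentChain

/-! ### Functions of triples -/

/-- The sum of the values of `q` at the entries of a triple. -/
def tripleSum (q : ℕ → ℤ) (I : ℕ × ℕ × ℕ) : ℤ := q I.1 + q I.2.1 + q I.2.2

/-- The multiset of the entries of a triple. -/
def tripleSym (r : ℕ) (I : ℕ × ℕ × ℕ) : Sym (Fin (r + 1)) 3 :=
  ⟨{Fin.ofNat (r + 1) I.1, Fin.ofNat (r + 1) I.2.1, Fin.ofNat (r + 1) I.2.2}, rfl⟩

/-- Weakly increasing triples of integers between `0` and `r`. -/
def IsTriple (r : ℕ) (I : ℕ × ℕ × ℕ) : Prop := I.1 ≤ I.2.1 ∧ I.2.1 ≤ I.2.2 ∧ I.2.2 ≤ r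

theorem tripleSym_injOn (r : ℕ) : Set.InjOn (tripleSym r) {I | IsTriple r I} := by
  rintro ⟨i, j, k⟩ ⟨h1, h2, h3⟩ ⟨i', j', k'⟩ ⟨h1', h2', h3'⟩ h
  simp only at h1 h2 h3 h1' h2' h3'
  have hval := congrArg (fun x : Sym (Fin (r + 1)) 3 =>
    (x : Multiset (Fin (r + 1))).map (fun x : Fin (r + 1) => (x : ℕ))) h
  simp only [tripleSym, Sym.coe_mk, Multiset.insert_eq_cons, Multiset.map_cons,
    Multiset.map_singleton, Fin.val_ofNat] at hval
  rw [Nat.mod_eq_of_lt (by omega), Nat.mod_eq_of_lt (by omega), Nat.mod_eq_of_lt (by omega),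
    Nat.mod_eq_of_lt (by omega), Nat.mod_eq_of_lt (by omega), Nat.mod_eq_of_lt (by omega)] at hval
  have hperm : [i, j, k].Perm [i', j', k'] := Multiset.coe_eq_coe.1 hval
  have hlist := hperm.eq_of_pairwise (le := (· ≤ ·)) (fun a b _ _ h h' => le_antisymm h h')
    (by simp; omega) (by simp; omega)
  simp only [List.cons.injEq, and_true] at hlist
  obtain ⟨rfl, rfl, rfl⟩ := hlist
  rfl

theorem exists_tripleSym_eq (r : ℕ) (I : Sym (Fin (r + 1)) 3) :
    ∃ J, IsTriple r J ∧ tripleSym r J = I := by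
  obtain ⟨I, hI⟩ := I
  have hlen : (I.sort (· ≤ ·)).length = 3 := by rw [Multiset.length_sort, hI]
  have hsorted := Multiset.pairwise_sort I (· ≤ ·)
  obtain ⟨a, b, c, habc⟩ := List.length_eq_three.1 hlen
  rw [habc] at hsorted
  simp only [List.pairwise_cons, List.mem_cons, List.not_mem_nil, or_false, forall_eq_or_imp,
    forall_eq] at hsorted
  refine ⟨(a, b, c), ⟨hsorted.1.1, hsorted.2.1, by simp only; omega⟩, Subtype.ext ?_⟩
  simp only [tripleSym, Fin.ofNat_eq_cast, Fin.cast_val_eq_self]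
  rw [← Multiset.sort_eq I (· ≤ ·), habc]
  rfl

namespace ChainOfLoops

open MetricGraph

variable {g r s : ℕ} {Γ : ChainOfLoops g} {p : ℕ → ℕ → ℤ} {P : ℕ → ℤ}

theorem HasProfile.add {f f' : Γ.graph.Point → ℝ} {S U H S' U' H' : ℕ → ℤ}
    (hf : HasProfile Γ f S U H) (hf' : HasProfile Γ f' S' U' H') :
    HasProfile Γ (f + f') (S + S') (U + U') (H + H') where
  bridge k t h0 h1 := by
    simp only [Pi.add_apply, hf.bridge k t h0 h1, hf'.bridge k t h0 h1, Int.cast_add]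
    ring
  half k := by simp only [Pi.add_apply, hf.half k, hf'.half k, Int.cast_add]; ring
  loop k := by simp only [Pi.add_apply, hf.loop k, hf'.loop k, Int.cast_add]; ring

theorem HasProfile.add_const {f : Γ.graph.Point → ℝ} {S U H : ℕ → ℤ} (hf : HasProfile Γ f S U H)
    (c : ℝ) : HasProfile Γ (fun x => f x + c) S U H where
  bridge k t h0 h1 := by rw [hf.bridge k t h0 h1]; ring
  half k := by rw [hf.half k]; ring
  loop k := by rw [hf.loop k]; ring

theorem dependentChain_of_hasProfile {ι : Type*} {T : Finset ι} {f : ι → Γ.graph.Point → ℝ}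
    {S U H : ℕ → ι → ℤ} {Λ : ℝ} (hf : ∀ I ∈ T, HasProfile Γ (f I) (S · I) (U · I) (H · I))
    (hmin : ∀ x, MinTwice T fun I => f I x) (hS : ∀ k ≤ g, ∀ I ∈ T, |(S k I : ℝ)| ≤ Λ)
    (hU : ∀ k < g, ∀ I ∈ T, |(U k I : ℝ)| ≤ Λ) (hH : ∀ k < g, ∀ I ∈ T, |(H k I : ℝ)| ≤ Λ) :
    DependentChain T g Γ.bridgeLen Γ.botLen S U H
      (fun k I => f I (Γ.wPoint (Fin.ofNat (g + 1) k))) Λ := by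
  have hcast : ∀ k (hk : k < g + 1), Fin.ofNat (g + 1) k = ⟨k, hk⟩ := fun k hk =>
    Fin.ext (Nat.mod_eq_of_lt hk)
  refine ⟨fun k hk I hI => ?_, fun k hk x h0 h1 => ?_, fun k hk => ?_, hS, hU, hH⟩
  · rw [hcast k (by omega), hcast (k + 1) (by omega)]
    exact (hf I hI).loop ⟨k, hk⟩
  · refine (hmin (Γ.graph.onEdge (bridge ⟨k, by omega⟩) x)).congr fun I hI => ?_
    rw [hcast k (by omega)]
    exact (hf I hI).bridge ⟨k, by omega⟩ x h0 h1
  · refine (hmin (Γ.graph.onEdge (top ⟨k, hk⟩) (Γ.topLen (k + 1) / 2))).congr fun I hI => ?_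
    rw [hcast k (by omega)]
    exact (hf I hI).half ⟨k, hk⟩

theorem abs_tripleSum_le {q : ℕ → ℤ} {b : ℝ} (hq : ∀ i ≤ r, |(q i : ℝ)| ≤ b) {I : ℕ × ℕ × ℕ}
    (hI : IsTriple r I) : |(tripleSum q I : ℝ)| ≤ 3 * b := by
  obtain ⟨h1, h2, h3⟩ := hI
  have := abs_add_three (q I.1 : ℝ) (q I.2.1) (q I.2.2)
  rw [tripleSum, Int.cast_add, Int.cast_add]
  linarith [hq I.1 (by omega), hq I.2.1 (by omega), hq I.2.2 h3]

theorem abs_loopChange_le (hP : SlopePath g r s p P) {k i : ℕ} (hk : k < g) (hi : i ≤ r) :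
    |loopChange p P k i| ≤ r + s + 1 := by
  have := hP.nonneg k hk.le i hi
  have := hP.le k hk.le i hi
  have := hP.special_nonneg k hk
  have := hP.special_le k hk
  rw [abs_le, loopChange]
  split_ifs <;> constructor <;> omega

theorem abs_halfChange_le (hP : SlopePath g r s p P) {k i : ℕ} (hk : k < g) (hi : i ≤ r) :
    |halfChange p P k i| ≤ r + s + 1 := by
  have := hP.nonneg k hk.le i hi
  have := hP.le k hk.le i hi
  have := hP.special_nonneg k hk
  have := hP.special_le k hk
  rw [abs_le, halfChange]
  constructor <;> omega

theorem abs_slope_le (hP : SlopePath g r s p P) {k i : ℕ} (hk : k ≤ g) (hi : i ≤ r) :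
    |p k i| ≤ r + s + 1 := by
  have := hP.nonneg k hk i hi
  have := hP.le k hk i hi
  rw [abs_le]
  constructor <;> omega

theorem exists_tripleFunctions (hP : SlopePath g r s p P) (hΓ : ShortBottoms Γ) :
    ∃ ψ : Sym (Fin (r + 1)) 3 → Γ.graph.Point → ℝ,
      (∀ I, MovesTo (ψ I) (3 • baseDivisor Γ r s P) ((I : Multiset (Fin (r + 1))).map
        fun i : Fin (r + 1) => endDivisor Γ r p P i).sum) ∧
      ∀ T : Finset (ℕ × ℕ × ℕ), (∀ I ∈ T, IsTriple r I) →
        TropicallyDependent (T.image (tripleSym r)) ψ →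
        ∃ w, DependentChain T g Γ.bridgeLen Γ.botLen (fun k => tripleSum (p k))
          (fun k => tripleSum (loopChange p P k)) (fun k => tripleSum (halfChange p P k)) w
          (3 * (r + s + 1)) := by
  choose f hf hprofile using fun i : Fin (r + 1) =>
    exists_hasProfile_endDivisor hP hΓ (i := i) (by omega)
  refine ⟨fun I x => ((I : Multiset (Fin (r + 1))).map fun i => f i x).sum, fun I => ?_,
    fun T hT ⟨b, hb⟩ => ?_⟩
  · simpa only [show Multiset.card (I : Multiset (Fin (r + 1))) = 3 from I.2] using
      MovesTo.multiset_sum hf (I : Multiset (Fin (r + 1)))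
  have hprofile' : ∀ i ≤ r, HasProfile Γ (f (Fin.ofNat (r + 1) i)) (p · i) (loopChange p P · i)
      (halfChange p P · i) := fun i hi => by
    simpa only [Fin.val_ofNat, Nat.mod_eq_of_lt (Nat.lt_succ_of_le hi)] using
      hprofile (Fin.ofNat (r + 1) i)
  refine ⟨_, dependentChain_of_hasProfile (f := fun I x => (f (Fin.ofNat (r + 1) I.1) +
    f (Fin.ofNat (r + 1) I.2.1) + f (Fin.ofNat (r + 1) I.2.2)) x + b (tripleSym r I))
    (fun I hI => ?_) (fun x => ?_) (fun k hk I hI => abs_tripleSum_le (fun i hi => ?_) (hT I hI))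
    (fun k hk I hI => abs_tripleSum_le (fun i hi => ?_) (hT I hI))
    (fun k hk I hI => abs_tripleSum_le (fun i hi => ?_) (hT I hI))⟩
  · obtain ⟨h1, h2, h3⟩ := hT I hI
    exact (((hprofile' I.1 (by omega)).add (hprofile' I.2.1 (by omega))).add
      (hprofile' I.2.2 h3)).add_const _
  · obtain ⟨I, hI, J, hJ, hne, heq, hle⟩ := hb x
    obtain ⟨I, hI', rfl⟩ := Finset.mem_image.1 hI
    obtain ⟨J, hJ', rfl⟩ := Finset.mem_image.1 hJ
    refine ⟨I, hI', J, hJ', fun h => hne (by rw [h]), ?_, fun K hK => ?_⟩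
    · simpa [tripleSym, add_assoc] using heq
    · simpa [tripleSym, add_assoc] using hle _ (Finset.mem_image_of_mem _ hK)
  · exact_mod_cast abs_slope_le hP hk hi
  · exact_mod_cast abs_loopChange_le hP hk hi
  · exact_mod_cast abs_halfChange_le hP hk hi

end ChainOfLoops

/-! ### The slopes and minima in a block -/

/-- The slope of the function `i` on the bridge `k`: it increases by one at each loop of the block
with index `i`. -/
def blockSlope (r s k i : ℕ) : ℤ := r - i + (min s (k - i * s) : ℕ)

/-- The slope that increases at the loop after the bridge `k`. -/
def blockSpecial (r s k : ℕ) : ℤ :=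
  if k < (r + 1) * s then (r : ℤ) - (k / s : ℕ) + (k % s : ℕ) else r + s + 1

/-- The slope of the function `i` on the bridge `t` of the block `α`. -/
def localSlope (r s α t i : ℕ) : ℤ := r - i + if i < α then (s : ℤ) else if i = α then t else 0

/-- The change of the function `i` on the first half of the top edge of the loop after the bridge
`t` of the block `α`. -/
def localRise (s α t i : ℕ) : ℤ := if i < α then (α : ℤ) - i + s - t - 1 else 0

/-- The change of the function `i` between the middle of the top edge and the end of the loop after
the bridge `t` of the block `α`. -/
def localFall (α t i : ℕ) : ℤ := if α < i then (α : ℤ) - i - t else 0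

theorem blockSlope_block {r s α t : ℕ} (ht : t ≤ s) (i : ℕ) :
    blockSlope r s (α * s + t) i = localSlope r s α t i := by
  unfold blockSlope localSlope
  rcases lt_trichotomy i α with h | h | h
  · obtain ⟨d, rfl⟩ := Nat.exists_eq_add_of_lt h
    have e : (i + d + 1) * s + t - i * s = d * s + s + t := by
      rw [show (i + d + 1) * s + t = i * s + (d * s + s + t) by ring, Nat.add_sub_cancel_left]
    rw [e, min_eq_left (by omega), if_pos h]
  · subst h
    rw [Nat.add_sub_cancel_left, min_eq_right ht]
    simp
  · obtain ⟨d, rfl⟩ := Nat.exists_eq_add_of_lt h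
    have e : α * s + t - (α + d + 1) * s = 0 := by
      rw [show (α + d + 1) * s = α * s + d * s + s by ring]; omega
    rw [e, if_neg (by omega), if_neg (by omega)]
    simp

theorem blockSpecial_block {r s α t : ℕ} (hα : α ≤ r) (ht : t < s) :
    blockSpecial r s (α * s + t) = (r : ℤ) - α + t := by
  have h1 : α * s + t < (r + 1) * s := by
    have : (α + 1) * s ≤ (r + 1) * s := Nat.mul_le_mul_right _ (by omega)
    rw [add_mul, one_mul] at this
    omega
  rw [blockSpecial, if_pos h1]
  congr 3
  · rw [mul_comm, Nat.mul_add_div (by omega), Nat.div_eq_of_lt ht, add_zero]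
  · rw [mul_comm, Nat.mul_add_mod, Nat.mod_eq_of_lt ht]

theorem blockSlope_of_le {r s k i : ℕ} (hi : i ≤ r) (hk : (r + 1) * s ≤ k) :
    blockSlope r s k i = r - i + s := by
  have h1 : (i + 1) * s ≤ (r + 1) * s := Nat.mul_le_mul_right _ (by omega)
  rw [add_mul, one_mul] at h1
  rw [blockSlope, min_eq_left (by omega)]

theorem exists_eq_block {r s k : ℕ} (hs : 1 ≤ s) (hk : k < (r + 1) * s) :
    ∃ α ≤ r, ∃ t < s, k = α * s + t :=
  ⟨k / s, Nat.le_of_lt_succ (Nat.div_lt_of_lt_mul (by rwa [mul_comm])), k % s,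
    Nat.mod_lt _ (by omega), by rw [mul_comm, Nat.div_add_mod]⟩

theorem blockSlope_cases {r s : ℕ} (hs : 1 ≤ s) (k : ℕ) :
    (∃ α ≤ r, ∃ t < s, blockSlope r s k = localSlope r s α t ∧
      blockSlope r s (k + 1) = localSlope r s α (t + 1) ∧ blockSpecial r s k = r - α + t) ∨
    (∀ i ≤ r, blockSlope r s k i = r - i + s) ∧ (∀ i ≤ r, blockSlope r s (k + 1) i = r - i + s) ∧
      blockSpecial r s k = r + s + 1 := by
  rcases lt_or_ge k ((r + 1) * s) with hk | hk
  · obtain ⟨α, hα, t, ht, rfl⟩ := exists_eq_block hs hk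
    exact .inl ⟨α, hα, t, ht, funext (blockSlope_block ht.le),
      funext fun i => by rw [add_assoc, blockSlope_block ht], blockSpecial_block hα ht⟩
  · exact .inr ⟨fun i hi => blockSlope_of_le hi hk, fun i hi => blockSlope_of_le hi (by omega),
      if_neg (not_lt.2 hk)⟩

theorem slopePath_blockSlope {r s ρ : ℕ} (hs : 1 ≤ s) :
    SlopePath (genusOf r s ρ) r s (blockSlope r s) (blockSpecial r s) where
  start i _ := by simp [blockSlope]
  finish i hi := blockSlope_of_le hi (by simp [genusOf])
  step k _ i hi := by
    rcases blockSlope_cases (r := r) hs k with ⟨α, -, t, ht, h, h', hP⟩ | ⟨h, h', hP⟩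
    · rw [h, h', hP, localSlope, localSlope]
      split_ifs <;> push_cast <;> omega
    · rw [h i hi, h' i hi, hP, if_neg (by omega), add_zero]
  anti k _ i j hij hj := by
    rcases blockSlope_cases (r := r) hs k with ⟨α, -, t, ht, h, -⟩ | ⟨h, -⟩
    · rw [h, localSlope, localSlope]
      split_ifs <;> omega
    · rw [h i (by omega), h j hj]
      omega
  skip k _ i hi := by
    rcases blockSlope_cases (r := r) hs k with ⟨α, -, t, _, h, -, hP⟩ | ⟨h, -, hP⟩
    · rw [h, hP, localSlope]
      split_ifs <;> omega
    · rw [h i hi, hP]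
      omega
  nonneg k _ i _ := by unfold blockSlope; omega
  le k _ i _ := by unfold blockSlope; omega
  special_nonneg k _ := by
    rcases blockSlope_cases (r := r) hs k with ⟨α, _, t, _, -, -, hP⟩ | ⟨-, -, hP⟩ <;> omega
  special_le k _ := by
    rcases blockSlope_cases (r := r) hs k with ⟨α, _, t, _, -, -, hP⟩ | ⟨-, -, hP⟩ <;> omega
  succ_le_genus := by unfold genusOf; nlinarith
  add_le_genus := by unfold genusOf; nlinarith

open ChainOfLoops in
theorem halfChange_block {r s α t : ℕ} (hα : α ≤ r) (ht : t < s) (i : ℕ) :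
    halfChange (blockSlope r s) (blockSpecial r s) (α * s + t) i = localRise s α t i := by
  rw [halfChange, blockSlope_block ht.le, blockSpecial_block hα ht]
  unfold localSlope localRise
  split_ifs <;> omega

open ChainOfLoops in
theorem loopChange_block {r s α t : ℕ} (hα : α ≤ r) (ht : t < s) (i : ℕ) :
    loopChange (blockSlope r s) (blockSpecial r s) (α * s + t) i =
      localRise s α t i + localFall α t i := by
  rw [loopChange, blockSlope_block ht.le, blockSpecial_block hα ht]
  unfold localSlope localRise localFall
  split_ifs <;> omega

theorem tripleSum_add (f h : ℕ → ℤ) (I : ℕ × ℕ × ℕ) :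
    tripleSum (fun i => f i + h i) I = tripleSum f I + tripleSum h I := by
  simp only [tripleSum]; ring

theorem tripleSum_blockSlope {r s α t : ℕ} (ht : t ≤ s) :
    tripleSum (blockSlope r s (α * s + t)) = tripleSum (localSlope r s α t) := by
  rw [funext (blockSlope_block ht)]

theorem tripleSum_halfChange {r s α t : ℕ} (hα : α ≤ r) (ht : t < s) :
    tripleSum (ChainOfLoops.halfChange (blockSlope r s) (blockSpecial r s) (α * s + t)) =
      tripleSum (localRise s α t) := by
  rw [funext (halfChange_block hα ht)]

theorem tripleSum_loopChange {r s α t : ℕ} (hα : α ≤ r) (ht : t < s) (I : ℕ × ℕ × ℕ) :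
    tripleSum (ChainOfLoops.loopChange (blockSlope r s) (blockSpecial r s) (α * s + t)) I =
      tripleSum (localRise s α t) I + tripleSum (localFall α t) I := by
  rw [funext (loopChange_block hα ht), tripleSum_add]

theorem tripleSum_blockSlope_add_one_le {r s α : ℕ} (hα : α ≤ r) {I J : ℕ × ℕ × ℕ}
    (hI : IsTriple r I) (hJ : IsTriple r J) (hsep : I.1 + I.2.2 ≤ I.2.1 + s + 1 ∨ I.2.1 = r)
    (hIα : I.2.1 < α) (hJα : α ≤ J.2.1) :
    tripleSum (blockSlope r s (α * s)) J + 1 ≤ tripleSum (blockSlope r s (α * s)) I := by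
  obtain ⟨_, _, _⟩ := hI
  obtain ⟨_, _, _⟩ := hJ
  rw [← add_zero (α * s), tripleSum_blockSlope (Nat.zero_le s)]
  simp only [tripleSum, localSlope]
  split_ifs <;> omega

/-- The value of the function `I` in the middle of the top edge of the loop after the bridge `t` of
the block `α`, where `y t I` is its value at distance `z t` before that loop, and `q t` is the
length of the bottom edge. -/
def midValue (r s α : ℕ) (y : ℕ → ℕ × ℕ × ℕ → ℝ) (z q : ℕ → ℝ) (t : ℕ) (I : ℕ × ℕ × ℕ) : ℝ :=
  y t I + tripleSum (localSlope r s α t) I * z t + q t * tripleSum (localRise s α t) I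

/-- A block of a chain of loops on which the minimum of the functions in `T` occurs twice: `y t I`
is the value of the function `I` at a point at distances `x t` and `z t` from the ends of the
bridge `t` of the block, where all minimal functions have the slope `σ t`, and `q t` is the bottom
length of the loop after that bridge. -/
structure MinimalBlock (T : Finset (ℕ × ℕ × ℕ)) (r s α : ℕ) (y : ℕ → ℕ × ℕ × ℕ → ℝ)
    (x z q : ℕ → ℝ) (σ : ℕ → ℤ) : Prop where
  minTwice_bridge : ∀ t ≤ s, MinTwice T (y t)
  of_bridge : ∀ t ≤ s, ∀ I, AttainsMin T (y t) I →
    I.2.1 = α ∧ tripleSum (localSlope r s α t) I = σ t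
  minTwice_loop : ∀ t < s, MinTwice T (midValue r s α y z q t)
  of_loop : ∀ t < s, ∀ I, AttainsMin T (midValue r s α y z q t) I →
    I.2.1 = α ∧ tripleSum (localSlope r s α t) I ≤ σ t ∧
      σ (t + 1) ≤ tripleSum (localSlope r s α (t + 1)) I
  next : ∀ t < s, ∀ I ∈ T, y (t + 1) I = midValue r s α y z q t I +
    q t * tripleSum (localFall α t) I + tripleSum (localSlope r s α (t + 1)) I * x (t + 1)
  pos : ∀ t < s, 0 < q t
  inj : ∀ t < s, ∀ t' < s, q t = q t' → t = t'

namespace ChainOfLoops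

section Admissible

variable {g r s : ℕ} {Γ : ChainOfLoops g} {C : ℝ}

theorem Admissible.botLen_inj (h : Γ.Admissible r s C) {k l : ℕ} (hk : 1 ≤ k ∧ k ≤ g)
    (hl : 1 ≤ l ∧ l ≤ g) (hkl : Γ.botLen k = Γ.botLen l) : k = l := by
  by_contra hne
  have hsum : ∑ i ∈ Finset.Icc 1 g,
      (((if i = k then 1 else 0) - (if i = l then 1 else 0) : ℤ) : ℝ) * Γ.botLen i = 0 := by
    push_cast
    simp only [sub_mul, ite_mul, one_mul, zero_mul, Finset.sum_sub_distrib, Finset.sum_ite_eq',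
      Finset.mem_Icc, hk, hl, and_self, if_true, hkl, sub_self]
  have hzero := h.no_relation (fun i => (if i = k then 1 else 0) - (if i = l then 1 else 0))
    (fun i => by split_ifs <;> simp <;> omega) hsum k (Finset.mem_Icc.2 hk)
  simp [hne] at hzero

theorem Admissible.shortBottoms (h : Γ.Admissible r s C) : ShortBottoms Γ :=
  fun k => h.bot_lt_top _ (by omega) (by omega)

theorem Admissible.longBridges {Λ : ℝ} (h : Γ.Admissible r s (100 * (Λ + 1) ^ 2)) :
    LongBridges g Γ.bridgeLen Γ.botLen Γ.topLen Λ where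
  bridge_pos := Γ.bridgeLen_pos
  bot_pos k hk := Γ.botLen_pos _ (by omega) hk
  bot_lt_top k hk := by
    have hm := Γ.botLen_pos (k + 1) (by omega) hk
    have hlt := h.bot_lt_top (k + 1) (by omega) hk
    have hg : (1 : ℝ) ≤ g := by exact_mod_cast Nat.one_le_of_lt hk
    nlinarith
  top_le_left k hk := (h.top_ll_bridge (k + 1) (by omega) hk).trans (min_le_left _ _)
  top_le_right k hk := (h.top_ll_bridge (k + 1) (by omega) hk).trans (min_le_right _ _)

theorem Admissible.blockLen_le (h : Γ.Admissible r s C) (hs : 1 ≤ s) {α : ℕ} (hα : α ≤ r) :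
    C * blockLen Γ.bridgeLen Γ.topLen (α * s) s ≤
      min (Γ.bridgeLen (α * s)) (Γ.bridgeLen ((α + 1) * s)) := by
  convert h.block_ll_bridge α hα using 2
  rw [blockLen, ← Finset.Ico_add_one_right_eq_Icc, ← Finset.Ico_add_one_right_eq_Icc,
    Finset.sum_Ico_eq_sum_range, Finset.sum_Ico_eq_sum_range, add_mul, one_mul,
    show α * s + s + 1 - (α * s + 1) = s by omega,
    show α * s + s - 1 + 1 - (α * s + 1) = s - 1 by omega]

end Admissible

/-- A bound `C` on the ratios of the edge lengths that suffices for the triples: the slopes of their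
functions are at most `3 * (r + s + 1)`. -/
def admissibleConst (r s : ℕ) : ℝ := 100 * (3 * (r + s + 1) + 1) ^ 2

theorem exists_minimalBlock {r s ρ : ℕ} {Γ : ChainOfLoops (genusOf r s ρ)} (hs : 1 ≤ s)
    (hΓ : Γ.Admissible r s (admissibleConst r s)) {T : Finset (ℕ × ℕ × ℕ)}
    (hT : ∀ I ∈ T, IsTriple r I) (hsep : ∀ I ∈ T, I.1 + I.2.2 ≤ I.2.1 + s + 1 ∨ I.2.1 = r)
    {w : ℕ → ℕ × ℕ × ℕ → ℝ}
    (hw : DependentChain T (genusOf r s ρ) Γ.bridgeLen Γ.botLen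
      (fun k => tripleSum (blockSlope r s k))
      (fun k => tripleSum (loopChange (blockSlope r s) (blockSpecial r s) k))
      (fun k => tripleSum (halfChange (blockSlope r s) (blockSpecial r s) k)) w
      (3 * (r + s + 1))) :
    ∃ α ≤ r, ∃ y x z q σ, MinimalBlock T r s α y x z q σ := by
  have hg : (r + 1) * s ≤ genusOf r s ρ := by simp [genusOf]
  obtain ⟨α, hα, x, σ, hbridge, hloop⟩ := hw.exists_block (κ := fun I => I.2.1)
    hΓ.longBridges hs hg (fun α hα => hΓ.blockLen_le hs hα)
    (fun I hI => (hT I hI).2.1.trans (hT I hI).2.2) fun α _ hα I hI J hJ =>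
      tripleSum_blockSlope_add_one_le hα (hT I hI) (hT J hJ) (hsep I hI)
  have hαs : α * s + s ≤ (r + 1) * s := by
    rw [← Nat.succ_mul]
    exact Nat.mul_le_mul_right _ (by omega)
  have hmid : ∀ t < s, (fun I => w (α * s + t) I + tripleSum (blockSlope r s (α * s + t)) I *
        Γ.bridgeLen (α * s + t) + Γ.botLen (α * s + t + 1) *
          tripleSum (halfChange (blockSlope r s) (blockSpecial r s) (α * s + t)) I) =
      midValue r s α (fun t I => w (α * s + t) I + tripleSum (blockSlope r s (α * s + t)) I * x t)
        (fun t => Γ.bridgeLen (α * s + t) - x t) (fun t => Γ.botLen (α * s + t + 1)) t :=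
    fun t ht => by
      funext I
      rw [midValue, tripleSum_blockSlope ht.le, tripleSum_halfChange hα ht]
      ring
  refine ⟨α, hα, fun t I => w (α * s + t) I + tripleSum (blockSlope r s (α * s + t)) I * x t, x,
    fun t => Γ.bridgeLen (α * s + t) - x t, fun t => Γ.botLen (α * s + t + 1), σ, {
      minTwice_bridge := fun t ht => (hbridge t ht).1
      of_bridge := fun t ht => by
        rw [← tripleSum_blockSlope ht]
        exact (hbridge t ht).2
      minTwice_loop := fun t ht => hmid t ht ▸ hw.loop _ (by omega)
      of_loop := fun t ht => by
        rw [← hmid t ht, ← tripleSum_blockSlope ht.le, ← tripleSum_blockSlope ht]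
        exact hloop t ht
      next := fun t ht I hI => ?_
      pos := fun t ht => Γ.botLen_pos _ (by omega) (by omega)
      inj := fun t ht t' ht' hq => by
        have := hΓ.botLen_inj ⟨by omega, by omega⟩ ⟨by omega, by omega⟩ hq
        omega }⟩
  have hstep := hw.step (α * s + t) (by omega) I hI
  rw [tripleSum_loopChange hα ht, tripleSum_blockSlope ht.le] at hstep
  rw [midValue, ← tripleSum_blockSlope (t := t + 1) ht, ← add_assoc, hstep,
    tripleSum_blockSlope ht.le]
  push_cast
  ring

end ChainOfLoops

theorem tripleSum_localSlope {r s α t i k : ℕ} (hi : i ≤ α) (hk : α ≤ k) :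
    tripleSum (localSlope r s α t) (i, α, k) = 3 * r - i - α - k + t +
      (if i < α then (s : ℤ) else t) + if α < k then 0 else (t : ℤ) := by
  simp only [tripleSum, localSlope, lt_irrefl, if_false, if_true]
  split_ifs <;> omega

theorem exists_pair_of_attainsMin {T : Finset (ℕ × ℕ × ℕ)} {r α : ℕ} {f : ℕ × ℕ × ℕ → ℝ}
    {Q : ℕ × ℕ × ℕ → Prop} (hT : ∀ I ∈ T, IsTriple r I) (hf : MinTwice T f)
    (hQ : ∀ I, AttainsMin T f I → I.2.1 = α ∧ Q I) :
    ∃ i k i' k', (i, k) ≠ (i', k') ∧ (i, α, k) ∈ T ∧ (i', α, k') ∈ T ∧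
      (i ≤ α ∧ α ≤ k ∧ k ≤ r) ∧ (i' ≤ α ∧ α ≤ k' ∧ k' ≤ r) ∧ Q (i, α, k) ∧ Q (i', α, k') := by
  obtain ⟨⟨i, j, k⟩, ⟨i', j', k'⟩, hne, hI, hJ⟩ := hf.exists_attainsMin
  obtain ⟨rfl, hQI⟩ := hQ _ hI
  obtain ⟨rfl, hQJ⟩ := hQ _ hJ
  exact ⟨i, k, i', k', fun h => hne (by simp_all), hI.1, hJ.1, hT _ hI.1, hT _ hJ.1, hQI, hQJ⟩

namespace MinimalBlock

variable {T : Finset (ℕ × ℕ × ℕ)} {r s α : ℕ} {y : ℕ → ℕ × ℕ × ℕ → ℝ} {x z q : ℕ → ℝ} {σ : ℕ → ℤ}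

theorem exists_bridge (h : MinimalBlock T r s α y x z q σ) (hT : ∀ I ∈ T, IsTriple r I) {t : ℕ}
    (ht : t ≤ s) : ∃ i k i' k', (i, k) ≠ (i', k') ∧ (i, α, k) ∈ T ∧ (i', α, k') ∈ T ∧
      (i ≤ α ∧ α ≤ k ∧ k ≤ r) ∧ (i' ≤ α ∧ α ≤ k' ∧ k' ≤ r) ∧
      tripleSum (localSlope r s α t) (i, α, k) = σ t ∧
      tripleSum (localSlope r s α t) (i', α, k') = σ t :=
  exists_pair_of_attainsMin hT (h.minTwice_bridge t ht) (h.of_bridge t ht)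

theorem exists_loop (h : MinimalBlock T r s α y x z q σ) (hT : ∀ I ∈ T, IsTriple r I) {t : ℕ}
    (ht : t < s) : ∃ i k i' k', (i, k) ≠ (i', k') ∧ (i, α, k) ∈ T ∧ (i', α, k') ∈ T ∧
      (i ≤ α ∧ α ≤ k ∧ k ≤ r) ∧ (i' ≤ α ∧ α ≤ k' ∧ k' ≤ r) ∧
      (tripleSum (localSlope r s α t) (i, α, k) ≤ σ t ∧
        σ (t + 1) ≤ tripleSum (localSlope r s α (t + 1)) (i, α, k)) ∧
      tripleSum (localSlope r s α t) (i', α, k') ≤ σ t ∧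
        σ (t + 1) ≤ tripleSum (localSlope r s α (t + 1)) (i', α, k') :=
  exists_pair_of_attainsMin hT (h.minTwice_loop t ht) (h.of_loop t ht)

theorem ne_zero (h : MinimalBlock T r s α y x z q σ) (hT : ∀ I ∈ T, IsTriple r I) : α ≠ 0 := by
  rintro rfl
  obtain ⟨i, k, i', k', hne, -, -, _, _, hσ, hσ'⟩ := h.exists_bridge hT (Nat.zero_le s)
  rw [tripleSum_localSlope (by omega) (by omega)] at hσ hσ'
  rw [Ne, Prod.mk.injEq] at hne
  split_ifs at hσ hσ' <;> omega

theorem lt_last (h : MinimalBlock T r s α y x z q σ) (hT : ∀ I ∈ T, IsTriple r I) : α < r := by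
  by_contra! hα
  obtain ⟨i, k, i', k', hne, -, -, _, _, hσ, hσ'⟩ := h.exists_bridge hT le_rfl
  rw [tripleSum_localSlope (by omega) (by omega)] at hσ hσ'
  rw [Ne, Prod.mk.injEq] at hne
  split_ifs at hσ hσ' <;> omega

end MinimalBlock

/-! ### The surjective range -/

/-- The number of triples with median `α` in `surjectiveTriples`. -/
def fiberCard (r s α : ℕ) : ℕ := if α = 0 then s + 2 else if α = r then r + 1 else 2 * s + 2

/-- The number of triples with median `α` and a repeated entry `α` in `surjectiveTriples`. -/
def doubleCard (r s α : ℕ) : ℕ :=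
  if α = 0 then s + 2 else if α = r then r + 1 else if α ≤ s then s + 2 else s + 1

/-- The triples with median `α` in `surjectiveTriples`, labelled by `e < fiberCard r s α`: first the
triples with a repeated entry `α`, whose other entry is the label, then triples `i < α < k` with
`i = 0` or `k = r`, in the order of increasing `i + k`. -/
def labelTriple (r s α e : ℕ) : ℕ × ℕ × ℕ :=
  if e < doubleCard r s α then (min e α, α, max e α)
  else (α + 1 + (e - doubleCard r s α) - r, α, min (α + 1 + (e - doubleCard r s α)) r)

/-- A set of triples whose functions are independent in the surjective range. -/
def surjectiveTriples (r s : ℕ) : Finset (ℕ × ℕ × ℕ) :=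
  ((Finset.range (r + 1)).sigma fun α => Finset.range (fiberCard r s α)).image
    fun a => labelTriple r s a.1 a.2

section surjectiveTriples

variable {r s : ℕ}

theorem labelTriple_median (α e : ℕ) : (labelTriple r s α e).2.1 = α := by
  unfold labelTriple
  split_ifs <;> rfl

theorem labelTriple_injOn (hrs : s + 1 ≤ r) {α : ℕ} (hα : α ≤ r) :
    Set.InjOn (labelTriple r s α) {e | e < fiberCard r s α} := by
  intro e he e' he' heq
  simp only [Set.mem_ofPred_eq, fiberCard] at he he'
  unfold labelTriple doubleCard at heq
  split_ifs at he he' heq <;> simp only [Prod.mk.injEq] at heq <;>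
    obtain ⟨heq, -, heq'⟩ := heq <;> omega

theorem mem_surjectiveTriples_cases (hrs : s + 1 ≤ r) {i j k : ℕ}
    (hI : (i, j, k) ∈ surjectiveTriples r s) :
    i ≤ j ∧ j ≤ k ∧ k ≤ r ∧ ((j = 0 ∧ k ≤ s + 1) ∨ j = r ∨ (j < r ∧
      ((i < j ∧ k = j ∧ i ≤ s) ∨ (i = j ∧ k ≤ s + 1 ∧ j ≤ s) ∨
        (i < j ∧ j < k ∧ (i = 0 ∨ k = r) ∧ i + k ≤ j + s + 1 ∧ (j ≤ s → i + k ≤ j + s))))) := by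
  obtain ⟨⟨α, e⟩, hαe, hlabel⟩ := Finset.mem_image.1 hI
  simp only [Finset.mem_sigma, Finset.mem_range] at hαe hlabel
  obtain ⟨hα, he⟩ := hαe
  unfold labelTriple doubleCard at hlabel
  unfold fiberCard at he
  split_ifs at he hlabel <;> simp only [Prod.mk.injEq] at hlabel <;>
    obtain ⟨hi, hj, hk⟩ := hlabel <;> omega

theorem isTriple_of_mem_surjectiveTriples (hrs : s + 1 ≤ r) :
    ∀ I ∈ surjectiveTriples r s, IsTriple r I := by
  rintro ⟨i, j, k⟩ hI
  obtain ⟨hij, hjk, hkr, -⟩ := mem_surjectiveTriples_cases hrs hI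
  exact ⟨hij, hjk, hkr⟩

theorem sum_fiberCard (hr : 1 ≤ r) :
    ∑ α ∈ Finset.range (r + 1), fiberCard r s α = s + 2 + (r - 1) * (2 * s + 2) + (r + 1) := by
  obtain ⟨r, rfl⟩ := Nat.exists_eq_add_of_le' hr
  have hmid : ∀ α ∈ Finset.range r, fiberCard (r + 1) s (α + 1) = 2 * s + 2 := fun α hα => by
    have := Finset.mem_range.1 hα
    rw [fiberCard, if_neg (by omega), if_neg (by omega)]
  rw [Finset.sum_range_succ, Finset.sum_range_succ', Finset.sum_congr rfl hmid]
  simp only [fiberCard, Finset.sum_const, Finset.card_range, smul_eq_mul, if_true, if_false,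
    Nat.add_eq_zero_iff, one_ne_zero, and_false, Nat.add_sub_cancel]
  ring

theorem card_surjectiveTriples (hrs : s + 1 ≤ r) :
    (surjectiveTriples r s).card = s + 2 + (r - 1) * (2 * s + 2) + (r + 1) := by
  rw [surjectiveTriples, Finset.card_image_of_injOn, Finset.card_sigma]
  · simpa only [Finset.card_range] using sum_fiberCard (Nat.one_le_of_lt hrs)
  · rintro ⟨α, e⟩ he ⟨α', e'⟩ he' heq
    simp only [Finset.coe_sigma, Set.mem_sigma_iff, Finset.coe_range, Set.mem_Iio] at he he' heq
    obtain rfl : α = α' := by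
      simpa only [labelTriple_median] using congrArg (fun I => I.2.1) heq
    rw [labelTriple_injOn hrs (Nat.le_of_lt_succ he.1) he.2 he'.2 heq]

section MinimalBlock

variable {α : ℕ} {y : ℕ → ℕ × ℕ × ℕ → ℝ} {x z q : ℕ → ℝ} {σ : ℕ → ℤ}

theorem MinimalBlock.bridge_constraints (hrs : s + 1 ≤ r)
    (h : MinimalBlock (surjectiveTriples r s) r s α y x z q σ) {t : ℕ} (ht : t ≤ s) :
    (s < α → t < s) ∧ (α ≤ s → (t = α → σ t = 3 * r) ∧ (t + 1 = α → σ t = 3 * r - 3)) := by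
  have hT := isTriple_of_mem_surjectiveTriples (s := s) hrs
  have := h.ne_zero hT
  have := h.lt_last hT
  obtain ⟨i, k, i', k', hne, hI, hI', -, -, hσ, hσ'⟩ := h.exists_bridge hT ht
  obtain ⟨_, _, _, hcases⟩ := mem_surjectiveTriples_cases hrs hI
  obtain ⟨_, _, _, hcases'⟩ := mem_surjectiveTriples_cases hrs hI'
  rw [tripleSum_localSlope (by omega) (by omega)] at hσ hσ'
  rw [Ne, Prod.mk.injEq] at hne
  split_ifs at hσ hσ' <;> omega

/-- If `s < α`, no two triples with median `α` have the same slope on the last bridge of the block.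
If `α ≤ s`, the slopes on the bridges `α - 1` and `α` are forced to be `3 * r - 3` and `3 * r`, and
no two triples can be minimal at the loop between them. -/
theorem not_minimalBlock_surjectiveTriples (hrs : s + 1 ≤ r) :
    ¬MinimalBlock (surjectiveTriples r s) r s α y x z q σ := by
  intro h
  have hT := isTriple_of_mem_surjectiveTriples (s := s) hrs
  have hα := h.ne_zero hT
  have hαs : α ≤ s := by
    by_contra! hlt
    exact lt_irrefl s ((h.bridge_constraints hrs le_rfl).1 hlt)
  have hσ : σ α = 3 * r := ((h.bridge_constraints hrs hαs).2 hαs).1 rfl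
  have hσ' : σ (α - 1) = 3 * r - 3 :=
    ((h.bridge_constraints hrs (by omega)).2 hαs).2 (by omega)
  obtain ⟨i, k, i', k', hne, hI, hI', _, _, ⟨hle, hge⟩, hle', hge'⟩ :=
    h.exists_loop hT (show α - 1 < s by omega)
  rw [show α - 1 + 1 = α by omega] at hge hge'
  rw [tripleSum_localSlope (by omega) (by omega)] at hle hge hle' hge'
  rw [Ne, Prod.mk.injEq] at hne
  split_ifs at hle hge hle' hge' <;> omega

end MinimalBlock

end surjectiveTriples

/-! ### The injective range -/

section MinTwice

variable {ι κ : Type*} {A : Finset ι} {G : Finset κ}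

theorem MinTwice.comp {f : ι → ℝ} (h : MinTwice A f) {φ : κ → ι} (hφ : ∀ i ∈ G, φ i ∈ A)
    (hG : ∀ I, AttainsMin A f I → ∃ i ∈ G, I = φ i) : MinTwice G fun i => f (φ i) := by
  obtain ⟨I, J, hne, hI, hJ⟩ := h.exists_attainsMin
  obtain ⟨i, hi, rfl⟩ := hG I hI
  obtain ⟨j, hj, rfl⟩ := hG J hJ
  exact minTwice_of_attainsMin (fun hij => hne (congrArg φ hij))
    ⟨hi, fun k hk => hI.2 _ (hφ k hk)⟩ ⟨hj, fun k hk => hJ.2 _ (hφ k hk)⟩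

theorem MinTwice.comp_or {f : ι → ℝ} (h : MinTwice A f) {φ : κ → ι} (hφ : ∀ i ∈ G, φ i ∈ A) (K : ι)
    (hG : ∀ I, AttainsMin A f I → I = K ∨ ∃ i ∈ G, I = φ i) :
    (MinTwice G fun i => f (φ i)) ∨
      (∃ i ∈ G, f (φ i) - f K = 0) ∧ ∀ i ∈ G, 0 ≤ f (φ i) - f K := by
  obtain ⟨I, J, hne, hI, hJ⟩ := h.exists_attainsMin
  have heq : f I = f J := le_antisymm (hI.2 _ hJ.1) (hJ.2 _ hI.1)
  rcases hG I hI with rfl | ⟨i, hi, rfl⟩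
  · rcases hG J hJ with rfl | ⟨j, hj, rfl⟩
    · exact absurd rfl hne
    · exact .inr ⟨⟨j, hj, sub_eq_zero.2 heq.symm⟩, fun k hk => sub_nonneg.2 (hI.2 _ (hφ k hk))⟩
  · rcases hG J hJ with rfl | ⟨j, hj, rfl⟩
    · exact .inr ⟨⟨i, hi, sub_eq_zero.2 heq⟩, fun k hk => sub_nonneg.2 (hJ.2 _ (hφ k hk))⟩
    · exact .inl (minTwice_of_attainsMin (fun hij => hne (congrArg φ hij))
        ⟨hi, fun k hk => hI.2 _ (hφ k hk)⟩ ⟨hj, fun k hk => hJ.2 _ (hφ k hk)⟩)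

theorem MinTwice.exists_lt_attainsMin [LinearOrder ι] {f : ι → ℝ} (h : MinTwice A f) :
    ∃ i j, i < j ∧ AttainsMin A f i ∧ AttainsMin A f j := by
  obtain ⟨i, j, hne, hi, hj⟩ := h.exists_attainsMin
  rcases lt_or_gt_of_ne hne with hij | hji
  · exact ⟨i, j, hij, hi, hj⟩
  · exact ⟨j, i, hji, hj, hi⟩

theorem card_breakpoints_lt {G : Finset ℕ} (hG : G.Nonempty) (B : ℕ → ℝ) (M : Finset ℝ)
    (hM : ∀ m ∈ M, MinTwice G fun i => B i - i * m) : M.card < G.card := by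
  choose! a b hlt ha hb using fun m hm => (hM m hm).exists_lt_attainsMin
  -- The slope to the right of a breakpoint is at least the slope to the left of a later one.
  have hmono : ∀ m ∈ M, ∀ m' ∈ M, m < m' → b m < b m' := by
    intro m hm m' hm' hmm'
    have hmin := (hb m hm).2 _ (ha m' hm').1
    have hmin' := (ha m' hm').2 _ (hb m hm).1
    simp only at hmin hmin'
    refine lt_of_le_of_lt ?_ (hlt m' hm')
    by_contra! hcon
    have : (a m' : ℝ) < b m := by exact_mod_cast hcon
    nlinarith
  have hinj : Set.InjOn b M := fun m hm m' hm' heq =>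
    le_antisymm (not_lt.1 fun h => (hmono m' hm' m hm h).ne heq.symm)
      (not_lt.1 fun h => (hmono m hm m' hm' h).ne heq)
  calc M.card ≤ (G.erase (G.min' hG)).card := Finset.card_le_card_of_injOn b (fun m hm =>
        Finset.mem_erase.2
          ⟨((G.min'_le _ (ha m hm).1).trans_lt (hlt m hm)).ne', (hb m hm).1⟩) hinj
    _ < G.card := Finset.card_erase_lt_of_mem (G.min'_mem hG)

theorem le_of_add_mul_eq_zero {D e : κ → ℝ} {a b : ℝ} (he : ∀ i ∈ G, 0 < e i)
    (ha : ∃ i ∈ G, D i + a * e i = 0) (hb : ∀ i ∈ G, 0 ≤ D i + b * e i) : a ≤ b := by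
  obtain ⟨i, hi, hzero⟩ := ha
  exact le_of_mul_le_mul_right (by linarith [hb i hi]) (he i hi)

end MinTwice

/-- All weakly increasing triples of integers between `0` and `r`. -/
def allTriples (r : ℕ) : Finset (ℕ × ℕ × ℕ) :=
  (Finset.range (r + 1) ×ˢ Finset.range (r + 1) ×ˢ Finset.range (r + 1)).filter
    fun I => I.1 ≤ I.2.1 ∧ I.2.1 ≤ I.2.2

theorem mem_allTriples {r : ℕ} {I : ℕ × ℕ × ℕ} : I ∈ allTriples r ↔ IsTriple r I := by
  simp only [allTriples, Finset.mem_filter, Finset.mem_product, Finset.mem_range, IsTriple]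
  omega

/-- The smallest entries `i` of the triples `i < α < c - i ≤ r`, that is, of the triples with
distinct entries and median `α` whose outer entries have the sum `c`. -/
def medianGroup (r α c : ℕ) : Finset ℕ :=
  (Finset.range α).filter fun i => α + i < c ∧ c ≤ r + i

section medianGroup

variable {r s α c t i k : ℕ}

theorem mem_medianGroup : i ∈ medianGroup r α c ↔ i < α ∧ α + i < c ∧ c ≤ r + i := by
  simp [medianGroup]

theorem mem_allTriples_of_mem_medianGroup (hi : i ∈ medianGroup r α c) :
    (i, α, c - i) ∈ allTriples r := by
  obtain ⟨hiα, _, _⟩ := mem_medianGroup.1 hi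
  exact mem_allTriples.2 ⟨hiα.le, by dsimp only; omega, by dsimp only; omega⟩

theorem medianGroup_nonempty (hα : α ≠ 0) (hαr : α < r) (hc : α + 1 ≤ c) (hcr : c + 1 ≤ α + r) :
    (medianGroup r α c).Nonempty :=
  ⟨c - r, mem_medianGroup.2 ⟨by omega, by omega, by omega⟩⟩

theorem sum_card_medianGroup (r α : ℕ) :
    ∑ c ∈ Finset.Icc (α + 1) (α + r - 1), (medianGroup r α c).card = α * (r - α) := by
  have hfiber : ∀ i ∈ Finset.range α, ((Finset.Icc (α + 1) (α + r - 1)).bipartiteBelow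
      (fun c i => α + i < c ∧ c ≤ r + i) i).card = r - α := fun i hi => by
    have := Finset.mem_range.1 hi
    have heq : (Finset.Icc (α + 1) (α + r - 1)).bipartiteBelow
        (fun c i => α + i < c ∧ c ≤ r + i) i = Finset.Ioc (α + i) (r + i) := by
      ext c
      simp only [Finset.bipartiteBelow, Finset.mem_filter, Finset.mem_Icc, Finset.mem_Ioc]
      omega
    rw [heq, Nat.card_Ioc]
    omega
  calc ∑ c ∈ Finset.Icc (α + 1) (α + r - 1), (medianGroup r α c).card
      = ∑ i ∈ Finset.range α, ((Finset.Icc (α + 1) (α + r - 1)).bipartiteBelow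
          (fun c i => α + i < c ∧ c ≤ r + i) i).card :=
        Finset.sum_card_bipartiteAbove_eq_sum_card_bipartiteBelow _
    _ = α * (r - α) := by
        rw [Finset.sum_congr rfl hfiber, Finset.sum_const, Finset.card_range, smul_eq_mul]

theorem tripleSum_localRise_of_lt (hi : i < α) (hk : α < k) :
    tripleSum (localRise s α t) (i, α, k) = (α : ℤ) - i + s - t - 1 := by
  simp only [tripleSum, localRise, lt_irrefl, if_false, if_pos hi, if_neg hk.le.not_gt]
  ring

theorem tripleSum_localFall_of_lt (hi : i < α) (hk : α < k) :
    tripleSum (localFall α t) (i, α, k) = (α : ℤ) - k - t := by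
  simp only [tripleSum, localFall, lt_irrefl, if_false, if_pos hk, if_neg hi.le.not_gt]
  ring

theorem tripleSum_localSlope_of_mem (hi : i ∈ medianGroup r α c) :
    tripleSum (localSlope r s α t) (i, α, c - i) = 3 * r + s - α + t - c := by
  obtain ⟨hiα, _, _⟩ := mem_medianGroup.1 hi
  rw [tripleSum_localSlope hiα.le (by omega), if_pos hiα, if_pos (by omega)]
  push_cast [show i ≤ c by omega]
  ring

theorem tripleSum_localRise_self : tripleSum (localRise s α t) (α, α, α) = 0 := by
  simp [tripleSum, localRise]

theorem tripleSum_localFall_self : tripleSum (localFall α t) (α, α, α) = 0 := by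
  simp [tripleSum, localFall]

theorem midValue_of_mem {y : ℕ → ℕ × ℕ × ℕ → ℝ} {z q : ℕ → ℝ} (hi : i ∈ medianGroup r α c) :
    midValue r s α y z q t (i, α, c - i) =
      y t (i, α, c - i) + (3 * r + s - α + t - c) * z t + q t * (α + s - t - 1 - i) := by
  obtain ⟨hiα, _, _⟩ := mem_medianGroup.1 hi
  rw [midValue, tripleSum_localSlope_of_mem hi, tripleSum_localRise_of_lt hiα (by omega)]
  push_cast
  ring

theorem midValue_self {y : ℕ → ℕ × ℕ × ℕ → ℝ} {z q : ℕ → ℝ} :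
    midValue r s α y z q t (α, α, α) = y t (α, α, α) + (3 * r - 3 * α + 3 * t) * z t := by
  rw [midValue, tripleSum_localSlope le_rfl le_rfl, tripleSum_localRise_self]
  simp only [lt_irrefl, if_false]
  push_cast
  ring

end medianGroup

namespace MinimalBlock

variable {r s α c t : ℕ} {y : ℕ → ℕ × ℕ × ℕ → ℝ} {x z q : ℕ → ℝ} {σ : ℕ → ℤ}

/-- The sum of the outer entries of a triple `i < α < k` with the slope `σ t` on the bridge `t`. -/
def outerSum (r s α : ℕ) (σ : ℕ → ℤ) (t : ℕ) : ℤ := 3 * r + s - α + t - σ t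

/-- The bridges in the middle of the block on which the outer entries have sum `c`. -/
def fiber (r s α : ℕ) (σ : ℕ → ℤ) (c : ℕ) : Finset ℕ :=
  (Finset.Icc (α - 1) (s + α + 1 - r)).filter fun t => outerSum r s α σ t = c

/-- The loops between two bridges of `fiber`, labelled by the bridge before the loop. -/
def innerLoops (r s α : ℕ) (σ : ℕ → ℤ) (c : ℕ) : Finset ℕ :=
  (fiber r s α σ c).filter fun t => t + 1 ∈ fiber r s α σ c

/-- The triple `(α, α, α)` can be minimal on a bridge of the fiber of `c`, or at a loop between two
such bridges. -/
def Contaminated (r s α : ℕ) (σ : ℕ → ℤ) (c : ℕ) : Prop :=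
  ∃ t ∈ fiber r s α σ c, 2 * t + c = 2 * α + s ∨
    (t ∈ innerLoops r s α σ c ∧ 2 * t + c + 1 = 2 * α + s)

/-- The number `m` is a breakpoint of the minimum of the affine functions with slopes `-i`, for `i`
in `medianGroup r α c`, whose values at `0` are those of the triples at the start of the block. -/
def IsBreakpoint (r α : ℕ) (y : ℕ → ℕ × ℕ × ℕ → ℝ) (c : ℕ) (m : ℝ) : Prop :=
  MinTwice (medianGroup r α c) fun i => y 0 (i, α, c - i) - i * m

theorem mem_fiber : t ∈ fiber r s α σ c ↔
    (α ≤ t + 1 ∧ t ≤ s + α + 1 - r) ∧ outerSum r s α σ t = c := by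
  simp [fiber]

theorem mem_innerLoops : t ∈ innerLoops r s α σ c ↔
    t ∈ fiber r s α σ c ∧ t + 1 ∈ fiber r s α σ c :=
  Finset.mem_filter

section AllTriples

variable (h : MinimalBlock (allTriples r) r s α y x z q σ)

include h

theorem median_ne_zero : α ≠ 0 := h.ne_zero fun _ => mem_allTriples.1

theorem median_lt : α < r := h.lt_last fun _ => mem_allTriples.1

theorem outerSum_le_succ (ht : t < s) : outerSum r s α σ t ≤ outerSum r s α σ (t + 1) := by
  obtain ⟨i, k, i', k', hne, -, -, _, _, ⟨hle, hge⟩, hle', hge'⟩ :=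
    h.exists_loop (fun I => mem_allTriples.1) ht
  rw [tripleSum_localSlope (by omega) (by omega)] at hle hge hle' hge'
  rw [Ne, Prod.mk.injEq] at hne
  unfold outerSum
  by_contra! hcon
  split_ifs at hle hge hle' hge' <;> omega

theorem outerSum_mono {t' : ℕ} (htt : t ≤ t') (ht : t' ≤ s) :
    outerSum r s α σ t ≤ outerSum r s α σ t' := by
  induction t', htt using Nat.le_induction with
  | base => exact le_rfl
  | succ n _ ih => exact (ih (by omega)).trans (h.outerSum_le_succ (by omega))

theorem lt_outerSum_zero : (α : ℤ) + 1 ≤ outerSum r s α σ 0 := by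
  obtain ⟨i, k, i', k', hne, -, -, _, _, hσ, hσ'⟩ :=
    h.exists_bridge (fun I => mem_allTriples.1) (Nat.zero_le s)
  rw [tripleSum_localSlope (by omega) (by omega)] at hσ hσ'
  rw [Ne, Prod.mk.injEq] at hne
  unfold outerSum
  split_ifs at hσ hσ' <;> omega

theorem outerSum_last_lt : outerSum r s α σ s + 1 ≤ (α : ℤ) + r := by
  obtain ⟨i, k, i', k', hne, -, -, _, _, hσ, hσ'⟩ :=
    h.exists_bridge (fun I => mem_allTriples.1) le_rfl
  rw [tripleSum_localSlope (by omega) (by omega)] at hσ hσ'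
  rw [Ne, Prod.mk.injEq] at hne
  unfold outerSum
  split_ifs at hσ hσ' <;> omega

theorem lt_outerSum (ht : t ≤ s) : (α : ℤ) + 1 ≤ outerSum r s α σ t :=
  h.lt_outerSum_zero.trans (h.outerSum_mono (Nat.zero_le t) ht)

theorem outerSum_lt (ht : t ≤ s) : outerSum r s α σ t + 1 ≤ (α : ℤ) + r := by
  have := h.outerSum_mono ht le_rfl
  have := h.outerSum_last_lt
  omega

theorem le_of_mem_fiber (ht : t ∈ fiber r s α σ c) : t ≤ s := by
  have := (mem_fiber.1 ht).1
  have := h.median_lt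
  omega

theorem lt_of_mem_innerLoops (ht : t ∈ innerLoops r s α σ c) : t < s :=
  h.le_of_mem_fiber (mem_innerLoops.1 ht).2

theorem bridge_cases (hs : r ≤ s + 1) (ht : t ∈ fiber r s α σ c) {I : ℕ × ℕ × ℕ}
    (hI : AttainsMin (allTriples r) (y t) I) :
    (I = (α, α, α) ∧ 2 * t + c = 2 * α + s) ∨ ∃ i ∈ medianGroup r α c, I = (i, α, c - i) := by
  have hts := h.le_of_mem_fiber ht
  obtain ⟨⟨_, _⟩, hc⟩ := mem_fiber.1 ht
  have hlo := h.lt_outerSum hts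
  have hhi := h.outerSum_lt hts
  rw [hc] at hlo hhi
  have := h.median_lt
  obtain ⟨hmedian, hσ⟩ := h.of_bridge t hts I hI
  obtain ⟨i, j, k⟩ := I
  obtain ⟨hij, hjk, _⟩ : i ≤ j ∧ j ≤ k ∧ k ≤ r := mem_allTriples.1 hI.1
  obtain rfl : j = α := hmedian
  rw [tripleSum_localSlope hij hjk] at hσ
  unfold outerSum at hc
  simp only [mem_medianGroup, Prod.mk.injEq, true_and]
  by_cases hlt : i < j ∧ j < k
  · exact .inr ⟨i, by split_ifs at hσ <;> omega⟩
  · exact .inl (by split_ifs at hσ <;> omega)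

theorem loop_cases (hs : r ≤ s + 1) (ht : t ∈ innerLoops r s α σ c) {I : ℕ × ℕ × ℕ}
    (hI : AttainsMin (allTriples r) (midValue r s α y z q t) I) :
    (I = (α, α, α) ∧ 2 * t + c ≤ 2 * α + s ∧ 2 * α + s ≤ 2 * t + c + 2) ∨
      ∃ i ∈ medianGroup r α c, I = (i, α, c - i) := by
  have hts := h.lt_of_mem_innerLoops ht
  obtain ⟨ht, ht'⟩ := mem_innerLoops.1 ht
  obtain ⟨⟨_, _⟩, hc⟩ := mem_fiber.1 ht
  obtain ⟨⟨_, _⟩, hc'⟩ := mem_fiber.1 ht'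
  have hlo := h.lt_outerSum hts.le
  have hhi := h.outerSum_lt hts.le
  rw [hc] at hlo hhi
  have := h.median_lt
  obtain ⟨hmedian, hσ, hσ'⟩ := h.of_loop t hts I hI
  obtain ⟨i, j, k⟩ := I
  obtain ⟨hij, hjk, _⟩ : i ≤ j ∧ j ≤ k ∧ k ≤ r := mem_allTriples.1 hI.1
  obtain rfl : j = α := hmedian
  rw [tripleSum_localSlope hij hjk] at hσ hσ'
  unfold outerSum at hc hc'
  simp only [mem_medianGroup, Prod.mk.injEq, true_and]
  by_cases hlt : i < j ∧ j < k
  · exact .inr ⟨i, by split_ifs at hσ hσ' <;> omega⟩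
  · exact .inl (by split_ifs at hσ hσ' <;> omega)

theorem exists_value_eq (c : ℕ) (ht : t ≤ s) :
    ∃ b, ∀ i ∈ medianGroup r α c, y t (i, α, c - i) = y 0 (i, α, c - i) + b := by
  induction t with
  | zero => exact ⟨0, fun i _ => by simp⟩
  | succ t ih =>
    obtain ⟨b, hb⟩ := ih (by omega)
    refine ⟨b + (3 * r + s - α + t - c) * z t + q t * (2 * α + s - 2 * t - 1 - c) +
      (3 * r + s - α + (t + 1) - c) * x (t + 1), fun i hi => ?_⟩
    obtain ⟨hiα, _, _⟩ := mem_medianGroup.1 hi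
    rw [h.next t (by omega) _ (mem_allTriples_of_mem_medianGroup hi), midValue_of_mem hi, hb i hi,
      tripleSum_localSlope_of_mem hi, tripleSum_localFall_of_lt hiα (by omega)]
    push_cast [show i ≤ c by omega]
    ring

theorem isBreakpoint_zero (ht : t ≤ s)
    (hmin : MinTwice (medianGroup r α c) fun i => y t (i, α, c - i)) :
    IsBreakpoint r α y c 0 := by
  obtain ⟨b, hb⟩ := h.exists_value_eq c ht
  exact hmin.of_eq_add_const b fun i hi => by rw [hb i hi]; ring

theorem isBreakpoint_loop (ht : t < s)
    (hmin : MinTwice (medianGroup r α c) fun i => midValue r s α y z q t (i, α, c - i)) :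
    IsBreakpoint r α y c (q t) := by
  obtain ⟨b, hb⟩ := h.exists_value_eq c ht.le
  refine hmin.of_eq_add_const (b + (3 * r + s - α + t - c) * z t + q t * (α + s - t - 1))
    fun i hi => ?_
  rw [midValue_of_mem hi, hb i hi]
  ring

theorem isBreakpoint_zero_of_mem_fiber (hs : r ≤ s + 1) (ht : t ∈ fiber r s α σ c)
    (htie : 2 * t + c ≠ 2 * α + s) : IsBreakpoint r α y c 0 :=
  have hts := h.le_of_mem_fiber ht
  h.isBreakpoint_zero hts ((h.minTwice_bridge t hts).comp
    (fun _ => mem_allTriples_of_mem_medianGroup) fun _ hI =>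
      (h.bridge_cases hs ht hI).resolve_left fun hK => htie hK.2)

theorem isBreakpoint_of_mem_innerLoops (hs : r ≤ s + 1) (ht : t ∈ innerLoops r s α σ c)
    (hfar : ¬(2 * t + c ≤ 2 * α + s ∧ 2 * α + s ≤ 2 * t + c + 2)) : IsBreakpoint r α y c (q t) :=
  have hts := h.lt_of_mem_innerLoops ht
  h.isBreakpoint_loop hts ((h.minTwice_loop t hts).comp
    (fun _ => mem_allTriples_of_mem_medianGroup) fun _ hI =>
      (h.loop_cases hs ht hI).resolve_left fun hK => hfar hK.2)

theorem isBreakpoint_or_of_mem_innerLoops (hs : r ≤ s + 1) (ht : t ∈ innerLoops r s α σ c) :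
    IsBreakpoint r α y c (q t) ∨
      (∃ i ∈ medianGroup r α c,
        midValue r s α y z q t (i, α, c - i) - midValue r s α y z q t (α, α, α) = 0) ∧
      ∀ i ∈ medianGroup r α c,
        0 ≤ midValue r s α y z q t (i, α, c - i) - midValue r s α y z q t (α, α, α) :=
  have hts := h.lt_of_mem_innerLoops ht
  ((h.minTwice_loop t hts).comp_or (fun _ => mem_allTriples_of_mem_medianGroup) (α, α, α)
    fun _ hI => (h.loop_cases hs ht hI).imp_left And.left).imp_left (h.isBreakpoint_loop hts)

omit h in
theorem midValue_sub_of_tie (htie : 2 * t + c = 2 * α + s) {i : ℕ} (hi : i ∈ medianGroup r α c) :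
    midValue r s α y z q t (i, α, c - i) - midValue r s α y z q t (α, α, α) =
      y t (i, α, c - i) - y t (α, α, α) + q t * (α + s - t - 1 - i) := by
  have hc : (c : ℝ) = 2 * α + s - 2 * t := by
    have : (2 * t + c : ℝ) = 2 * α + s := by exact_mod_cast htie
    linarith
  rw [midValue_of_mem hi, midValue_self, hc]
  ring

theorem midValue_sub_of_tie_succ (ht : t < s) (htie : 2 * (t + 1) + c = 2 * α + s) {i : ℕ}
    (hi : i ∈ medianGroup r α c) :
    midValue r s α y z q t (i, α, c - i) - midValue r s α y z q t (α, α, α) =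
      y (t + 1) (i, α, c - i) - y (t + 1) (α, α, α) + q t * (α + s - (t + 1 : ℕ) - 1 - i) := by
  obtain ⟨hiα, _, _⟩ := mem_medianGroup.1 hi
  have hK : (α, α, α) ∈ allTriples r := mem_allTriples.2 ⟨le_rfl, le_rfl, h.median_lt.le⟩
  have hc : (c : ℝ) = 2 * α + s - 2 * (t + 1) := by
    have : (2 * (t + 1) + c : ℝ) = 2 * α + s := by exact_mod_cast htie
    linarith
  rw [h.next t ht _ (mem_allTriples_of_mem_medianGroup hi), h.next t ht _ hK,
    tripleSum_localFall_of_lt hiα (by omega), tripleSum_localFall_self,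
    tripleSum_localSlope_of_mem hi, tripleSum_localSlope le_rfl le_rfl]
  simp only [lt_irrefl, if_false]
  push_cast [show i ≤ c by omega]
  rw [hc]
  ring

/-- If both loops next to the bridge failed, the values of the group relative to `(α, α, α)` would
have minimum zero at both; on moving between the loops they all change in the same direction, since
the bottom lengths differ. -/
theorem isBreakpoint_or_of_tie (hs : r ≤ s + 1) (ht : t ∈ innerLoops r s α σ c)
    (ht' : t + 1 ∈ innerLoops r s α σ c) (htie : 2 * (t + 1) + c = 2 * α + s) :
    IsBreakpoint r α y c (q t) ∨ IsBreakpoint r α y c (q (t + 1)) := by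
  have hts := h.lt_of_mem_innerLoops ht
  have hts' := h.lt_of_mem_innerLoops ht'
  by_contra! hcon
  obtain ⟨⟨i, hi, hzero⟩, hnonneg⟩ :=
    (h.isBreakpoint_or_of_mem_innerLoops hs ht).resolve_left hcon.1
  obtain ⟨⟨j, hj, hzero'⟩, hnonneg'⟩ :=
    (h.isBreakpoint_or_of_mem_innerLoops hs ht').resolve_left hcon.2
  rw [h.midValue_sub_of_tie_succ hts htie hi] at hzero
  rw [midValue_sub_of_tie htie hj] at hzero'
  have hnonneg := fun i hi => (hnonneg i hi).trans_eq (h.midValue_sub_of_tie_succ hts htie hi)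
  have hnonneg' := fun i hi => (hnonneg' i hi).trans_eq (midValue_sub_of_tie htie hi)
  have hpos : ∀ i ∈ medianGroup r α c, (0 : ℝ) < α + s - (t + 1 : ℕ) - 1 - i := fun i hi => by
    obtain ⟨_, _, _⟩ := mem_medianGroup.1 hi
    have : ((t + 1 + 1 + i : ℕ) : ℝ) < (α + s : ℕ) := by exact_mod_cast (by omega)
    push_cast at this ⊢
    linarith
  have hq : q t = q (t + 1) := le_antisymm
    (le_of_add_mul_eq_zero hpos ⟨i, hi, hzero⟩ hnonneg')
    (le_of_add_mul_eq_zero hpos ⟨j, hj, hzero'⟩ hnonneg)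
  exact absurd (h.inj t hts (t + 1) hts' hq) (by omega)

theorem exists_forall_ne_isBreakpoint (hs : r ≤ s + 1) (c : ℕ) :
    ∃ u, ∀ t ∈ innerLoops r s α σ c, t ≠ u → IsBreakpoint r α y c (q t) := by
  by_cases htie : ∃ t ∈ innerLoops r s α σ c, t + 1 ∈ innerLoops r s α σ c ∧
      2 * (t + 1) + c = 2 * α + s
  · obtain ⟨t, ht, ht', htie⟩ := htie
    rcases h.isBreakpoint_or_of_tie hs ht ht' htie with hb | hb
    · refine ⟨t + 1, fun u hu hne => ?_⟩
      rcases eq_or_ne u t with rfl | hne'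
      · exact hb
      · exact h.isBreakpoint_of_mem_innerLoops hs hu (by omega)
    · refine ⟨t, fun u hu hne => ?_⟩
      rcases eq_or_ne u (t + 1) with rfl | hne'
      · exact hb
      · exact h.isBreakpoint_of_mem_innerLoops hs hu (by omega)
  · push Not at htie
    by_cases hnear : ∃ u ∈ innerLoops r s α σ c, 2 * u + c ≤ 2 * α + s ∧ 2 * α + s ≤ 2 * u + c + 2
    · obtain ⟨u, hu, _, _⟩ := hnear
      refine ⟨u, fun t ht hne => h.isBreakpoint_of_mem_innerLoops hs ht fun hnear' => ?_⟩
      rcases hne.lt_or_gt with hlt | hlt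
      · obtain rfl : u = t + 1 := by omega
        exact htie t ht hu (by omega)
      · obtain rfl : t = u + 1 := by omega
        exact htie u hu ht (by omega)
    · exact ⟨0, fun t ht _ => h.isBreakpoint_of_mem_innerLoops hs ht fun hb => hnear ⟨t, ht, hb⟩⟩

theorem card_fiber_le_card_innerLoops (c : ℕ) :
    (fiber r s α σ c).card ≤ (innerLoops r s α σ c).card + 1 := by
  rcases (fiber r s α σ c).eq_empty_or_nonempty with hempty | hne
  · simp [hempty]
  have hmax := Finset.max'_mem _ hne
  set b := (fiber r s α σ c).max' hne with hb
  have hbs := h.le_of_mem_fiber hmax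
  obtain ⟨⟨_, _⟩, _⟩ := mem_fiber.1 hmax
  have hsub : (fiber r s α σ c).erase b ⊆ innerLoops r s α σ c := fun t ht => by
    obtain ⟨htb, ht⟩ := Finset.mem_erase.1 ht
    have hlt : t < b := lt_of_le_of_ne (hb ▸ Finset.le_max' _ _ ht) htb
    obtain ⟨⟨_, _⟩, _⟩ := mem_fiber.1 ht
    have := h.outerSum_mono (show t ≤ t + 1 by omega) (show t + 1 ≤ s by omega)
    have := h.outerSum_mono (show t + 1 ≤ b by omega) hbs
    exact mem_innerLoops.2 ⟨ht, mem_fiber.2 ⟨⟨by omega, by omega⟩, by omega⟩⟩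
  rw [← Finset.card_erase_add_one hmax]
  exact Nat.succ_le_succ (Finset.card_le_card hsub)

theorem card_add_two_le_of_isBreakpoint (hG : (medianGroup r α c).Nonempty)
    (hzero : IsBreakpoint r α y c 0) (L : Finset ℕ) (hLs : ∀ t ∈ L, t < s)
    (hL : ∀ t ∈ L, IsBreakpoint r α y c (q t)) : L.card + 2 ≤ (medianGroup r α c).card := by
  classical
  have hinj : Set.InjOn q L := fun t ht t' ht' => h.inj t (hLs t ht) t' (hLs t' ht')
  have hnotMem : (0 : ℝ) ∉ L.image q := fun hmem => by
    obtain ⟨t, ht, hq⟩ := Finset.mem_image.1 hmem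
    exact (h.pos t (hLs t ht)).ne' hq
  have hcard := card_breakpoints_lt hG (fun i => y 0 (i, α, c - i)) (insert 0 (L.image q))
    (Finset.forall_mem_insert _ _ _ |>.2 ⟨hzero, Finset.forall_mem_image.2 hL⟩)
  rwa [Finset.card_insert_of_notMem hnotMem, Finset.card_image_of_injOn hinj] at hcard

theorem card_fiber_lt (hs : r ≤ s + 1) (hG : (medianGroup r α c).Nonempty)
    (hc : ¬Contaminated r s α σ c) : (fiber r s α σ c).card < (medianGroup r α c).card := by
  rcases (fiber r s α σ c).eq_empty_or_nonempty with hempty | ⟨t₀, ht₀⟩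
  · simpa only [hempty, Finset.card_empty] using hG.card_pos
  have hclean : ∀ t ∈ fiber r s α σ c, 2 * t + c ≠ 2 * α + s :=
    fun t ht htie => hc ⟨t, ht, .inl htie⟩
  have := h.card_add_two_le_of_isBreakpoint hG
    (h.isBreakpoint_zero_of_mem_fiber hs ht₀ (hclean t₀ ht₀)) (innerLoops r s α σ c)
    (fun t => h.lt_of_mem_innerLoops) fun t ht =>
      h.isBreakpoint_of_mem_innerLoops hs ht fun hnear => by
        obtain ⟨htf, htf'⟩ := mem_innerLoops.1 ht
        have := hclean _ htf
        have := hclean _ htf'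
        exact hc ⟨t, htf, .inr ⟨ht, by omega⟩⟩
  have := h.card_fiber_le_card_innerLoops c
  omega

theorem card_fiber_le (hs : r ≤ s + 1) (hG : (medianGroup r α c).Nonempty) :
    (fiber r s α σ c).card ≤ (medianGroup r α c).card := by
  rcases le_or_gt (fiber r s α σ c).card 1 with hone | hone
  · exact hone.trans hG.card_pos
  obtain ⟨t₁, ht₁, t₂, ht₂, hne⟩ := Finset.one_lt_card.1 hone
  have hzero : IsBreakpoint r α y c 0 := by
    by_cases htie : 2 * t₁ + c = 2 * α + s
    · exact h.isBreakpoint_zero_of_mem_fiber hs ht₂ (by omega)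
    · exact h.isBreakpoint_zero_of_mem_fiber hs ht₁ htie
  obtain ⟨u, hu⟩ := h.exists_forall_ne_isBreakpoint hs c
  have := h.card_add_two_le_of_isBreakpoint hG hzero ((innerLoops r s α σ c).erase u)
    (fun t ht => h.lt_of_mem_innerLoops (Finset.mem_of_mem_erase ht))
    fun t ht => hu t (Finset.mem_of_mem_erase ht) (Finset.ne_of_mem_erase ht)
  have := Finset.pred_card_le_card_erase (s := innerLoops r s α σ c) (a := u)
  have := h.card_fiber_le_card_innerLoops c
  omega

theorem contaminated_le {c' : ℕ} (hc : Contaminated r s α σ c) (hc' : Contaminated r s α σ c') :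
    c ≤ c' := by
  by_contra! hlt
  obtain ⟨t, ht, htc⟩ := hc
  obtain ⟨t', ht', htc'⟩ := hc'
  have := (mem_fiber.1 ht).2
  have := (mem_fiber.1 ht').2
  rcases le_or_gt t t' with hle | hgt
  · have := h.outerSum_mono hle (h.le_of_mem_fiber ht')
    omega
  · omega

open Classical in
theorem card_filter_contaminated_le (A : Finset ℕ) :
    (A.filter fun c => Contaminated r s α σ c).card ≤ 1 :=
  Finset.card_le_one.2 fun _ hc _ hc' =>
    have hc := (Finset.mem_filter.1 hc).2
    have hc' := (Finset.mem_filter.1 hc').2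
    le_antisymm (h.contaminated_le hc hc') (h.contaminated_le hc' hc)

theorem sum_card_fiber (hs : r ≤ s + 1) :
    ∑ c ∈ Finset.Icc (α + 1) (α + r - 1), (fiber r s α σ c).card = s + 3 - r := by
  have hα := h.median_lt
  have hα0 := h.median_ne_zero
  have hmaps : ∀ t ∈ Finset.Icc (α - 1) (s + α + 1 - r),
      (outerSum r s α σ t).toNat ∈ Finset.Icc (α + 1) (α + r - 1) := fun t ht => by
    have := Finset.mem_Icc.1 ht
    have := h.lt_outerSum (show t ≤ s by omega)
    have := h.outerSum_lt (show t ≤ s by omega)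
    rw [Finset.mem_Icc]
    omega
  have hfiber : ∀ c ∈ Finset.Icc (α + 1) (α + r - 1), fiber r s α σ c =
      (Finset.Icc (α - 1) (s + α + 1 - r)).filter fun t => (outerSum r s α σ t).toNat = c :=
    fun c hc => Finset.filter_congr fun t _ => by
      have := Finset.mem_Icc.1 hc
      omega
  rw [Finset.sum_congr rfl fun c hc => congrArg Finset.card (hfiber c hc),
    ← Finset.card_eq_sum_card_fiberwise hmaps, Nat.card_Icc]
  omega

open Classical in
theorem lt_mul_of_allTriples (hs : r ≤ s + 1) : s < α * (r - α) := by
  have hα := h.median_lt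
  have hα0 := h.median_ne_zero
  have hle : ∀ c ∈ Finset.Icc (α + 1) (α + r - 1), (fiber r s α σ c).card + 1 ≤
      (medianGroup r α c).card + if Contaminated r s α σ c then 1 else 0 := fun c hc => by
    obtain ⟨_, _⟩ := Finset.mem_Icc.1 hc
    have hG := medianGroup_nonempty hα0 hα (show α + 1 ≤ c by omega) (by omega)
    split_ifs with hcont
    · exact Nat.succ_le_succ (h.card_fiber_le hs hG)
    · exact h.card_fiber_lt hs hG hcont
  have hsum := Finset.sum_le_sum hle
  rw [Finset.sum_add_distrib, Finset.sum_add_distrib, ← Finset.card_filter, h.sum_card_fiber hs,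
    sum_card_medianGroup, Finset.sum_const, Nat.card_Icc, smul_eq_mul, mul_one] at hsum
  have := h.card_filter_contaminated_le (Finset.Icc (α + 1) (α + r - 1))
  omega

end AllTriples

end MinimalBlock

theorem le_add_one_of_sq_le {r s : ℕ} (hrs : r ^ 2 ≤ 4 * s) : r ≤ s + 1 := by
  nlinarith [sq_nonneg ((r : ℤ) - 2)]

theorem not_minimalBlock_allTriples {r s α : ℕ} (hrs : r ^ 2 ≤ 4 * s)
    {y : ℕ → ℕ × ℕ × ℕ → ℝ} {x z q : ℕ → ℝ} {σ : ℕ → ℤ} :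
    ¬MinimalBlock (allTriples r) r s α y x z q σ := by
  intro h
  have hlt := h.lt_mul_of_allTriples (le_add_one_of_sq_le hrs)
  obtain ⟨d, rfl⟩ := Nat.exists_eq_add_of_le h.median_lt.le
  rw [Nat.add_sub_cancel_left] at hlt
  zify at *
  nlinarith [sq_nonneg ((α : ℤ) - d)]

theorem card_allTriples (r : ℕ) : (allTriples r).card = (r + 3).choose 3 := by
  have himage : (allTriples r).image (tripleSym r) = Finset.univ := by
    ext I
    obtain ⟨J, hJ, rfl⟩ := exists_tripleSym_eq r I
    simpa using ⟨_, _, _, mem_allTriples.2 hJ, rfl⟩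
  rw [← Finset.card_image_of_injOn ((tripleSym_injOn r).mono fun I hI => mem_allTriples.1 hI),
    himage, Finset.card_univ, Sym.card_sym_eq_choose, Fintype.card_fin]
  rfl

section TropicalMaximalRank

variable {r s ρ : ℕ}

open ChainOfLoops in
theorem tropicalMaximalRank_of_not_minimalBlock (hs : 1 ≤ s) {T : Finset (ℕ × ℕ × ℕ)}
    (hT : ∀ I ∈ T, IsTriple r I) (hsep : ∀ I ∈ T, I.1 + I.2.2 ≤ I.2.1 + s + 1 ∨ I.2.1 = r)
    (hblock : ∀ α y x z q σ, ¬MinimalBlock T r s α y x z q σ)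
    (hcard : (T.card : ℤ) =
      min ((r + 3).choose 3 : ℤ) (3 * degreeOf r s ρ - genusOf r s ρ + 1)) :
    TropicalMaximalRank r s ρ 3 := by
  refine ⟨admissibleConst r s, fun Γ hΓ => ?_⟩
  have hP := slopePath_blockSlope (r := r) (ρ := ρ) hs
  have hΓ' := hΓ.shortBottoms
  obtain ⟨ψ, hψ, hdep⟩ := exists_tripleFunctions hP hΓ'
  refine ⟨baseDivisor Γ r s (blockSpecial r s), deg_baseDivisor, hasRank_baseDivisor hP hΓ',
    vertexAvoiding_baseDivisor hP hΓ',
    fun i => endDivisor Γ r (blockSlope r s) (blockSpecial r s) i, ψ,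
    isEndDivisor_endDivisor hP hΓ', hψ, T.image (tripleSym r), ?_, fun hcon => ?_⟩
  · rw [Finset.card_image_of_injOn ((tripleSym_injOn r).mono hT)]
    exact hcard
  · obtain ⟨w, hw⟩ := hdep T hT hcon
    obtain ⟨α, -, y, x, z, q, σ, hb⟩ := exists_minimalBlock hs hΓ hT hsep hw
    exact hblock α y x z q σ hb

theorem six_mul_choose_three (r : ℕ) : 6 * (r + 3).choose 3 = (r + 3) * (r + 2) * (r + 1) := by
  have := Nat.descFactorial_eq_factorial_mul_choose (r + 3) 3
  simp [Nat.descFactorial, Nat.factorial] at this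
  linarith

theorem injectiveRange_three (hr : 1 ≤ r) (hrs : r ^ 2 ≤ 4 * s) : InjectiveRange r s ρ 3 := by
  have hchoose := six_mul_choose_three r
  unfold InjectiveRange degreeOf genusOf
  zify at *
  have hs : (0 : ℤ) ≤ (2 * r - 1) * (4 * s - r ^ 2) := mul_nonneg (by linarith) (by linarith)
  have hr' : (0 : ℤ) ≤ (r - 2) * (4 * r - 7) := by
    rcases hr.eq_or_lt with heq | hlt
    · rw [← heq]; norm_num
    · exact mul_nonneg (by omega) (by omega)
  have := mul_nonneg (show (0 : ℤ) ≤ r by omega) hr'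
  have := Int.natCast_nonneg ρ
  linarith

theorem tropicalMaximalRank_three_of_sq_le (hr : 1 ≤ r) (hs : 1 ≤ s) (hrs : r ^ 2 ≤ 4 * s) :
    TropicalMaximalRank r s ρ 3 := by
  refine tropicalMaximalRank_of_not_minimalBlock hs (fun I => mem_allTriples.1) (fun I hI => ?_)
    (fun _ _ _ _ _ _ => not_minimalBlock_allTriples hrs) ?_
  · obtain ⟨_, _, _⟩ := mem_allTriples.1 hI
    have := le_add_one_of_sq_le hrs
    omega
  · rw [card_allTriples, min_eq_left]
    exact_mod_cast injectiveRange_three hr hrs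

theorem card_surjectiveTriples_eq_degree (hrs : s + 1 ≤ r) :
    ((surjectiveTriples r s).card : ℤ) = 3 * degreeOf r s 0 - genusOf r s 0 + 1 := by
  rw [card_surjectiveTriples hrs]
  obtain ⟨r, rfl⟩ := Nat.exists_eq_add_of_le' (Nat.one_le_of_lt hrs)
  simp only [degreeOf, genusOf, Nat.add_sub_cancel]
  push_cast
  ring

theorem surjectiveRange_three (hrs : s + 1 ≤ r) : SurjectiveRange r s 0 3 := by
  have hle : (surjectiveTriples r s).card ≤ (r + 3).choose 3 :=
    (Finset.card_le_card fun I hI =>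
      mem_allTriples.2 (isTriple_of_mem_surjectiveTriples hrs I hI)).trans_eq (card_allTriples r)
  unfold SurjectiveRange
  push_cast
  rw [← card_surjectiveTriples_eq_degree hrs]
  exact_mod_cast hle

theorem tropicalMaximalRank_three_of_lt (hs : 1 ≤ s) (hrs : s + 1 ≤ r) :
    TropicalMaximalRank r s 0 3 := by
  refine tropicalMaximalRank_of_not_minimalBlock hs (isTriple_of_mem_surjectiveTriples hrs)
    (fun ⟨i, j, k⟩ hI => ?_) (fun _ _ _ _ _ _ => not_minimalBlock_surjectiveTriples hrs) ?_
  · obtain ⟨_, _, _, _⟩ := mem_surjectiveTriples_cases hrs hI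
    simp only
    omega
  · rw [card_surjectiveTriples_eq_degree hrs, min_eq_right]
    exact_mod_cast surjectiveRange_three hrs

end TropicalMaximalRank

theorem theorem1p3_general (r s ρ : ℕ) (hr : 1 ≤ r) (hs : 1 ≤ s) :
    ((r : ℝ) ^ 2 / 4 ≤ s → InjectiveRange r s ρ 3 ∧ TropicalMaximalRank r s ρ 3) ∧
    (ρ = 0 → s + 1 ≤ r → SurjectiveRange r s ρ 3 ∧ TropicalMaximalRank r s ρ 3) := by
  refine ⟨fun h => ?_, ?_⟩
  · have hrs : r ^ 2 ≤ 4 * s := by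
      have : (r : ℝ) ^ 2 ≤ 4 * s := by linarith
      exact_mod_cast this
    exact ⟨injectiveRange_three hr hrs, tropicalMaximalRank_three_of_sq_le hr hs hrs⟩
  · rintro rfl hrs
    exact ⟨surjectiveRange_three hrs, tropicalMaximalRank_three_of_lt hs hrs⟩

theorem theorem1p3 (r s ρ : ℕ) (hr : 3 ≤ r) (hs : 1 ≤ s) :
    ((r : ℝ) ^ 2 / 4 ≤ s → InjectiveRange r s ρ 3 ∧ TropicalMaximalRank r s ρ 3) ∧
    (ρ = 0 → s + 1 ≤ r → SurjectiveRange r s ρ 3 ∧ TropicalMaximalRank r s ρ 3) :=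
  theorem1p3_general r s ρ (by omega) hs
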